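/- For a field $K$ of characteristic $\neq 2$ let $W(K)$ be its Witt ring: the quotient of the Grothendieck ring of isometry classes of non-degenerate quadratic forms over $K$ (under $\oplus,\otimes$) by the ideal generated by the metabolic forms; it is functorial in $K$ through extension of scalars. Let $\mathrm{Et}_n(K)$ be the set of isomorphism classes of étale $K$-algebras of rank $n$, and for $\mathbf n=(n_0,\dots,n_r)\in\mathbb N^{r+1}$ put $\mathrm{Et}_{\mathbf n}=\mathrm{Et}_{n_0}\times\dots\times\mathrm{Et}_{n_r}$, which is functorial through $A\mapsto A\otimes_K L$. For a field $k$ of characteristic $\ne 2$, $\mathrm{Inv}_k(\mathbf n)$ is the ring of natural transformations $\mathrm{Et}_{\mathbf n}\to W$ on the category of field extensions of $k$; it is a $W(k)$-algebra. For a set $S$ of primes, $\mathrm{Inv}_S(\mathbf n)$ is the ring of natural transformations $\mathrm{Et}_{\mathbf n}\to W$ on the category of all fields of characteristic $\neq 2$ whose characteristic is $0$ or not in $S$; it is an algebra over $W(\mathcal P\setminus S):=\prod_{k} W(k)$, the product over all prime fields $k$ with $\operatorname{char} k\neq 2$ and $\operatorname{char} k\notin S$, where the factor $W(k)$ acts on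 the values at fields containing $k$. Write $\mathrm{Inv}(\mathbf n)$ for $\mathrm{Inv}_\emptyset(\mathbf n)$. **Theorem.** (1) For every field $k$ of characteristic $\neq 2$ and every $\mathbf n\in\mathbb N^{r+1}$, $\mathrm{Inv}_k(\mathbf n)$ is a free $W(k)$-module. (2) For all $n,i\in\mathbb N$, with $m=\lfloor n/2\rfloor$, there is a unique $\beta_i^n\in\mathrm{Inv}(n)$ such that for every field $K$ of characteristic $\ne2$ and all $a_1,\dots,a_m\in K^\times$ $$\beta_i^n\bigl(\mathcal E_{a_1}\times\dots\times\mathcal E_{a_m}\times K^{n-2m}\bigr)=\sum_{J\subseteq\{1,\dots,m\},\ |J|=i}\ \prod_{j\in J}\mathrm{Tr}(\mathcal E_{a_j})\in W(K),$$ where $\mathcal E_a=K[x]/(x^2-a)$ and $\mathrm{Tr}(A)$ is the class of the trace form $x\mapsto \mathrm{tr}_{A/K}(x^2)$. For every set $S$ of primes containing $2$ and every $\mathbf n=(n_0,\dots,n_r)\in\mathbb N^{r+1}$, the $W(\mathcal P\setminus S)$-module $\mathrm{Inv}_S(\mathbf n)$ is free, with basis the invariants $$\beta_{\mathbf i}(A_0,\dots,A_r)=\prod_{j=0}^r\beta_{i_j}^{n_j}(A_j),\qquad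 \mathbf i\in\mathbb N^{r+1},\ 0\le i_j\le\lfloor n_j/2\rfloor\text{ for all }j .$$ -/

import Mathlib

open scoped TensorProduct
universe u v

namespace WittEt

/-! ### The Grothendieck ring of a commutative semiring -/

section Grothendieck

/-- The ring completion of a commutative semiring `R`: formal differences of elements of `R`. -/
def GrothendieckRing (R : Type v) [CommSemiring R] : Type v := Algebra.GrothendieckAddGroup R

namespace GrothendieckRing

variable {R : Type v} [CommSemiring R]

noncomputable instance : AddCommGroup (GrothendieckRing R) :=
  inferInstanceAs (AddCommGroup (Algebra.GrothendieckAddGroup R))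

/-- The canonical map from a semiring to its ring completion, as an additive map. -/
noncomputable def of : R →+ GrothendieckRing R := Algebra.GrothendieckAddGroup.of

theorem ind {P : GrothendieckRing R → Prop} (h : ∀ a b, P (of a - of b)) (x) : P x := by
  induction x using AddLocalization.ind with
  | _ y =>
    obtain ⟨a, b⟩ := y
    have hab : (AddLocalization.mk a b : Algebra.GrothendieckAddGroup R) =
        AddLocalization.mk a 0 - AddLocalization.mk b.1 0 := by
      rw [Algebra.GrothendieckAddGroup.mk_sub_mk]
      congr 1
      · simp
      · ext; simp
    change P (AddLocalization.mk a b : Algebra.GrothendieckAddGroup R)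
    rw [hab]
    exact h a b

/-- Additive maps out of the ring completion. -/
noncomputable def liftAdd {G : Type*} [AddCommGroup G] (f : R →+ G) : GrothendieckRing R →+ G :=
  Algebra.GrothendieckAddGroup.lift f

@[simp] theorem liftAdd_of {G : Type*} [AddCommGroup G] (f : R →+ G) (a : R) :
    liftAdd f (of a) = f a :=
  DFunLike.congr_fun (Algebra.GrothendieckAddGroup.lift.symm_apply_apply f) a

/-- Multiplication on the ring completion, as the biadditive extension of that of `R`. -/
noncomputable def mulHom : GrothendieckRing R →+ GrothendieckRing R →+ GrothendieckRing R :=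
  liftAdd
    { toFun := fun a => liftAdd (of.comp (AddMonoidHom.mulLeft a))
      map_zero' := by
        ext x
        induction x using ind with
        | h a b => simp
      map_add' := fun a b => by
        ext x
        induction x using ind with
        | h c d => simp [add_mul]; abel }

noncomputable instance : Mul (GrothendieckRing R) := ⟨fun x y => mulHom x y⟩

theorem of_mul_of (a b : R) : (of a * of b : GrothendieckRing R) = of (a * b) := by
  change mulHom (of a) (of b) = _
  simp [mulHom]

noncomputable instance : NonUnitalNonAssocRing (GrothendieckRing R) where
  left_distrib x y z := map_add (mulHom x) y z
  right_distrib x y z := by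
    change mulHom (x + y) z = mulHom x z + mulHom y z
    simp
  zero_mul x := by
    change mulHom 0 x = 0
    simp
  mul_zero x := map_zero (mulHom x)

noncomputable instance : CommRing (GrothendieckRing R) where
  mul_assoc x y z := by
    induction x using ind with
    | h a b =>
      induction y using ind with
      | h c d =>
        induction z using ind with
        | h e f => simp only [sub_mul, mul_sub, of_mul_of, mul_assoc]
  mul_comm x y := by
    induction x using ind with
    | h a b =>
      induction y using ind with
      | h c d =>
        simp only [sub_mul, mul_sub, of_mul_of, mul_comm a, mul_comm b]
        abel
  one := of 1
  one_mul x := by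
    change of 1 * x = x
    induction x using ind with
    | h a b => simp only [mul_sub, of_mul_of, one_mul]
  mul_one x := by
    change x * of 1 = x
    induction x using ind with
    | h a b => simp only [sub_mul, of_mul_of, mul_one]

/-- The canonical homomorphism from a semiring to its ring completion. -/
noncomputable def ofHom : R →+* GrothendieckRing R where
  __ := of
  map_one' := rfl
  map_mul' a b := (of_mul_of a b).symm

/-- Functoriality of the ring completion. -/
noncomputable def map {T : Type*} [CommSemiring T] (f : R →+* T) :
    GrothendieckRing R →+* GrothendieckRing T where
  __ := liftAdd (of.comp f.toAddMonoidHom)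
  map_one' := by
    change liftAdd _ (of 1) = of 1
    simp
  map_mul' x y := by
    change liftAdd _ _ = liftAdd _ _ * liftAdd _ _
    induction x using ind with
    | h a b =>
      induction y using ind with
      | h c d => simp [sub_mul, mul_sub, of_mul_of]

theorem map_ofHom {T : Type*} [CommSemiring T] (f : R →+* T) (a : R) :
    map f (ofHom a) = ofHom (f a) :=
  liftAdd_of _ a

end GrothendieckRing

end Grothendieck

/-! ### Quadratic spaces and the Witt ring of a field of characteristic different from two -/

section Quadratic

open QuadraticMap

/-- In this development `2 ≠ 0` is an instance argument; the inverse of `2` is derived from it. -/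
noncomputable scoped instance invertibleTwo (K : Type u) [Field K] [NeZero (2 : K)] :
    Invertible (2 : K) :=
  invertibleOfNonzero (NeZero.ne 2)

/-- A non-degenerate quadratic form over `K` on a finite-dimensional vector space. -/
structure QuadSpace (K : Type u) [Field K] : Type (u + 1) where
  carrier : Type u
  [addCommGroup : AddCommGroup carrier]
  [module : Module K carrier]
  [finite : Module.Finite K carrier]
  form : QuadraticForm K carrier
  nondegenerate : form.polarBilin.Nondegenerate

namespace QuadSpace

attribute [instance] addCommGroup module finite

theorem nondegenerate_iff {K : Type u} [Field K] {V : Type*} [AddCommGroup V] [Module K V]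
    (q : QuadraticForm K V) :
    q.polarBilin.Nondegenerate ↔ ∀ x, (∀ y, polar q x y = 0) → x = 0 := by
  constructor
  · intro h x hx
    exact h.1 x hx
  · intro h
    refine ⟨fun x hx => h x hx, fun y hy => h y fun x => ?_⟩
    rw [polar_comm]
    exact hy x

variable {K : Type u} [Field K]

theorem tmul_nondegenerate {V W : Type*} [AddCommGroup V] [Module K V] [AddCommGroup W]
    [Module K W] [Module.Finite K V] [Module.Finite K W] {B : LinearMap.BilinForm K V}
    {C : LinearMap.BilinForm K W} (hB : B.Nondegenerate) (hC : C.Nondegenerate)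
    (hs : (LinearMap.BilinForm.tmul B C).IsSymm) :
    (LinearMap.BilinForm.tmul B C).Nondegenerate := by
  let e : (V ⊗[K] W) ≃ₗ[K] Module.Dual K (V ⊗[K] W) :=
    (TensorProduct.congr (B.toDual hB) (C.toDual hC)).trans
      (TensorProduct.dualDistribEquiv K V W)
  have he : (LinearMap.BilinForm.tmul B C : V ⊗[K] W →ₗ[K] _) = e.toLinearMap := by
    ext v w v' w'
    simp [e, TensorProduct.dualDistribEquiv, LinearMap.BilinForm.toDual_def, mul_comm]
  have hl : (LinearMap.BilinForm.tmul B C).SeparatingLeft := by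
    rw [LinearMap.separatingLeft_iff_ker_eq_bot]
    have : LinearMap.ker (LinearMap.BilinForm.tmul B C) = LinearMap.ker e.toLinearMap := by
      rw [← he]
    rw [this]
    exact e.ker
  exact (hs.isRefl.nondegenerate_iff_separatingLeft).mpr hl

theorem baseChange_nondegenerate {L : Type*} [Field L] [Algebra K L] {V : Type*} [AddCommGroup V]
    [Module K V] [Module.Finite K V] {B : LinearMap.BilinForm K V} (hB : B.Nondegenerate) :
    (LinearMap.BilinForm.baseChange L B).Nondegenerate := by
  classical
  let b := Module.finBasis K V
  rw [LinearMap.BilinForm.nondegenerate_iff_det_ne_zero (b.baseChange L)]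
  rw [LinearMap.BilinForm.nondegenerate_iff_det_ne_zero b] at hB
  have : LinearMap.BilinForm.toMatrix (b.baseChange L) (LinearMap.BilinForm.baseChange L B) =
      (LinearMap.BilinForm.toMatrix b B).map (algebraMap K L) := by
    ext i j
    simp [LinearMap.BilinForm.toMatrix_apply, Algebra.algebraMap_eq_smul_one]
  rw [this, ← RingHom.mapMatrix_apply, ← RingHom.map_det]
  simpa using hB

variable [NeZero (2 : K)]

theorem nondegenerate_iff_associated {V : Type*} [AddCommGroup V] [Module K V]
    (q : QuadraticForm K V) :
    q.polarBilin.Nondegenerate ↔ (associated (R := K) q).Nondegenerate := by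
  have h2 : (2 : K) ≠ 0 := NeZero.ne 2
  rw [nondegenerate_iff]
  have key : ∀ x y, polar q x y = 2 * associated (R := K) q x y := by
    intro x y
    rw [← QuadraticMap.polarBilin_apply_apply, ← two_nsmul_associated K q]
    simp [two_mul, two_smul]
  have hs : ∀ x y, associated (R := K) q x y = associated (R := K) q y x := by
    intro x y
    have := key x y
    rw [polar_comm, key y x] at this
    exact (mul_left_cancel₀ h2 this).symm
  constructor
  · intro h
    refine ⟨fun x hx => h x fun y => by rw [key, hx, mul_zero],
      fun y hy => h y fun x => by rw [key, hs, hy, mul_zero]⟩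
  · intro h x hx
    exact h.1 x fun y => by
      have := hx y
      rw [key] at this
      exact (mul_eq_zero.mp this).resolve_left h2

/-- The orthogonal sum. -/
def add (V W : QuadSpace K) : QuadSpace K where
  carrier := V.carrier × W.carrier
  form := V.form.prod W.form
  nondegenerate := by
    rw [nondegenerate_iff]
    rintro ⟨x, y⟩ h
    have hx : x = 0 := (nondegenerate_iff _).mp V.nondegenerate x fun z => by
      simpa using h (z, 0)
    have hy : y = 0 := (nondegenerate_iff _).mp W.nondegenerate y fun z => by
      simpa using h (0, z)
    rw [hx, hy]
    rfl

/-- The zero-dimensional form. -/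
def zero : QuadSpace K where
  carrier := PUnit
  form := 0
  nondegenerate := by
    rw [nondegenerate_iff]
    intro x _
    rfl

/-- The form `x ↦ x ^ 2` on `K`. -/
def one : QuadSpace K where
  carrier := K
  form := sq
  nondegenerate := by
    rw [nondegenerate_iff]
    intro x h
    have h1 := h 1
    have h2 : (2 : K) ≠ 0 := NeZero.ne 2
    simp only [polar, sq_apply] at h1
    have : 2 * x = 0 := by linear_combination h1
    exact (mul_eq_zero.mp this).resolve_left h2

/-- The tensor product, with `(q ⊗ q') (x ⊗ y) = q x * q' y`. -/
noncomputable def mul (V W : QuadSpace K) : QuadSpace K where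
  carrier := V.carrier ⊗[K] W.carrier
  form := V.form.tmul W.form
  nondegenerate := by
    rw [nondegenerate_iff_associated, QuadraticForm.associated_tmul]
    refine tmul_nondegenerate ((nondegenerate_iff_associated _).mp V.nondegenerate)
      ((nondegenerate_iff_associated _).mp W.nondegenerate) ?_
    exact LinearMap.IsSymm.tmul ⟨associated_isSymm K V.form⟩ ⟨associated_isSymm K W.form⟩

/-- Extension of scalars. -/
noncomputable def baseChange (L : Type u) [Field L] [NeZero (2 : L)] [Algebra K L]
    (V : QuadSpace K) : QuadSpace L where
  carrier := L ⊗[K] V.carrier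
  form := V.form.baseChange L
  nondegenerate := by
    rw [nondegenerate_iff_associated, QuadraticForm.associated_baseChange]
    exact baseChange_nondegenerate ((nondegenerate_iff_associated _).mp V.nondegenerate)

/-- A form is metabolic if some subspace equals its own orthogonal complement. -/
def IsMetabolic (V : QuadSpace K) : Prop :=
  ∃ U : Submodule K V.carrier, LinearMap.BilinForm.orthogonal V.form.polarBilin U = U

theorem IsMetabolic.baseChange {L : Type u} [Field L] [NeZero (2 : L)] [Algebra K L]
    {V : QuadSpace K} (h : V.IsMetabolic) : (V.baseChange L).IsMetabolic := by
  obtain ⟨U, hU⟩ := h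
  have hnd : LinearMap.BilinForm.Nondegenerate (V.baseChange L).form.polarBilin :=
    (V.baseChange L).nondegenerate
  have hV : LinearMap.BilinForm.Nondegenerate V.form.polarBilin := V.nondegenerate
  let UL : Submodule L (V.baseChange L).carrier := LinearMap.range (U.subtype.baseChange L)
  have hfr : Module.finrank L UL = Module.finrank K U := by
    have hinj : Function.Injective (U.subtype.baseChange L) :=
      Module.Flat.lTensor_preserves_injective_linearMap U.subtype U.injective_subtype
    exact (LinearMap.finrank_range_of_inj hinj).trans Module.finrank_baseChange
  have hle : UL ≤ LinearMap.BilinForm.orthogonal (V.baseChange L).form.polarBilin UL := by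
    rintro _ ⟨y, rfl⟩ _ ⟨x, rfl⟩
    have hz : (LinearMap.compl₁₂ (V.form.baseChange L).polarBilin (U.subtype.baseChange L)
        (U.subtype.baseChange L)) = 0 := by
      rw [QuadraticForm.polarBilin_baseChange]
      ext x y
      have hxy : (V.form.polarBilin : LinearMap.BilinForm K V.carrier) x y = 0 := by
        have hy : (y : V.carrier) ∈ LinearMap.BilinForm.orthogonal V.form.polarBilin U := by
          rw [hU]
          exact y.2
        exact hy x x.2
      simp only [QuadraticMap.polarBilin_apply_apply] at hxy
      simp [hxy]
    exact LinearMap.congr_fun₂ hz x y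
  refine ⟨UL, (Submodule.eq_of_le_of_finrank_eq hle ?_).symm⟩
  have h1 := LinearMap.BilinForm.finrank_orthogonal hnd UL
  have h2 := LinearMap.BilinForm.finrank_orthogonal hV U
  rw [hU] at h2
  have h3 : Module.finrank L (V.baseChange L).carrier = Module.finrank K V.carrier :=
    Module.finrank_baseChange
  omega


set_option linter.unusedSectionVars false

/-- Isometry of quadratic spaces. -/
def Iso (V W : QuadSpace K) : Prop := V.form.Equivalent W.form

variable (K) in
/-- Quadratic spaces up to isometry. -/
instance isoSetoid : Setoid (QuadSpace K) where
  r := Iso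
  iseqv := ⟨fun _ => Equivalent.refl _, fun h => Equivalent.symm h, fun h h' => Equivalent.trans h h'⟩

theorem iso_of_comp {V W : QuadSpace K} (e : V.carrier ≃ₗ[K] W.carrier)
    (h : W.form.comp e.toLinearMap = V.form) : V ≈ W :=
  ⟨{ toLinearEquiv := e, map_app' := fun m => DFunLike.congr_fun h m }⟩

theorem add_congr {V V' W W' : QuadSpace K} (h : V ≈ V') (h' : W ≈ W') : V.add W ≈ V'.add W' :=
  Equivalent.prod h h'

theorem mul_congr {V V' W W' : QuadSpace K} (h : V ≈ V') (h' : W ≈ W') : V.mul W ≈ V'.mul W' := by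
  obtain ⟨e⟩ := h
  obtain ⟨e'⟩ := h'
  exact iso_of_comp (V := V.mul W) (W := V'.mul W')
    (TensorProduct.congr e.toLinearEquiv e'.toLinearEquiv)
    (QuadraticForm.tmul_comp_tensorMap e.toIsometry e'.toIsometry)

theorem baseChange_congr (L : Type u) [Field L] [NeZero (2 : L)] [Algebra K L]
    {V V' : QuadSpace K} (h : V ≈ V') : V.baseChange L ≈ V'.baseChange L := by
  obtain ⟨e⟩ := h
  refine iso_of_comp (V := V.baseChange L) (W := V'.baseChange L)
    (e.toLinearEquiv.baseChange K L _ _) ?_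
  refine baseChange_ext fun m => ?_
  change (V'.form.baseChange L) (1 ⊗ₜ[K] e m) = (V.form.baseChange L) (1 ⊗ₜ[K] m)
  simp

theorem add_assoc_iso (U V W : QuadSpace K) : (U.add V).add W ≈ U.add (V.add W) :=
  iso_of_comp (V := (U.add V).add W) (W := U.add (V.add W))
    (LinearEquiv.prodAssoc K _ _ _) (by
      ext x
      exact (add_assoc (U.form x.1.1) (V.form x.1.2) (W.form x.2)).symm)

theorem add_comm_iso (V W : QuadSpace K) : V.add W ≈ W.add V :=
  ⟨IsometryEquiv.prodComm _ _⟩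

theorem zero_add_iso (V : QuadSpace K) : zero.add V ≈ V :=
  iso_of_comp (V := zero.add V) (W := V)
    { toFun := fun x => x.2
      invFun := fun x => (0, x)
      map_add' := fun _ _ => rfl
      map_smul' := fun _ _ => rfl
      left_inv := fun _ => rfl
      right_inv := fun _ => rfl } (by
      ext x
      exact (zero_add (V.form x.2)).symm)

theorem mul_assoc_iso (U V W : QuadSpace K) : (U.mul V).mul W ≈ U.mul (V.mul W) :=
  ⟨QuadraticForm.tensorAssoc _ _ _⟩

theorem mul_comm_iso (V W : QuadSpace K) : V.mul W ≈ W.mul V :=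
  ⟨QuadraticForm.tensorComm _ _⟩

theorem one_mul_iso (V : QuadSpace K) : one.mul V ≈ V :=
  ⟨QuadraticForm.tensorLId _⟩

theorem zero_mul_iso (V : QuadSpace K) : zero.mul V ≈ zero := by
  have hs : Subsingleton (PUnit.{u + 1} ⊗[K] V.carrier) := inferInstance
  refine iso_of_comp (V := zero.mul V) (W := zero)
    { toFun := fun _ => 0
      invFun := fun _ => 0
      map_add' := fun _ _ => rfl
      map_smul' := fun _ _ => rfl
      left_inv := fun x => hs.elim _ _
      right_inv := fun _ => rfl } ?_
  ext x
  have hx : x = 0 := hs.elim _ _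
  rw [hx, map_zero, map_zero]

theorem mul_add_iso (U V W : QuadSpace K) : U.mul (V.add W) ≈ (U.mul V).add (U.mul W) := by
  refine iso_of_comp (V := U.mul (V.add W)) (W := (U.mul V).add (U.mul W))
    (TensorProduct.prodRight K K U.carrier V.carrier W.carrier) ?_
  refine (QuadraticMap.associated_rightInverse K).injective ?_
  change associated (((U.form.tmul V.form).prod (U.form.tmul W.form)).comp
      (TensorProduct.prodRight K K U.carrier V.carrier W.carrier).toLinearMap) =
    associated (U.form.tmul (V.form.prod W.form))
  rw [QuadraticMap.associated_comp, QuadraticMap.associated_prod]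
  simp only [QuadraticForm.associated_tmul, QuadraticMap.associated_prod]
  ext <;> simp

section baseChange

variable (L : Type u) [Field L] [NeZero (2 : L)] [Algebra K L]

theorem baseChange_add (V W : QuadSpace K) :
    (V.add W).baseChange L ≈ (V.baseChange L).add (W.baseChange L) := by
  refine iso_of_comp (V := (V.add W).baseChange L) (W := (V.baseChange L).add (W.baseChange L))
    (TensorProduct.prodRight K L L V.carrier W.carrier) ?_
  refine baseChange_ext fun m => ?_
  obtain ⟨v, w⟩ := m
  change ((V.form.baseChange L).prod (W.form.baseChange L)) (1 ⊗ₜ[K] v, 1 ⊗ₜ[K] w) =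
    (QuadraticForm.baseChange L (V.form.prod W.form)) (1 ⊗ₜ[K] (v, w))
  simp [add_smul]

theorem baseChange_zero : (zero : QuadSpace K).baseChange L ≈ zero := by
  have hs : Subsingleton (L ⊗[K] PUnit.{u + 1}) := inferInstance
  refine iso_of_comp (V := zero.baseChange L) (W := zero)
    { toFun := fun _ => 0
      invFun := fun _ => 0
      map_add' := fun _ _ => rfl
      map_smul' := fun _ _ => rfl
      left_inv := fun x => hs.elim _ _
      right_inv := fun _ => rfl } ?_
  ext x
  have hx : x = 0 := hs.elim _ _
  rw [hx, map_zero, map_zero]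

theorem baseChange_one : (one : QuadSpace K).baseChange L ≈ one := by
  refine iso_of_comp (V := one.baseChange L) (W := one)
    (TensorProduct.AlgebraTensorModule.rid K L L) ?_
  refine baseChange_ext fun (m : K) => ?_
  change (sq : QuadraticForm L L) (m • (1 : L)) = (QuadraticForm.baseChange L (sq : QuadraticForm K K)) (1 ⊗ₜ[K] m)
  simp [mul_smul]

theorem tmul_comp_distribBaseChange {V W : Type u} [AddCommGroup V] [Module K V]
    [AddCommGroup W] [Module K W] (p : QuadraticForm K V) (q : QuadraticForm K W) :
    (QuadraticForm.tmul (p.baseChange L) (q.baseChange L)).comp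
      (TensorProduct.AlgebraTensorModule.distribBaseChange K L V W).toLinearMap =
    QuadraticForm.baseChange L (p.tmul q) := by
  refine (QuadraticMap.associated_rightInverse L).injective ?_
  have := QuadraticMap.associated_comp L (QuadraticForm.tmul (p.baseChange L) (q.baseChange L))
      (TensorProduct.AlgebraTensorModule.distribBaseChange K L V W).toLinearMap
  refine this.trans ?_
  simp only [QuadraticForm.associated_tmul, QuadraticForm.associated_baseChange]
  ext
  simp [mul_smul, smul_comm ((associated (R := K) p) _ _)]

theorem baseChange_mul (V W : QuadSpace K) :
    (V.mul W).baseChange L ≈ (V.baseChange L).mul (W.baseChange L) :=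
  iso_of_comp (V := (V.mul W).baseChange L) (W := (V.baseChange L).mul (W.baseChange L))
    (TensorProduct.AlgebraTensorModule.distribBaseChange K L V.carrier W.carrier)
    (tmul_comp_distribBaseChange L V.form W.form)

theorem baseChange_baseChange (M : Type u) [Field M] [NeZero (2 : M)] [Algebra K M] [Algebra L M]
    [IsScalarTower K L M] (V : QuadSpace K) :
    (V.baseChange L).baseChange M ≈ V.baseChange M := by
  refine iso_of_comp (V := (V.baseChange L).baseChange M) (W := V.baseChange M)
    (TensorProduct.AlgebraTensorModule.cancelBaseChange K L M M V.carrier) ?_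
  refine (QuadraticMap.associated_rightInverse M).injective ?_
  change associated ((V.form.baseChange M).comp
      (TensorProduct.AlgebraTensorModule.cancelBaseChange K L M M V.carrier).toLinearMap) =
    associated ((V.form.baseChange L).baseChange M)
  rw [QuadraticMap.associated_comp]
  simp only [QuadraticForm.associated_baseChange]
  ext
  simp

end baseChange

end QuadSpace

/-- Isometry classes of non-degenerate quadratic forms over `K`. -/
def FormClass (K : Type u) [Field K] [NeZero (2 : K)] : Type (u + 1) :=
  Quotient (QuadSpace.isoSetoid K)

namespace FormClass

variable {K : Type u} [Field K] [NeZero (2 : K)]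

/-- The isometry class of a quadratic space. -/
def mk (V : QuadSpace K) : FormClass K := Quotient.mk _ V

instance : Zero (FormClass K) := ⟨mk QuadSpace.zero⟩

instance : One (FormClass K) := ⟨mk QuadSpace.one⟩

instance : Add (FormClass K) :=
  ⟨Quotient.map₂ QuadSpace.add fun _ _ h _ _ h' => QuadSpace.add_congr h h'⟩

noncomputable instance : Mul (FormClass K) :=
  ⟨Quotient.map₂ QuadSpace.mul fun _ _ h _ _ h' => QuadSpace.mul_congr h h'⟩

/-- Orthogonal sum and tensor product make isometry classes a commutative semiring. -/
noncomputable instance : CommSemiring (FormClass K) where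
  nsmul := nsmulRec
  add_assoc := by
    rintro ⟨U⟩ ⟨V⟩ ⟨W⟩
    exact Quotient.sound (QuadSpace.add_assoc_iso U V W)
  add_comm := by
    rintro ⟨U⟩ ⟨V⟩
    exact Quotient.sound (QuadSpace.add_comm_iso U V)
  zero_add := by
    rintro ⟨V⟩
    exact Quotient.sound (QuadSpace.zero_add_iso V)
  add_zero := by
    rintro ⟨V⟩
    exact Quotient.sound (Setoid.trans (QuadSpace.add_comm_iso V _) (QuadSpace.zero_add_iso V))
  mul_assoc := by
    rintro ⟨U⟩ ⟨V⟩ ⟨W⟩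
    exact Quotient.sound (QuadSpace.mul_assoc_iso U V W)
  mul_comm := by
    rintro ⟨U⟩ ⟨V⟩
    exact Quotient.sound (QuadSpace.mul_comm_iso U V)
  one_mul := by
    rintro ⟨V⟩
    exact Quotient.sound (QuadSpace.one_mul_iso V)
  mul_one := by
    rintro ⟨V⟩
    exact Quotient.sound (Setoid.trans (QuadSpace.mul_comm_iso V _) (QuadSpace.one_mul_iso V))
  zero_mul := by
    rintro ⟨V⟩
    exact Quotient.sound (QuadSpace.zero_mul_iso V)
  mul_zero := by
    rintro ⟨V⟩
    exact Quotient.sound (Setoid.trans (QuadSpace.mul_comm_iso V _) (QuadSpace.zero_mul_iso V))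
  left_distrib := by
    rintro ⟨U⟩ ⟨V⟩ ⟨W⟩
    exact Quotient.sound (QuadSpace.mul_add_iso U V W)
  right_distrib := by
    rintro ⟨U⟩ ⟨V⟩ ⟨W⟩
    refine Quotient.sound ?_
    exact Setoid.trans (QuadSpace.mul_comm_iso _ _) (Setoid.trans (QuadSpace.mul_add_iso W U V)
      (QuadSpace.add_congr (QuadSpace.mul_comm_iso _ _) (QuadSpace.mul_comm_iso _ _)))

/-- Extension of scalars on isometry classes. -/
noncomputable def baseChange (K : Type u) [Field K] [NeZero (2 : K)] (L : Type u) [Field L]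
    [NeZero (2 : L)] [Algebra K L] : FormClass K →+* FormClass L where
  toFun := Quotient.map (QuadSpace.baseChange L) fun _ _ h => QuadSpace.baseChange_congr L h
  map_zero' := Quotient.sound (QuadSpace.baseChange_zero L)
  map_one' := Quotient.sound (QuadSpace.baseChange_one L)
  map_add' := by
    rintro ⟨V⟩ ⟨W⟩
    exact Quotient.sound (QuadSpace.baseChange_add L V W)
  map_mul' := by
    rintro ⟨V⟩ ⟨W⟩
    exact Quotient.sound (QuadSpace.baseChange_mul L V W)

end FormClass

/-- The Witt–Grothendieck ring of `K`. -/
abbrev WittGrothendieckRing (K : Type u) [Field K] [NeZero (2 : K)] : Type (u + 1) :=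
  GrothendieckRing (FormClass K)

/-- The ideal of the Witt–Grothendieck ring generated by the metabolic forms. -/
noncomputable def metabolicIdeal (K : Type u) [Field K] [NeZero (2 : K)] :
    Ideal (WittGrothendieckRing K) :=
  Ideal.span {x | ∃ V : QuadSpace K, V.IsMetabolic ∧ x = GrothendieckRing.ofHom (FormClass.mk V)}

/-- The Witt ring of `K`. -/
abbrev WittRing (K : Type u) [Field K] [NeZero (2 : K)] : Type (u + 1) :=
  WittGrothendieckRing K ⧸ metabolicIdeal K

namespace WittRing

/-- The class of a quadratic space in the Witt ring. -/
noncomputable def mk {K : Type u} [Field K] [NeZero (2 : K)] (V : QuadSpace K) : WittRing K :=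
  Ideal.Quotient.mk _ (GrothendieckRing.ofHom (FormClass.mk V))

/-- Extension of scalars on Witt rings. -/
noncomputable def baseChange (K : Type u) [Field K] [NeZero (2 : K)] (L : Type u) [Field L]
    [NeZero (2 : L)] [Algebra K L] : WittRing K →+* WittRing L :=
  Ideal.quotientMap (metabolicIdeal L) (GrothendieckRing.map (FormClass.baseChange K L)) (by
    rw [metabolicIdeal, Ideal.span_le]
    rintro _ ⟨V, hV, rfl⟩
    change GrothendieckRing.map _ _ ∈ metabolicIdeal L
    rw [GrothendieckRing.map_ofHom]
    exact Ideal.subset_span ⟨V.baseChange L, hV.baseChange, rfl⟩)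

theorem baseChange_mk {K : Type u} [Field K] [NeZero (2 : K)] (L : Type u) [Field L]
    [NeZero (2 : L)] [Algebra K L] (V : QuadSpace K) :
    baseChange K L (mk V) = mk (V.baseChange L) := by
  rw [baseChange, mk, Ideal.quotientMap_mk, GrothendieckRing.map_ofHom]
  rfl

theorem ringHom_ext {K : Type u} [Field K] [NeZero (2 : K)] {R : Type*} [CommRing R]
    {f g : WittRing K →+* R} (h : ∀ V, f (mk V) = g (mk V)) : f = g := by
  refine Ideal.Quotient.ringHom_ext (RingHom.ext fun x => ?_)
  induction x using GrothendieckRing.ind with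
  | h a b =>
    obtain ⟨V, rfl⟩ := Quotient.exists_rep a
    obtain ⟨W, rfl⟩ := Quotient.exists_rep b
    rw [map_sub, map_sub]
    exact congrArg₂ _ (h V) (h W)

theorem baseChange_baseChange (K L M : Type u) [Field K] [NeZero (2 : K)] [Field L]
    [NeZero (2 : L)] [Field M] [NeZero (2 : M)] [Algebra K L] [Algebra K M] [Algebra L M]
    [IsScalarTower K L M] (w : WittRing K) :
    baseChange L M (baseChange K L w) = baseChange K M w := by
  have : (baseChange L M).comp (baseChange K L) = baseChange K M :=
    ringHom_ext fun V => by
      rw [RingHom.comp_apply, baseChange_mk, baseChange_mk, baseChange_mk]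
      exact congrArg (fun c => Ideal.Quotient.mk _ (GrothendieckRing.ofHom c))
        (Quotient.sound (QuadSpace.baseChange_baseChange L M V))
  exact DFunLike.congr_fun this w

end WittRing

end Quadratic

/-! ### Étale algebras -/

section Etale

/-- An étale `K`-algebra of rank `n`. -/
structure EtaleAlg (K : Type u) [Field K] (n : ℕ) : Type (u + 1) where
  carrier : Type u
  [commRing : CommRing carrier]
  [algebra : Algebra K carrier]
  [etale : Algebra.Etale K carrier]
  finrank_eq : Module.finrank K carrier = n

namespace EtaleAlg

attribute [instance] commRing algebra etale

instance {K : Type u} [Field K] {n : ℕ} (A : EtaleAlg K n) : Module.Finite K A.carrier :=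
  Algebra.FormallyUnramified.finite_of_free K A.carrier

variable {K : Type u} [Field K]

theorem trace_single {I : Type*} [Fintype I] [DecidableEq I] (E : I → Type*)
    [∀ i, CommRing (E i)] [∀ i, Algebra K (E i)] [∀ i, Module.Finite K (E i)] (i : I) (z : E i) :
    Algebra.trace K (∀ i, E i) (Pi.single i z) = Algebra.trace K (E i) z := by
  classical
  let b := Pi.basis fun i => Module.finBasis K (E i)
  rw [Algebra.trace_eq_matrix_trace b, Algebra.trace_eq_matrix_trace (Module.finBasis K (E i))]
  simp only [Matrix.trace, Matrix.diag_apply, Algebra.leftMulMatrix_eq_repr_mul]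
  rw [Fintype.sum_sigma, Finset.sum_eq_single i]
  · refine Finset.sum_congr rfl fun j _ => ?_
    simp [b, Pi.basis_apply, Pi.basis_repr]
  · intro j _ hj
    refine Finset.sum_eq_zero fun l _ => ?_
    simp [b, Pi.basis_apply, Pi.basis_repr, hj]
  · simp

theorem trace_nondegenerate (A : Type u) [CommRing A] [Algebra K A] [Algebra.Etale K A] (x : A)
    (hx : ∀ y, Algebra.trace K A (x * y) = 0) : x = 0 := by
  classical
  obtain ⟨I, _, E, _, _, e, h⟩ := (Algebra.Etale.iff_exists_algEquiv_prod (K := K) (A := A)).mp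
    inferInstance
  have := fun i => (h i).1
  have := fun i => (h i).2
  cases nonempty_fintype I
  apply e.injective
  rw [map_zero]
  funext i
  refine (traceForm_nondegenerate K (E i)).1 (e x i) fun z => ?_
  have h1 := hx (e.symm (Pi.single i z))
  rw [← Algebra.trace_eq_of_algEquiv e, map_mul, AlgEquiv.apply_symm_apply] at h1
  rw [Algebra.traceForm_apply, ← trace_single E i]
  convert h1 using 2
  ext j
  by_cases hj : j = i
  · subst hj
    simp
  · simp [hj]

/-- The trace form `x ↦ tr (x ^ 2)` of an étale algebra. -/
noncomputable def traceForm [NeZero (2 : K)] {n : ℕ} (A : EtaleAlg K n) : QuadSpace K where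
  carrier := A.carrier
  form := LinearMap.BilinMap.toQuadraticMap (Algebra.traceForm K A.carrier)
  nondegenerate := by
    rw [QuadSpace.nondegenerate_iff]
    intro x hx
    refine trace_nondegenerate (K := K) A.carrier x fun y => ?_
    have h := hx y
    have h2 : (2 : K) ≠ 0 := NeZero.ne 2
    rw [LinearMap.BilinMap.polar_toQuadraticMap] at h
    simp only [Algebra.traceForm_apply, mul_comm y x, ← two_mul] at h
    exact (mul_eq_zero.mp h).resolve_left h2

/-- Extension of scalars. -/
noncomputable def baseChange (L : Type u) [Field L] [Algebra K L] {n : ℕ} (A : EtaleAlg K n) :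
    EtaleAlg L n where
  carrier := L ⊗[K] A.carrier
  finrank_eq := by rw [Module.finrank_baseChange, A.finrank_eq]

/-- Isomorphism of étale algebras. -/
instance isoSetoid (K : Type u) [Field K] (n : ℕ) : Setoid (EtaleAlg K n) where
  r A B := Nonempty (A.carrier ≃ₐ[K] B.carrier)
  iseqv := ⟨fun _ => ⟨AlgEquiv.refl⟩, fun ⟨e⟩ => ⟨e.symm⟩, fun ⟨e⟩ ⟨f⟩ => ⟨e.trans f⟩⟩

/-- The quadratic algebra `K[x] / (x ^ 2 - a)` for `a` in `Kˣ`. -/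
noncomputable abbrev quadraticCarrier (a : Kˣ) : Type u :=
  AdjoinRoot (Polynomial.X ^ 2 - Polynomial.C (a : K))

theorem monic_quadratic (a : Kˣ) : (Polynomial.X ^ 2 - Polynomial.C (a : K)).Monic :=
  Polynomial.monic_X_pow_sub_C _ two_ne_zero

instance (a : Kˣ) : Module.Finite K (quadraticCarrier a) := (monic_quadratic a).finite_adjoinRoot

theorem finrank_quadratic (a : Kˣ) : Module.finrank K (quadraticCarrier a) = 2 := by
  rw [(AdjoinRoot.powerBasis (monic_quadratic a).ne_zero).finrank, AdjoinRoot.powerBasis_dim,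
    Polynomial.natDegree_X_pow_sub_C]

instance [NeZero (2 : K)] (a : Kˣ) : Algebra.Etale K (quadraticCarrier a) := by
  have hunr : Algebra.FormallyUnramified K (quadraticCarrier a) := by
    rw [Algebra.FormallyUnramified.iff_comp_injective]
    intro B _ _ I hI f g hfg
    have hroot : (AdjoinRoot.root (Polynomial.X ^ 2 - Polynomial.C (a : K))) ^ 2 =
        algebraMap K (quadraticCarrier a) a := by
      have := AdjoinRoot.eval₂_root (Polynomial.X ^ 2 - Polynomial.C (a : K))
      simp only [Polynomial.eval₂_sub, Polynomial.eval₂_pow, Polynomial.eval₂_X,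
        Polynomial.eval₂_C] at this
      exact sub_eq_zero.mp this
    refine AdjoinRoot.algHom_ext ?_
    set r : quadraticCarrier a := AdjoinRoot.root (Polynomial.X ^ 2 - Polynomial.C (a : K))
    have hf : f r ^ 2 = algebraMap K B a := by rw [← map_pow, hroot, AlgHom.commutes]
    have hg : g r ^ 2 = algebraMap K B a := by rw [← map_pow, hroot, AlgHom.commutes]
    have hmem : f r - g r ∈ I := by
      rw [← Ideal.Quotient.eq]
      exact DFunLike.congr_fun hfg r
    have hsq : (f r - g r) ^ 2 = 0 := by
      have := Ideal.pow_mem_pow hmem 2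
      rw [hI] at this
      exact this
    have h4 : IsUnit (algebraMap K B (4 * a)) :=
      (IsUnit.mk0 _ (mul_ne_zero (by
        have h2 : (2 : K) ≠ 0 := NeZero.ne 2
        have : (4 : K) = 2 * 2 := by norm_num
        rw [this]
        exact mul_ne_zero h2 h2) a.ne_zero)).map _
    rw [← sub_eq_zero, ← h4.mul_right_eq_zero, map_mul, ← hf, map_ofNat]
    linear_combination (2 * f r) * (hf - hg + hsq)
  have := Algebra.FormallyEtale.of_formallyUnramified_of_field K (quadraticCarrier a)
  exact { finitePresentation := Algebra.FinitePresentation.of_finiteType.mp inferInstance }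

theorem etale_pi_bool (E : Bool → Type u) [∀ i, CommRing (E i)] [∀ i, Algebra K (E i)]
    [∀ i, Algebra.Etale K (E i)] : Algebra.Etale K (E true × E false) :=
  Algebra.Etale.of_equiv (A := ∀ i, E i)
    { toFun := fun x => (x true, x false)
      invFun := fun x i => match i with
        | true => x.1
        | false => x.2
      left_inv := fun x => by
        funext i
        cases i <;> rfl
      right_inv := fun _ => rfl
      map_mul' := fun _ _ => rfl
      map_add' := fun _ _ => rfl
      commutes' := fun _ => rfl }

theorem etale_prod (A B : Type u) [CommRing A] [CommRing B] [Algebra K A] [Algebra K B]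
    [hA : Algebra.Etale K A] [hB : Algebra.Etale K B] : Algebra.Etale K (A × B) := by
  let E : Bool → Type u := fun i => match i with
    | true => A
    | false => B
  let _ : ∀ i, CommRing (E i) := fun i => match i with
    | true => inferInstanceAs (CommRing A)
    | false => inferInstanceAs (CommRing B)
  let _ : ∀ i, Algebra K (E i) := fun i => match i with
    | true => inferInstanceAs (Algebra K A)
    | false => inferInstanceAs (Algebra K B)
  have : ∀ i, Algebra.Etale K (E i) := fun i => match i with
    | true => hA
    | false => hB
  exact etale_pi_bool E

/-- The étale algebra `K[x] / (x ^ 2 - a)` of rank two. -/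
noncomputable def quadratic [NeZero (2 : K)] (a : Kˣ) : EtaleAlg K 2 where
  carrier := quadraticCarrier a
  finrank_eq := finrank_quadratic a

/-- The multiquadratic algebra of rank `n` attached to `a`: the product of the algebras
`K[x] / (x ^ 2 - a j)` for `j < m`, and of `n - 2 m` copies of `K`, where `m = ⌊n / 2⌋`. -/
noncomputable def multiquadratic [NeZero (2 : K)] (n : ℕ) (a : Fin (n / 2) → Kˣ) :
    EtaleAlg K n where
  carrier := (∀ j, quadraticCarrier (a j)) × (Fin (n - 2 * (n / 2)) → K)
  etale := etale_prod _ _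
  finrank_eq := by
    rw [Module.finrank_prod, Module.finrank_pi_fintype, Module.finrank_fin_fun]
    simp only [finrank_quadratic, Finset.sum_const, Finset.card_univ, Fintype.card_fin,
      smul_eq_mul]
    omega

end EtaleAlg

/-- Isomorphism classes of étale `K`-algebras of rank `n`. -/
def Et (K : Type u) [Field K] (n : ℕ) : Type (u + 1) := Quotient (EtaleAlg.isoSetoid K n)

namespace Et

/-- The isomorphism class of an étale algebra. -/
def mk {K : Type u} [Field K] {n : ℕ} (A : EtaleAlg K n) : Et K n := Quotient.mk _ A

/-- Extension of scalars on isomorphism classes. -/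
noncomputable def baseChange {K : Type u} [Field K] (L : Type u) [Field L] [Algebra K L] {n : ℕ} :
    Et K n → Et L n :=
  Quotient.map (EtaleAlg.baseChange L) fun _ _ ⟨e⟩ =>
    ⟨Algebra.TensorProduct.congr AlgEquiv.refl e⟩

end Et

/-- Tuples of isomorphism classes of étale algebras of multidegree `n`. -/
abbrev EtTuple (K : Type u) [Field K] {ι : Type} (n : ι → ℕ) : Type (u + 1) := ∀ j, Et K (n j)

/-- Extension of scalars, componentwise. -/
noncomputable def EtTuple.baseChange {K : Type u} [Field K] (L : Type u) [Field L] [Algebra K L]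
    {ι : Type} {n : ι → ℕ} (A : EtTuple K n) : EtTuple L n := fun j => (A j).baseChange L

end Etale

/-! ### Witt invariants over a field -/

section Over

/-- A field extension of `k`. -/
structure FieldExt (k : Type u) [Field k] : Type (u + 1) where
  carrier : Type u
  [field : Field carrier]
  [algebra : Algebra k carrier]

attribute [instance] FieldExt.field FieldExt.algebra

variable {k : Type u} [Field k] [NeZero (2 : k)]

instance (X : FieldExt k) : NeZero (2 : X.carrier) :=
  ⟨by
    have h := (map_ne_zero (algebraMap k X.carrier)).mpr (NeZero.ne (2 : k))
    rwa [map_ofNat] at h⟩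

/-- `W(X)` is a `W(k)`-algebra through extension of scalars, for every extension `X` of `k`. -/
noncomputable instance (X : FieldExt k) : Algebra (WittRing k) (WittRing X.carrier) :=
  (WittRing.baseChange k X.carrier).toAlgebra

variable (k) in
/-- The `W(k)`-algebra `Inv_k(n)` of Witt invariants over `k` of multidegree `n`: families of maps
`Et_n(X) → W(X)`, indexed by the extensions `X` of `k`, that commute with extension of scalars along
all morphisms `X → Y` of extensions of `k`. -/
noncomputable def InvOver {ι : Type} (n : ι → ℕ) :
    Subalgebra (WittRing k) (∀ X : FieldExt k, EtTuple X.carrier n → WittRing X.carrier) where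
  carrier := {α | ∀ (X Y : FieldExt k) [Algebra X.carrier Y.carrier]
    [IsScalarTower k X.carrier Y.carrier] (A : EtTuple X.carrier n),
    WittRing.baseChange X.carrier Y.carrier (α X A) = α Y (A.baseChange Y.carrier)}
  mul_mem' := fun {α β} hα hβ X Y _ _ A => by
    rw [Pi.mul_apply, Pi.mul_apply, Pi.mul_apply, Pi.mul_apply, map_mul, hα, hβ]
  add_mem' := fun {α β} hα hβ X Y _ _ A => by
    rw [Pi.add_apply, Pi.add_apply, Pi.add_apply, Pi.add_apply, map_add, hα, hβ]
  algebraMap_mem' := fun w X Y _ _ A =>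
    WittRing.baseChange_baseChange k X.carrier Y.carrier w

end Over

/-! ### Witt invariants away from a set of primes -/

section Away

/-- A field of characteristic different from `2` whose characteristic, if positive, is not in
`S`. -/
structure FieldAway (S : Set ℕ) : Type (u + 1) where
  carrier : Type u
  [field : Field carrier]
  two_ne_zero : (2 : carrier) ≠ 0
  char_notMem : ringChar carrier = 0 ∨ ringChar carrier ∉ S

attribute [instance] FieldAway.field

instance {S : Set ℕ} (X : FieldAway.{u} S) : NeZero (2 : X.carrier) := ⟨X.two_ne_zero⟩

/-- The characteristic of a prime field of characteristic different from `2` and, if positive,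
not in `S`. -/
structure PrimeAway (S : Set ℕ) : Type where
  char : ℕ
  char_eq : char = 0 ∨ char.Prime
  char_ne_two : char ≠ 2
  char_notMem : char = 0 ∨ char ∉ S

/-- The prime field of characteristic `p`: `ℚ` for `p = 0` and `ZMod p` for `p` prime. -/
def PrimeField : ℕ → Type u
  | 0 => ULift ℚ
  | p + 1 => ULift (ZMod (p + 1))

noncomputable instance primeFieldCommRing : ∀ p, CommRing (PrimeField.{u} p)
  | 0 => inferInstanceAs (CommRing (ULift ℚ))
  | p + 1 => inferInstanceAs (CommRing (ULift (ZMod (p + 1))))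

theorem primeField_isField : ∀ p : ℕ, p = 0 ∨ p.Prime → IsField (PrimeField.{u} p)
  | 0, _ => (Field.toIsField (ULift.{u} ℚ))
  | p + 1, h => by
    have : Fact (p + 1).Prime := ⟨h.resolve_left p.succ_ne_zero⟩
    exact Field.toIsField (ULift.{u} (ZMod (p + 1)))

noncomputable instance {S : Set ℕ} (P : PrimeAway S) : Field (PrimeField.{u} P.char) :=
  (primeField_isField P.char P.char_eq).toField

instance primeField_charP : ∀ p : ℕ, CharP (PrimeField.{u} p) p
  | 0 => inferInstanceAs (CharP (ULift.{u} ℚ) 0)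
  | p + 1 => inferInstanceAs (CharP (ULift.{u} (ZMod (p + 1))) (p + 1))


instance {S : Set ℕ} (P : PrimeAway S) : NeZero (2 : PrimeField.{u} P.char) :=
  ⟨by
    intro h
    have h' : ((2 : ℕ) : PrimeField.{u} P.char) = 0 := by exact_mod_cast h
    have hd := (CharP.cast_eq_zero_iff (PrimeField.{u} P.char) P.char 2).mp h'
    rcases P.char_eq with h0 | hp
    · rw [h0] at hd
      omega
    · exact P.char_ne_two ((Nat.prime_dvd_prime_iff_eq hp Nat.prime_two).mp hd)⟩

/-- The embedding of the prime field of characteristic `p` into a field of characteristic `p`. -/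
noncomputable def primeFieldHom : ∀ (p : ℕ) (K : Type u) [Field K] [CharP K p],
    PrimeField.{u} p →+* K
  | 0, K, _, _ =>
    have : CharZero K := CharP.charP_to_charZero K
    (Rat.castHom K).comp (ULift.ringEquiv : ULift.{u} ℚ ≃+* ℚ).toRingHom
  | p + 1, K, _, _ =>
    (ZMod.castHom (dvd_refl (p + 1)) K).comp
      (ULift.ringEquiv : ULift.{u} (ZMod (p + 1)) ≃+* ZMod (p + 1)).toRingHom

theorem primeFieldHom_unique : ∀ (p : ℕ) (K : Type u) [Field K]
    (f g : PrimeField.{u} p →+* K), f = g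
  | 0, K, _, f, g => by
    have h : f.comp (ULift.ringEquiv : ULift.{u} ℚ ≃+* ℚ).symm.toRingHom =
        g.comp (ULift.ringEquiv : ULift.{u} ℚ ≃+* ℚ).symm.toRingHom := RingHom.ext_rat _ _
    exact RingHom.ext fun x => DFunLike.congr_fun h x.down
  | p + 1, K, _, f, g => by
    have h : f.comp (ULift.ringEquiv : ULift.{u} (ZMod (p + 1)) ≃+* _).symm.toRingHom =
        g.comp (ULift.ringEquiv : ULift.{u} (ZMod (p + 1)) ≃+* _).symm.toRingHom :=
      RingHom.ext_zmod _ _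
    exact RingHom.ext fun x => DFunLike.congr_fun h x.down

/-- The ring `W(𝒫 ∖ S)`: the product of the Witt rings of the prime fields of characteristic
different from `2` and not in `S`. -/
abbrev WittPrimeRing (S : Set ℕ) : Type (u + 1) :=
  ∀ P : PrimeAway S, WittRing (PrimeField.{u} P.char)

namespace FieldAway

variable {S : Set ℕ}

/-- The characteristic of `X`, as an index of a prime field. -/
noncomputable def primeAway (X : FieldAway.{u} S) : PrimeAway S where
  char := ringChar X.carrier
  char_eq := (CharP.char_is_prime_or_zero X.carrier (ringChar X.carrier)).symm
  char_ne_two h := X.two_ne_zero (by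
    have := (ringChar.spec X.carrier 2).mpr (dvd_of_eq h)
    exact_mod_cast this)
  char_notMem := X.char_notMem

instance (X : FieldAway.{u} S) : CharP X.carrier X.primeAway.char :=
  inferInstanceAs (CharP X.carrier (ringChar X.carrier))

/-- Projection to the factor of a prime field, followed by extension of scalars to `X`. -/
noncomputable def fromPrime (X : FieldAway.{u} S) (P : PrimeAway S) [CharP X.carrier P.char] :
    WittPrimeRing.{u} S →+* WittRing X.carrier :=
  letI : Algebra (PrimeField.{u} P.char) X.carrier := (primeFieldHom P.char X.carrier).toAlgebra
  (WittRing.baseChange (PrimeField.{u} P.char) X.carrier).comp (Pi.evalRingHom _ P)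

/-- `W(X)` is a `W(𝒫 ∖ S)`-algebra through the prime field contained in `X`. -/
noncomputable instance (X : FieldAway.{u} S) :
    Algebra (WittPrimeRing.{u} S) (WittRing X.carrier) :=
  (X.fromPrime X.primeAway).toAlgebra

theorem baseChange_fromPrime (X Y : FieldAway.{u} S) [Algebra X.carrier Y.carrier]
    (w : WittPrimeRing.{u} S) :
    WittRing.baseChange X.carrier Y.carrier (X.fromPrime X.primeAway w) =
      Y.fromPrime Y.primeAway w := by
  have key : ∀ (P Q : PrimeAway S) [CharP X.carrier P.char] [CharP Y.carrier Q.char],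
      P = Q → WittRing.baseChange X.carrier Y.carrier (X.fromPrime P w) = Y.fromPrime Q w := by
    rintro P _ _ _ rfl
    let _ : Algebra (PrimeField.{u} P.char) X.carrier :=
      (primeFieldHom P.char X.carrier).toAlgebra
    let _ : Algebra (PrimeField.{u} P.char) Y.carrier :=
      (primeFieldHom P.char Y.carrier).toAlgebra
    have : IsScalarTower (PrimeField.{u} P.char) X.carrier Y.carrier :=
      IsScalarTower.of_algebraMap_eq' (primeFieldHom_unique _ _ _ _)
    exact WittRing.baseChange_baseChange (PrimeField.{u} P.char) X.carrier Y.carrier (w P)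
  refine key _ _ ?_
  have hchar : ringChar X.carrier = ringChar Y.carrier :=
    Algebra.ringChar_eq X.carrier Y.carrier
  simp only [primeAway, hchar]

/-- The field `X`, viewed as a field of characteristic different from `2`. -/
abbrev toAll (X : FieldAway.{u} S) : FieldAway.{u} ∅ where
  carrier := X.carrier
  two_ne_zero := X.two_ne_zero
  char_notMem := Or.inr (Set.notMem_empty _)

end FieldAway

/-- The `W(𝒫 ∖ S)`-algebra `Inv_S(n)` of Witt invariants away from `S` of multidegree `n`: families
of maps `Et_n(X) → W(X)`, indexed by the fields `X` of characteristic different from `2` and, if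
positive, not in `S`, that commute with extension of scalars along all field extensions. For
`S = ∅` this is the ring `Inv(n)` of Witt invariants over all fields of characteristic
different from `2`. -/
noncomputable def InvAway (S : Set ℕ) {ι : Type} (n : ι → ℕ) :
    Subalgebra (WittPrimeRing.{u} S)
      (∀ X : FieldAway.{u} S, EtTuple X.carrier n → WittRing X.carrier) where
  carrier := {α | ∀ (X Y : FieldAway.{u} S) [Algebra X.carrier Y.carrier]
    (A : EtTuple X.carrier n),
    WittRing.baseChange X.carrier Y.carrier (α X A) = α Y (A.baseChange Y.carrier)}
  mul_mem' := fun {α β} hα hβ X Y _ A => by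
    rw [Pi.mul_apply, Pi.mul_apply, Pi.mul_apply, Pi.mul_apply, map_mul, hα, hβ]
  add_mem' := fun {α β} hα hβ X Y _ A => by
    rw [Pi.add_apply, Pi.add_apply, Pi.add_apply, Pi.add_apply, map_add, hα, hβ]
  algebraMap_mem' := fun w X Y _ A => FieldAway.baseChange_fromPrime X Y w

/-! ### The invariants `β` -/

/-- The value at `(x j)` of the `i`-th elementary symmetric polynomial in `m` variables. -/
def elemSymm {R : Type*} [CommRing R] {m : ℕ} (i : ℕ) (x : Fin m → R) : R :=
  ∑ J ∈ Finset.powersetCard i Finset.univ, ∏ j ∈ J, x j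

/-- A one-variable Witt invariant `b` of degree `n` whose value on every multiquadratic algebra
`∏ E_{a j} × K ^ (n - 2 m)`, `m = ⌊n / 2⌋`, is the `i`-th elementary symmetric polynomial in the
trace forms of the quadratic algebras `E_{a j} = K[x] / (x ^ 2 - a j)`. -/
def RestrictsToBeta (n i : ℕ) (b : InvAway.{u} ∅ fun _ : Fin 1 => n) : Prop :=
  ∀ (X : FieldAway.{u} ∅) (a : Fin (n / 2) → X.carrierˣ),
    b.1 X (fun _ => Et.mk (EtaleAlg.multiquadratic n a)) =
      elemSymm i fun j => WittRing.mk (EtaleAlg.quadratic (a j)).traceForm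

/-- The Witt invariant `(A_0, …, A_r) ↦ ∏ j, b (n j) (i j) (A j)` away from `S` obtained from
one-variable Witt invariants `b n i`. -/
noncomputable def prodInv (b : ∀ n _ : ℕ, InvAway.{u} ∅ fun _ : Fin 1 => n) (S : Set ℕ) {r : ℕ}
    (n i : Fin (r + 1) → ℕ) : InvAway.{u} S n :=
  ⟨fun X A => ∏ j, (b (n j) (i j)).1 X.toAll fun _ => A j, fun X Y _ A =>
    (map_prod (WittRing.baseChange X.carrier Y.carrier) _ _).trans <|
      Finset.prod_congr rfl fun j _ => (b (n j) (i j)).2 X.toAll Y.toAll fun _ => A j⟩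

/-- The multi-indices `i` with `i j ≤ ⌊n j / 2⌋` for all `j`. -/
def multiIndices {r : ℕ} (n : Fin (r + 1) → ℕ) : Set (Fin (r + 1) → ℕ) :=
  {i | ∀ j, i j ≤ n j / 2}

end Away

end WittEt

namespace WittEt

/-! Over a fixed field `k` the whole theorem rests on one statement, `isBasis_beta`: the invariants
`β_0, …, β_m`, `m = ⌊n/2⌋`, form a basis of the Witt invariants of rank `n` over `W(k)`, for every
`k` at once. Several variables follow by a Künneth argument (`IsBasis.prod`). The version away from
`S` follows because every field contains exactly one prime field, so such an invariant is a family
of invariants over the prime fields (`IsBasis.exists_basisInvAway`).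

The first ingredient is a splitting principle, `Inv.eq_zero_of_isMultiquadratic`: an invariant that
vanishes on multiquadratic algebras is zero. Induction on the rank, fixing one factor of a product
at a time, reduces it to `Inv.VanishesOnProd.eq_zero`: for `n ≥ 3`, an invariant `α` that vanishes
on products of algebras of positive rank is zero. For this, an algebra `K[X]/f` is placed in a
pencil `f - t g` none of whose members over algebraic extensions has zero derivative or is a proper
power (`exists_pencil`), and `w` is the value of `α` at the generic member, a class in `W(K(t))`. At
a closed point where the member is irreducible, the family is unramified, so `w` has no residue.
Where it is reducible, the member has coprime factors, Hensel's lemma makes the algebra a product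
over the completed field, and `w` becomes zero there. By Milnor's theorem (`exists_eq_map_C`) `w` is
a constant `c`. A rational point where the member has a root shows `c = 0`, and specialization at `t
= 0` gives `α(K[X]/f) = 0`.

The second ingredient is rank two (`isBasis_rankTwo`). The value of an invariant at `x ^ 2 - t` over
`k(t)` can ramify on the affine line only at `t = 0`, so it is `c₀ + c₁⟨t⟩`. Hence `1` and the trace
form are a basis, and products of these are a basis for tuples of quadratic algebras. An invariant
of rank `n` pulled back to such tuples is unchanged by permutations; by uniqueness of coordinates it
is a combination of elementary symmetric polynomials in the traces. These polynomials do come from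
invariants `β_i` of rank `n`: they differ by a unitriangular change from the exterior powers of the
trace form (`exists_beta`). The splitting principle then shows that nothing else is left.

All maps out of Witt rings come from one fact, `OrthFam.sum_eq`: a function on one-dimensional forms
that respects `⟨a b²⟩ = ⟨a⟩` and `⟨a⟩ + ⟨b⟩ = ⟨a + b⟩ + ⟨a b (a + b)⟩` has the same sum over all
orthogonal bases. Residues, the maps in Milnor's theorem and exterior powers are all obtained from
it. -/

theorem _root_.Finset.sum_eq_pair_add {ι M : Type*} [Fintype ι] [DecidableEq ι] [AddCommMonoid M]
    {i j : ι} (hij : i ≠ j) (f : ι → M) :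
    ∑ l, f l = f i + f j + ∑ l ∈ (Finset.univ.erase i).erase j, f l := by
  rw [← Finset.add_sum_erase _ f (Finset.mem_univ i),
    ← Finset.add_sum_erase _ f (Finset.mem_erase.mpr ⟨hij.symm, Finset.mem_univ j⟩), add_assoc]

theorem _root_.Finset.sum_erase_pair_congr {ι M : Type*} [Fintype ι] [DecidableEq ι]
    [AddCommMonoid M] {i j : ι} {f g : ι → M} (hfg : ∀ l, l ≠ i → l ≠ j → f l = g l) :
    ∑ l ∈ (Finset.univ.erase i).erase j, f l = ∑ l ∈ (Finset.univ.erase i).erase j, g l := by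
  refine Finset.sum_congr rfl fun l hl => ?_
  simp only [Finset.mem_erase] at hl
  exact hfg l hl.2.1 hl.1

/-! ### Chain equivalence of orthogonal bases. -/

section OrthogonalFamilies

open QuadraticMap

variable {K : Type*} [Field K] {V : Type*} [AddCommGroup V] [Module K V] {q : QuadraticForm K V}

/-- A family of pairwise orthogonal anisotropic vectors. -/
def OrthFam (q : QuadraticForm K V) {ι : Type*} (v : ι → V) : Prop :=
  (∀ i j, i ≠ j → polar q (v i) (v j) = 0) ∧ ∀ i, q (v i) ≠ 0

/-- The relations between the classes of one-dimensional forms in the Grothendieck ring. -/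
structure IsFormFunction {A : Type*} [AddCommMonoid A] (φ : K → A) : Prop where
  mul_sq : ∀ a b, a ≠ 0 → b ≠ 0 → φ (a * b ^ 2) = φ a
  add : ∀ a b, a ≠ 0 → b ≠ 0 → a + b ≠ 0 → φ a + φ b = φ (a + b) + φ (a * b * (a + b))

theorem polar_sum_right {ι : Type*} (s : Finset ι) (x : V) (f : ι → V) :
    polar q x (∑ i ∈ s, f i) = ∑ i ∈ s, polar q x (f i) :=
  map_sum (q.polarBilin x) f s

theorem OrthFam.map_sum {ι : Type*} {v : ι → V} (h : OrthFam q v) (s : Finset ι) (c : ι → K) :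
    q (∑ i ∈ s, c i • v i) = ∑ i ∈ s, q (v i) * c i ^ 2 := by
  classical
  induction s using Finset.induction_on with
  | empty => simp
  | insert a s ha ih =>
    rw [Finset.sum_insert ha, Finset.sum_insert ha, QuadraticMap.map_add (⇑q), ih, polar_sum_right,
      Finset.sum_eq_zero (s := s) (f := fun i => polar q (c a • v a) (c i • v i)),
      QuadraticMap.map_smul]
    · simp only [smul_eq_mul]; ring
    · intro i hi
      rw [polar_smul_left, polar_smul_right, h.1 a i (by rintro rfl; exact ha hi)]
      simp

/-- If any two nonzero entries cancel, then three of them give `2 * y i = 0`, and exactly two make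
the whole sum vanish. This is where characteristic different from two enters the chain argument. -/
theorem exists_add_ne_zero {ι : Type*} [Fintype ι] (y : ι → K) (h2 : (2 : K) ≠ 0)
    (hs : ∑ i, y i ≠ 0) :
    (∃ i, y i ≠ 0 ∧ ∀ j, j ≠ i → y j = 0) ∨
      ∃ i j, i ≠ j ∧ y i ≠ 0 ∧ y j ≠ 0 ∧ y i + y j ≠ 0 := by
  classical
  by_contra! hcon
  obtain ⟨hc1, hc2⟩ := hcon
  obtain ⟨i, -, hi⟩ := Finset.exists_ne_zero_of_sum_ne_zero hs
  obtain ⟨j, hji, hj⟩ := hc1 i hi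
  have hij := hc2 i j hji.symm hi hj
  by_cases hk : ∃ k, k ≠ i ∧ k ≠ j ∧ y k ≠ 0
  · obtain ⟨k, hki, hkj, hk⟩ := hk
    have h1 := hc2 i k hki.symm hi hk
    have h3 := hc2 j k hkj.symm hj hk
    have : 2 * y i = 0 := by linear_combination hij + h1 - h3
    exact hi ((mul_eq_zero.mp this).resolve_left h2)
  · push Not at hk
    apply hs
    rw [← Finset.sum_subset (Finset.subset_univ {i, j}), Finset.sum_pair hji.symm, hij]
    intro k _ hk'
    simp only [Finset.mem_insert, Finset.mem_singleton, not_or] at hk'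
    exact hk k hk'.1 hk'.2

theorem span_range_le_of_forall {ι : Type*} {v w : ι → V}
    (h : ∀ i, w i ∈ Submodule.span K (Set.range v)) :
    Submodule.span K (Set.range w) ≤ Submodule.span K (Set.range v) := by
  rw [Submodule.span_le]
  rintro _ ⟨i, rfl⟩
  exact h i

/-- Witt's chain argument, by induction on the number of nonzero coordinates of `x`. Two basis
vectors whose contributions to `x` have an anisotropic sum are replaced, inside the plane they span,
by that sum and a vector orthogonal to it; the relation `IsFormFunction.add` keeps the sum of `φ`,
and `x` has lost a coordinate. In the end `x` is a multiple of one basis vector and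
`IsFormFunction.mul_sq` applies. No subtraction is used, so `φ` may take values in a monoid. -/
theorem OrthFam.exists_through {ι : Type*} [Fintype ι] {A : Type*} [AddCommMonoid A] {φ : K → A}
    (hφ : IsFormFunction φ) (h2 : (2 : K) ≠ 0) {x : V} (hx : q x ≠ 0) (k : ℕ) :
    ∀ (v : ι → V) (c : ι → K), OrthFam q v → Set.ncard {i | c i ≠ 0} = k → x = ∑ i, c i • v i →
      ∃ v' : ι → V, OrthFam q v' ∧
        Submodule.span K (Set.range v') = Submodule.span K (Set.range v) ∧
        ∑ i, φ (q (v' i)) = ∑ i, φ (q (v i)) ∧ ∃ i, v' i = x := by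
  classical
  induction k using Nat.strong_induction_on with
  | _ k ih =>
  intro v c hv hk hxc
  have hq := hv.map_sum Finset.univ c
  rw [← hxc] at hq
  have hmem : ∀ i, v i ∈ Submodule.span K (Set.range v) := fun i => Submodule.subset_span ⟨i, rfl⟩
  rcases exists_add_ne_zero (fun i => q (v i) * c i ^ 2) h2 (hq ▸ hx) with
    ⟨i, hi, hji⟩ | ⟨i, j, hij, hi, hj, hs⟩
  · have hc : c i ≠ 0 := fun h => hi (by simp [h])
    have hxi : x = c i • v i := by
      rw [hxc, Finset.sum_eq_single i]
      · intro j _ hj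
        have := (mul_eq_zero.mp (hji j hj)).resolve_left (hv.2 j)
        rw [pow_eq_zero_iff two_ne_zero] at this
        simp [this]
      · simp
    have hqx : q x = q (v i) * c i ^ 2 := by
      rw [hxi, QuadraticMap.map_smul, smul_eq_mul]; ring
    refine ⟨Function.update v i x, ⟨?_, ?_⟩, ?_, ?_, i, by simp⟩
    · intro a b hab
      by_cases ha : a = i
      · subst ha
        rw [Function.update_self, Function.update_of_ne hab.symm, hxi, polar_smul_left, hv.1 a b hab,
          smul_zero]
      · by_cases hb : b = i
        · subst hb
          rw [Function.update_self, Function.update_of_ne ha, hxi, polar_smul_right, hv.1 a b hab,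
            smul_zero]
        · rw [Function.update_of_ne ha, Function.update_of_ne hb, hv.1 a b hab]
    · intro a
      by_cases ha : a = i
      · subst ha; simpa using hx
      · simpa [ha] using hv.2 a
    · apply le_antisymm
      · refine span_range_le_of_forall fun a => ?_
        by_cases ha : a = i
        · subst ha
          rw [Function.update_self, hxi]
          exact Submodule.smul_mem _ _ (hmem a)
        · rw [Function.update_of_ne ha]; exact hmem a
      · refine span_range_le_of_forall fun a => ?_
        by_cases ha : a = i
        · subst ha
          have : v a = (c a)⁻¹ • Function.update v a x a := by
            rw [Function.update_self, hxi, smul_smul, inv_mul_cancel₀ hc, one_smul]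
          rw [this]
          exact Submodule.smul_mem _ _ (Submodule.subset_span ⟨a, rfl⟩)
        · exact Submodule.subset_span ⟨a, by rw [Function.update_of_ne ha]⟩
    · refine Finset.sum_congr rfl fun a _ => ?_
      by_cases ha : a = i
      · subst ha
        rw [Function.update_self, hqx, hφ.mul_sq _ _ (hv.2 a) hc]
      · rw [Function.update_of_ne ha]
  · have hci : c i ≠ 0 := fun h => hi (by simp [h])
    have hcj : c j ≠ 0 := fun h => hj (by simp [h])
    set a := q (v i) with ha
    set b := q (v j) with hb
    have ha0 : a ≠ 0 := hv.2 i
    have hb0 : b ≠ 0 := hv.2 j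
    set d := a * c i ^ 2 + b * c j ^ 2 with hd
    have hd0 : d ≠ 0 := hs
    set y := c i • v i + c j • v j with hy
    -- `z` spans the orthogonal complement of `y` in the plane of `v i` and `v j`. Its value `a * b
    -- * d` is, up to the square of `c i * c j`, the last entry of the relation for `a * c i ^ 2`
    -- and `b * c j ^ 2`.
    set z := (-(b * c j)) • v i + (a * c i) • v j with hz
    have hpij : polar q (v i) (v j) = 0 := hv.1 i j hij
    have hpji : polar q (v j) (v i) = 0 := hv.1 j i hij.symm
    have hqy : q y = d := by
      rw [hy, QuadraticMap.map_add (⇑q), QuadraticMap.map_smul, QuadraticMap.map_smul, polar_smul_left,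
        polar_smul_right, hpij]
      simp only [smul_eq_mul]
      ring
    have hqz : q z = a * b * d := by
      rw [hz, QuadraticMap.map_add (⇑q), QuadraticMap.map_smul, QuadraticMap.map_smul, polar_smul_left,
        polar_smul_right, hpij, ← ha, ← hb]
      simp only [smul_eq_mul]
      ring
    have hyz : polar q y z = 0 := by
      rw [hy, hz]
      simp only [polar_add_left, polar_add_right, polar_smul_left, polar_smul_right, hpij, hpji,
        polar_self, ← ha, ← hb, smul_eq_mul, nsmul_eq_mul]
      push_cast
      ring
    have hout : ∀ l, l ≠ i → l ≠ j → polar q y (v l) = 0 ∧ polar q z (v l) = 0 := by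
      intro l hli hlj
      simp only [hy, hz, polar_add_left, polar_smul_left, hv.1 i l hli.symm, hv.1 j l hlj.symm]
      simp
    set v₁ := Function.update (Function.update v i y) j z with hv₁
    have v₁j : v₁ j = z := by simp [hv₁]
    have v₁i : v₁ i = y := by simp [hv₁, hij]
    have v₁l : ∀ l, l ≠ i → l ≠ j → v₁ l = v l := fun l h h' => by simp [hv₁, h, h']
    have hvi : v i = d⁻¹ • ((a * c i) • y - c j • z) := by
      have : (a * c i) • y - c j • z = d • v i := by
        rw [hy, hz, hd]; module
      rw [this, smul_smul, inv_mul_cancel₀ hd0, one_smul]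
    have hvj : v j = d⁻¹ • ((b * c j) • y + c i • z) := by
      have : (b * c j) • y + c i • z = d • v j := by
        rw [hy, hz, hd]; module
      rw [this, smul_smul, inv_mul_cancel₀ hd0, one_smul]
    have hO : OrthFam q v₁ := by
      have hsymm : ∀ l m, polar q (v₁ l) (v₁ m) = polar q (v₁ m) (v₁ l) := fun l m => polar_comm _ _ _
      have key : ∀ l m, l ≠ m → (m ≠ i ∧ m ≠ j ∨ l = i ∧ m = j) → polar q (v₁ l) (v₁ m) = 0 := by
        rintro l m hlm (⟨hmi, hmj⟩ | ⟨rfl, rfl⟩)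
        · rw [v₁l m hmi hmj]
          by_cases hli : l = i
          · rw [hli, v₁i]; exact (hout m hmi hmj).1
          by_cases hlj : l = j
          · rw [hlj, v₁j]; exact (hout m hmi hmj).2
          rw [v₁l l hli hlj]; exact hv.1 l m hlm
        · rw [v₁i, v₁j, hyz]
      refine ⟨fun l m hlm => ?_, fun l => ?_⟩
      · by_cases h1 : m ≠ i ∧ m ≠ j ∨ l = i ∧ m = j
        · exact key l m hlm h1
        · rw [hsymm]
          refine key m l hlm.symm ?_
          grind
      · by_cases hli : l = i
        · rw [hli, v₁i, hqy]; exact hd0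
        by_cases hlj : l = j
        · rw [hlj, v₁j, hqz]; exact mul_ne_zero (mul_ne_zero ha0 hb0) hd0
        rw [v₁l l hli hlj]; exact hv.2 l
    set c₁ := Function.update (Function.update c i 1) j 0 with hc₁
    have c₁j : c₁ j = 0 := by simp [hc₁]
    have c₁i : c₁ i = 1 := by simp [hc₁, hij]
    have c₁l : ∀ l, l ≠ i → l ≠ j → c₁ l = c l := fun l h h' => by simp [hc₁, h, h']
    have hlt : Set.ncard {l | c₁ l ≠ 0} < k := by
      rw [← hk]
      refine Set.ncard_lt_ncard ⟨fun l hl => ?_, fun hsub => hsub hcj c₁j⟩ (Set.toFinite _)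
      by_cases hli : l = i
      · rw [hli]; exact hci
      by_cases hlj : l = j
      · rw [hlj]; exact hcj
      have hl' : c₁ l ≠ 0 := hl
      rwa [c₁l l hli hlj] at hl'
    have hx₁ : x = ∑ l, c₁ l • v₁ l := by
      rw [hxc, Finset.sum_eq_pair_add hij, Finset.sum_eq_pair_add hij (fun l => c₁ l • v₁ l), c₁j, c₁i, v₁i, one_smul, zero_smul, add_zero,
        Finset.sum_erase_pair_congr (f := fun l => c₁ l • v₁ l) (g := fun l => c l • v l)
          fun l h h' => by rw [c₁l l h h', v₁l l h h']]
    obtain ⟨v', h1, h3, h4, h5⟩ := ih _ hlt v₁ c₁ hO rfl hx₁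
    refine ⟨v', h1, h3.trans (le_antisymm ?_ ?_), h4.trans ?_, h5⟩
    · refine span_range_le_of_forall fun l => ?_
      by_cases hli : l = i
      · rw [hli, v₁i]
        exact add_mem (Submodule.smul_mem _ _ (hmem i)) (Submodule.smul_mem _ _ (hmem j))
      by_cases hlj : l = j
      · rw [hlj, v₁j]
        exact add_mem (Submodule.smul_mem _ _ (hmem i)) (Submodule.smul_mem _ _ (hmem j))
      rw [v₁l l hli hlj]
      exact hmem l
    · have hy' : y ∈ Submodule.span K (Set.range v₁) := Submodule.subset_span ⟨i, v₁i⟩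
      have hz' : z ∈ Submodule.span K (Set.range v₁) := Submodule.subset_span ⟨j, v₁j⟩
      refine span_range_le_of_forall fun l => ?_
      by_cases hli : l = i
      · rw [hli, hvi]
        exact Submodule.smul_mem _ _ (sub_mem (Submodule.smul_mem _ _ hy')
          (Submodule.smul_mem _ _ hz'))
      by_cases hlj : l = j
      · rw [hlj, hvj]
        exact Submodule.smul_mem _ _ (add_mem (Submodule.smul_mem _ _ hy')
          (Submodule.smul_mem _ _ hz'))
      exact Submodule.subset_span ⟨l, v₁l l hli hlj⟩
    · rw [Finset.sum_eq_pair_add hij, Finset.sum_eq_pair_add hij (fun l => φ (q (v l))),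
        Finset.sum_erase_pair_congr (f := fun l => φ (q (v₁ l))) (g := fun l => φ (q (v l)))
          fun l h h' => by rw [v₁l l h h'], v₁i, v₁j, hqy, hqz]
      congr 1
      have e1 := hφ.mul_sq a (c i) ha0 hci
      have e2 := hφ.mul_sq b (c j) hb0 hcj
      have e3 := hφ.add (a * c i ^ 2) (b * c j ^ 2) hi hj hs
      have e4 := hφ.mul_sq (a * b * d) (c i * c j) (mul_ne_zero (mul_ne_zero ha0 hb0) hd0)
        (mul_ne_zero hci hcj)
      rw [e1, e2] at e3
      rw [← ha, ← hb, e3, ← e4]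
      congr 2
      ring

theorem OrthFam.mem_span_tail {n : ℕ} {v : Fin (n + 1) → V} (h2 : (2 : K) ≠ 0) (hv : OrthFam q v)
    {y : V} (hy : y ∈ Submodule.span K (Set.range v)) (h0 : polar q (v 0) y = 0) :
    y ∈ Submodule.span K (Set.range (Fin.tail v)) := by
  obtain ⟨c, rfl⟩ := (Submodule.mem_span_range_iff_exists_fun K).mp hy
  rw [polar_sum_right, Finset.sum_eq_single 0, polar_smul_right, polar_self] at h0
  · have hc : c 0 = 0 := by
      simp only [nsmul_eq_mul, smul_eq_mul, mul_eq_zero] at h0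
      rcases h0 with h | h | h
      · exact h
      · exact absurd (by exact_mod_cast h) h2
      · exact absurd h (hv.2 0)
    rw [Fin.sum_univ_succ, hc, zero_smul, zero_add]
    exact Submodule.sum_mem _ fun i _ =>
      Submodule.smul_mem _ _ (Submodule.subset_span (Set.mem_range_self i))
  · intro i _ hi
    rw [polar_smul_right, hv.1 0 i hi.symm, smul_zero]
  · simp

theorem OrthFam.tail {n : ℕ} {v : Fin (n + 1) → V} (hv : OrthFam q v) : OrthFam q (Fin.tail v) :=
  ⟨fun i j hij => hv.1 _ _ (by simpa using hij), fun i => hv.2 _⟩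

theorem OrthFam.comp {ι κ : Type*} {v : ι → V} (hv : OrthFam q v) {e : κ → ι}
    (he : Function.Injective e) : OrthFam q (v ∘ e) :=
  ⟨fun _ _ hij => hv.1 _ _ (he.ne hij), fun _ => hv.2 _⟩

theorem OrthFam.span_tail_le {n : ℕ} {v w : Fin (n + 1) → V} (h2 : (2 : K) ≠ 0)
    (hv : OrthFam q v) (hw : OrthFam q w) (h0 : v 0 = w 0)
    (hs : Submodule.span K (Set.range v) ≤ Submodule.span K (Set.range w)) :
    Submodule.span K (Set.range (Fin.tail v)) ≤ Submodule.span K (Set.range (Fin.tail w)) :=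
  span_range_le_of_forall fun i => hw.mem_span_tail h2 (hs (Submodule.subset_span ⟨i.succ, rfl⟩)) <| by
    rw [← h0]
    exact hv.1 _ _ (Fin.succ_ne_zero i).symm

/-- `OrthFam.exists_through` moves the first basis to one through `w 0` without changing the sum.
Once `w 0` is removed from both, what remains are two orthogonal bases of its orthogonal complement
in the common span, and induction applies. -/
theorem OrthFam.sum_eq_fin {A : Type*} [AddCommMonoid A] {φ : K → A} (hφ : IsFormFunction φ)
    (h2 : (2 : K) ≠ 0) (n : ℕ) : ∀ v w : Fin n → V, OrthFam q v → OrthFam q w →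
      Submodule.span K (Set.range v) = Submodule.span K (Set.range w) →
      ∑ i, φ (q (v i)) = ∑ i, φ (q (w i)) := by
  induction n with
  | zero => simp
  | succ n ih =>
    intro v w hv hw hs
    have hmem : w 0 ∈ Submodule.span K (Set.range v) := hs ▸ Submodule.subset_span ⟨0, rfl⟩
    obtain ⟨c, hc⟩ := (Submodule.mem_span_range_iff_exists_fun K).mp hmem
    obtain ⟨v₁, h1, hs1, hsum, i, hi⟩ := OrthFam.exists_through hφ h2 (x := w 0) (hw.2 0)
      (Set.ncard {i | c i ≠ 0}) v c hv rfl hc.symm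
    set v₂ := v₁ ∘ Equiv.swap 0 i with hv₂
    have h20 : v₂ 0 = w 0 := by simp [hv₂, hi]
    have hO : OrthFam q v₂ := h1.comp (Equiv.injective _)
    have hs2 : Submodule.span K (Set.range v₂) = Submodule.span K (Set.range w) := by
      rw [hv₂, EquivLike.range_comp, hs1, hs]
    have hsum₂ : ∑ l, φ (q (v₂ l)) = ∑ l, φ (q (v₁ l)) :=
      Equiv.sum_comp (Equiv.swap 0 i) fun l => φ (q (v₁ l))
    clear_value v₂
    have htail := ih (Fin.tail v₂) (Fin.tail w) hO.tail hw.tail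
      (le_antisymm (hO.span_tail_le h2 hw h20 hs2.le) (hw.span_tail_le h2 hO h20.symm hs2.ge))
    rw [← hsum, ← hsum₂, Fin.sum_univ_succ, Fin.sum_univ_succ (fun l => φ (q (w l))), h20]
    exact congrArg _ htail

theorem OrthFam.linearIndependent {ι : Type*} {v : ι → V} (h2 : (2 : K) ≠ 0)
    (hv : OrthFam q v) : LinearIndependent K v := by
  refine LinearMap.linearIndependent_of_isOrthoᵢ (B := q.polarBilin) (fun i j hij => hv.1 i j hij)
    fun i => ?_
  rw [polarBilin_apply_apply, polar_self, nsmul_eq_mul]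
  exact mul_ne_zero (by exact_mod_cast h2) (hv.2 i)

/-- The source of every additive map defined below on isometry classes or on the Witt ring. The
target is only a monoid, so that the multiplicative monoid of power series is allowed. -/
theorem OrthFam.sum_eq {A : Type*} [AddCommMonoid A] {φ : K → A} (hφ : IsFormFunction φ)
    (h2 : (2 : K) ≠ 0) {ι κ : Type*} [Fintype ι] [Fintype κ] {v : ι → V} {w : κ → V}
    (hv : OrthFam q v) (hw : OrthFam q w)
    (hs : Submodule.span K (Set.range v) = Submodule.span K (Set.range w)) :
    ∑ i, φ (q (v i)) = ∑ i, φ (q (w i)) := by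
  have hcard : Fintype.card κ = Fintype.card ι := by
    rw [← finrank_span_eq_card (hv.linearIndependent h2), hs,
      finrank_span_eq_card (hw.linearIndependent h2)]
  let e := (Fintype.equivFin ι).symm
  let f := (Fintype.equivFinOfCardEq hcard).symm
  rw [← e.sum_comp, ← f.sum_comp]
  exact OrthFam.sum_eq_fin hφ h2 _ (v ∘ e) (w ∘ f) (hv.comp e.injective) (hw.comp f.injective)
    (by rw [EquivLike.range_comp, EquivLike.range_comp, hs])

end OrthogonalFamilies
end WittEt
namespace WittEt

/-! ### Diagonal forms and additive maps out of isometry classes. -/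

section FormSum

set_option linter.unnecessarySeqFocus false

open QuadraticMap

namespace QuadSpace

variable {K : Type u} [Field K]

theorem exists_orthFam [NeZero (2 : K)] (V : QuadSpace K) :
    ∃ v : Fin (Module.finrank K V.carrier) → V.carrier, OrthFam V.form v ∧
      Submodule.span K (Set.range v) = ⊤ := by
  have h2 : (2 : K) ≠ 0 := NeZero.ne 2
  obtain ⟨b, hb⟩ := LinearMap.BilinForm.exists_orthogonal_basis
    (B := associated (R := K) V.form) ⟨associated_isSymm K V.form⟩
  have key : ∀ x y, polar V.form x y = 2 * associated (R := K) V.form x y := by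
    intro x y
    rw [← QuadraticMap.polarBilin_apply_apply, ← two_nsmul_associated K V.form]
    simp [two_mul, two_smul]
  have ho : ∀ i j, i ≠ j → polar V.form (b i) (b j) = 0 := fun i j hij => by
    rw [key, show associated (R := K) V.form (b i) (b j) = 0 from hb hij, mul_zero]
  refine ⟨b, ⟨ho, fun i hi => ?_⟩, b.span_eq⟩
  refine b.ne_zero i ((nondegenerate_iff _).mp V.nondegenerate _ fun y => ?_)
  rw [← b.sum_repr y, polar_sum_right]
  refine Finset.sum_eq_zero fun j _ => ?_
  rw [polar_smul_right]
  by_cases hij : i = j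
  · subst hij
    rw [polar_self, hi, smul_zero, smul_zero]
  · rw [ho i j hij, smul_zero]

theorem iso_of_forall [NeZero (2 : K)] {V W : QuadSpace K} (e : V.carrier ≃ₗ[K] W.carrier)
    (h : ∀ x, W.form (e x) = V.form x) : V ≈ W :=
  ⟨{ toLinearEquiv := e, map_app' := h }⟩

/-- The one-dimensional form `a x ^ 2`. -/
def unary [NeZero (2 : K)] (a : K) (ha : a ≠ 0) : QuadSpace K where
  carrier := K
  form := a • QuadraticMap.sq
  nondegenerate := by
    rw [nondegenerate_iff]
    intro x h
    have h1 := h 1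
    have h2 : (2 : K) ≠ 0 := NeZero.ne 2
    simp only [polar, _root_.smul_apply, QuadraticMap.sq_apply, smul_eq_mul] at h1
    have : (a * 2) * x = 0 := by linear_combination h1
    exact (mul_eq_zero.mp this).resolve_left (mul_ne_zero ha h2)

theorem unary_apply [NeZero (2 : K)] (a : K) (ha : a ≠ 0) (x : K) :
    (unary a ha).form x = a * x ^ 2 := by
  change a * (x * x) = _
  ring

/-- The diagonal form `∑ a i * x i ^ 2`. -/
def diag [NeZero (2 : K)] {n : ℕ} (a : Fin n → K) (ha : ∀ i, a i ≠ 0) : QuadSpace K where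
  carrier := Fin n → K
  form := weightedSumSquares K a
  nondegenerate := by
    rw [nondegenerate_iff]
    intro x h
    have h2 : (2 : K) ≠ 0 := NeZero.ne 2
    funext i
    have h1 := h (Pi.single i 1)
    simp only [polar, weightedSumSquares_apply, Pi.add_apply, smul_eq_mul,
      ← Finset.sum_sub_distrib] at h1
    rw [Finset.sum_eq_single i] at h1
    · have : (a i * 2) * x i = 0 := by
        rw [Pi.single_eq_same] at h1
        linear_combination h1
      exact (mul_eq_zero.mp this).resolve_left (mul_ne_zero (ha i) h2)
    · intro j _ hj
      rw [Pi.single_eq_of_ne hj]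
      ring
    · simp

end QuadSpace

variable {K : Type u} [Field K] [NeZero (2 : K)]

open QuadSpace

open Classical in
/-- The class of the one-dimensional form `a x ^ 2`, with value `0` at `0`. -/
noncomputable def FormClass.unary (a : K) : FormClass K :=
  if ha : a ≠ 0 then FormClass.mk (QuadSpace.unary a ha) else 0

theorem FormClass.unary_of_ne {a : K} (ha : a ≠ 0) :
    FormClass.unary a = FormClass.mk (QuadSpace.unary a ha) := dif_pos ha

theorem FormClass.mk_add (V W : QuadSpace K) :
    FormClass.mk (V.add W) = FormClass.mk V + FormClass.mk W := rfl

theorem FormClass.mk_mul (V W : QuadSpace K) :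
    FormClass.mk (V.mul W) = FormClass.mk V * FormClass.mk W := rfl

theorem FormClass.mk_diag {n : ℕ} (a : Fin n → K) (ha : ∀ i, a i ≠ 0) :
    FormClass.mk (QuadSpace.diag a ha) = ∑ i, FormClass.unary (a i) := by
  induction n with
  | zero =>
    refine Quotient.sound ?_
    refine iso_of_forall (V := QuadSpace.diag a ha) (W := QuadSpace.zero)
      { toFun := fun _ => 0
        invFun := fun _ => 0
        map_add' := fun _ _ => rfl
        map_smul' := fun _ _ => rfl
        left_inv := fun x => Subsingleton.elim (α := Fin 0 → K) _ _
        right_inv := fun _ => rfl } fun (x : Fin 0 → K) => ?_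
    change (0 : K) = weightedSumSquares K a x
    simp [weightedSumSquares_apply]
  | succ n ih =>
    rw [Fin.sum_univ_succ, FormClass.unary_of_ne (ha 0), ← ih (fun i => a i.succ) fun i => ha _,
      ← FormClass.mk_add]
    refine Quotient.sound (Setoid.symm ?_)
    refine iso_of_forall (V := (QuadSpace.unary (a 0) (ha 0)).add (QuadSpace.diag (fun i => a i.succ)
      fun i => ha _)) (W := QuadSpace.diag a ha) (Fin.consLinearEquiv K fun _ => K) ?_
    rintro ⟨(x : K), (y : Fin n → K)⟩
    change weightedSumSquares K a (Fin.cons x y : Fin (n + 1) → K) = a 0 * (x * x) +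
      weightedSumSquares K (fun i => a i.succ) y
    simp [weightedSumSquares_apply, Fin.sum_univ_succ]

theorem FormClass.mk_eq_sum {ι : Type*} [Fintype ι] (V : QuadSpace K) {v : ι → V.carrier}
    (hv : OrthFam V.form v) (hs : Submodule.span K (Set.range v) = ⊤) :
    FormClass.mk V = ∑ i, FormClass.unary (V.form (v i)) := by
  let e := (Fintype.equivFin ι).symm
  rw [← e.sum_comp, ← FormClass.mk_diag (fun i => V.form (v (e i))) fun i => hv.2 _]
  let b : Module.Basis (Fin (Fintype.card ι)) K V.carrier :=
    Module.Basis.mk ((hv.comp e.injective).linearIndependent (NeZero.ne 2))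
      (by rw [EquivLike.range_comp, hs])
  refine Quotient.sound (Setoid.symm ?_)
  refine iso_of_forall (V := QuadSpace.diag (fun i => V.form (v (e i))) fun i => hv.2 _) (W := V)
    b.equivFun.symm fun (x : Fin (Fintype.card ι) → K) => ?_
  change V.form (b.equivFun.symm x) = weightedSumSquares K (fun i => V.form (v (e i))) x
  rw [Module.Basis.equivFun_symm_apply, weightedSumSquares_apply]
  simp only [b, Module.Basis.mk_apply]
  rw [(hv.comp e.injective).map_sum]
  refine Finset.sum_congr rfl fun i _ => ?_
  simp only [Function.comp_apply, smul_eq_mul]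
  ring

/-- The sum of the values of `φ` on a diagonalization of `V`. -/
noncomputable def QuadSpace.formSum {A : Type*} [AddCommMonoid A] (φ : K → A) (V : QuadSpace K) :
    A :=
  ∑ i, φ (V.form (V.exists_orthFam.choose i))

theorem QuadSpace.formSum_eq {A : Type*} [AddCommMonoid A] {φ : K → A} (hφ : IsFormFunction φ)
    {ι : Type*} [Fintype ι] (V : QuadSpace K) {v : ι → V.carrier} (hv : OrthFam V.form v)
    (hs : Submodule.span K (Set.range v) = ⊤) : V.formSum φ = ∑ i, φ (V.form (v i)) :=
  OrthFam.sum_eq hφ (NeZero.ne 2) V.exists_orthFam.choose_spec.1 hv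
    (V.exists_orthFam.choose_spec.2.trans hs.symm)

theorem QuadSpace.formSum_congr {A : Type*} [AddCommMonoid A] {φ : K → A} (hφ : IsFormFunction φ)
    {V W : QuadSpace K} (h : V ≈ W) : V.formSum φ = W.formSum φ := by
  obtain ⟨e⟩ := h
  obtain ⟨v, hv, hs⟩ := V.exists_orthFam
  have hp : ∀ x y, polar W.form (e x) (e y) = polar V.form x y := fun x y => by
    simp only [polar, ← map_add, IsometryEquiv.map_app]
  rw [formSum_eq hφ V hv hs, formSum_eq hφ W (v := fun i => e (v i))]
  · simp
  · exact ⟨fun i j hij => by rw [hp, hv.1 i j hij], fun i => by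
      rw [IsometryEquiv.map_app]; exact hv.2 i⟩
  · have : Set.range (fun i => e (v i)) = e.toLinearEquiv.toLinearMap '' Set.range v := by
      rw [← Set.range_comp]; rfl
    rw [this, Submodule.span_image, hs, Submodule.map_top, LinearEquiv.range]

theorem QuadSpace.formSum_add {A : Type*} [AddCommMonoid A] {φ : K → A} (hφ : IsFormFunction φ)
    (V W : QuadSpace K) : (V.add W).formSum φ = V.formSum φ + W.formSum φ := by
  obtain ⟨v, hv, hs⟩ := V.exists_orthFam
  obtain ⟨w, hw, ht⟩ := W.exists_orthFam
  let f : Fin (Module.finrank K V.carrier) ⊕ Fin (Module.finrank K W.carrier) →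
    V.carrier × W.carrier := Sum.elim (fun i => (v i, 0)) fun j => (0, w j)
  have hO : OrthFam (V.form.prod W.form) f := by
    refine ⟨?_, ?_⟩
    · rintro (i | i) (j | j) hij
      · have := hv.1 i j (by simpa using hij)
        simpa [polar, f] using this
      · simp [polar, f]
      · simp [polar, f]
      · have := hw.1 i j (by simpa using hij)
        simpa [polar, f] using this
    · rintro (i | i)
      · simpa [f] using hv.2 i
      · simpa [f] using hw.2 i
  have hval : ∑ i, φ ((V.form.prod W.form) (f i)) =
      ∑ i, φ (V.form (v i)) + ∑ i, φ (W.form (w i)) := by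
    simp [f]
  rw [formSum_eq hφ V hv hs, formSum_eq hφ W hw ht, ← hval]
  refine formSum_eq hφ (V.add W) (v := f) hO ?_
  change Submodule.span K (Set.range (Sum.elim (fun i => (v i, (0 : W.carrier)))
    fun j => ((0 : V.carrier), w j))) = ⊤
  rw [Set.Sum.elim_range, Submodule.span_union]
  have h1 : (Set.range fun i => (v i, (0 : W.carrier))) =
        LinearMap.inl K V.carrier W.carrier '' Set.range v := by
      rw [← Set.range_comp]; rfl
  have h2 : (Set.range fun i => ((0 : V.carrier), w i)) =
        LinearMap.inr K V.carrier W.carrier '' Set.range w := by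
      rw [← Set.range_comp]; rfl
  rw [h1, h2, Submodule.span_image, Submodule.span_image, hs, ht, Submodule.map_top,
      Submodule.map_top]
  exact LinearMap.sup_range_inl_inr

theorem QuadSpace.formSum_unary {A : Type*} [AddCommMonoid A] {φ : K → A} (hφ : IsFormFunction φ)
    (a : K) (ha : a ≠ 0) : (QuadSpace.unary a ha).formSum φ = φ a := by
  have h1 : (QuadSpace.unary a ha).form (1 : K) = a := by rw [unary_apply]; simp
  rw [formSum_eq hφ (QuadSpace.unary a ha) (ι := Unit) (v := fun _ => (1 : K))]
  · rw [Fintype.sum_unique, h1]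
  · exact ⟨fun i j hij => absurd (Subsingleton.elim i j) hij, fun _ => by rw [h1]; exact ha⟩
  · change Submodule.span K (Set.range fun _ : Unit => (1 : K)) = ⊤
    rw [Set.range_const]
    exact Ideal.span_singleton_one

theorem QuadSpace.formSum_zero {A : Type*} [AddCommMonoid A] {φ : K → A} (hφ : IsFormFunction φ) :
    (QuadSpace.zero : QuadSpace K).formSum φ = 0 := by
  rw [formSum_eq hφ QuadSpace.zero (ι := Empty) (v := Empty.elim)]
  · simp
  · exact ⟨fun i => i.elim, fun i => i.elim⟩
  · refine eq_top_iff.mpr fun (x : PUnit.{u + 1}) _ => ?_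
    exact zero_mem (Submodule.span K (Set.range (Empty.elim : Empty → PUnit.{u + 1})))

/-- The additive extension of a form function to isometry classes. -/
noncomputable def FormClass.sumHom {A : Type*} [AddCommMonoid A] {φ : K → A}
    (hφ : IsFormFunction φ) : FormClass K →+ A where
  toFun := Quotient.lift (QuadSpace.formSum φ) fun _ _ h => QuadSpace.formSum_congr hφ h
  map_zero' := QuadSpace.formSum_zero hφ
  map_add' := by
    rintro ⟨V⟩ ⟨W⟩
    exact QuadSpace.formSum_add hφ V W

theorem FormClass.sumHom_unary {A : Type*} [AddCommMonoid A] {φ : K → A}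
    (hφ : IsFormFunction φ) {a : K} (ha : a ≠ 0) :
    FormClass.sumHom hφ (FormClass.unary a) = φ a := by
  rw [FormClass.unary_of_ne ha]
  exact QuadSpace.formSum_unary hφ a ha

theorem FormClass.unary_mul_sq (a b : K) (hb : b ≠ 0) :
    FormClass.unary (a * b ^ 2) = FormClass.unary a := by
  by_cases ha : a = 0
  · rw [ha, zero_mul]
  have hab : a * b ^ 2 ≠ 0 := mul_ne_zero ha (pow_ne_zero 2 hb)
  rw [unary_of_ne ha, unary_of_ne hab]
  refine Quotient.sound ?_
  refine iso_of_forall (V := QuadSpace.unary (a * b ^ 2) hab) (W := QuadSpace.unary a ha)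
    (LinearEquiv.smulOfUnit (Units.mk0 b hb) : K ≃ₗ[K] K) fun (x : K) => ?_
  change a * ((b * x) * (b * x)) = a * b ^ 2 * (x * x)
  ring

theorem FormClass.unary_mul (a b : K) :
    FormClass.unary (a * b) = FormClass.unary a * FormClass.unary b := by
  by_cases ha : a = 0
  · simp [ha, unary]
  by_cases hb : b = 0
  · simp [hb, unary]
  rw [unary_of_ne ha, unary_of_ne hb, unary_of_ne (mul_ne_zero ha hb), ← mk_mul]
  refine Quotient.sound (Setoid.symm ?_)
  refine iso_of_comp (V := (QuadSpace.unary a ha).mul (QuadSpace.unary b hb))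
    (W := QuadSpace.unary (a * b) (mul_ne_zero ha hb)) (TensorProduct.lid K K) ?_
  refine (QuadraticMap.associated_rightInverse K).injective ?_
  change associated (((a * b) • QuadraticMap.sq : QuadraticForm K K).comp (TensorProduct.lid K K).toLinearMap) =
    associated (QuadraticForm.tmul (a • QuadraticMap.sq) (b • QuadraticMap.sq))
  rw [QuadraticMap.associated_comp, QuadraticForm.associated_tmul]
  ext
  simp [mul_comm]

theorem FormClass.unary_one : FormClass.unary (1 : K) = 1 := by
  rw [unary_of_ne one_ne_zero]
  refine Quotient.sound ?_
  refine iso_of_forall (V := QuadSpace.unary (1 : K) one_ne_zero) (W := QuadSpace.one)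
    (LinearEquiv.refl K K) fun (x : K) => ?_
  change x * x = 1 * (x * x)
  ring

/-- The second relation is a change of basis: in `⟨a, b⟩` the vectors `(1, 1)` and `(-b, a)` are
orthogonal, with values `a + b` and `a * b * (a + b)`. -/
theorem FormClass.isFormFunction_unary : IsFormFunction (FormClass.unary : K → FormClass K) where
  mul_sq a b _ hb := unary_mul_sq a b hb
  add a b ha hb hab := by
    rw [unary_of_ne ha, unary_of_ne hb, unary_of_ne hab,
      unary_of_ne (mul_ne_zero (mul_ne_zero ha hb) hab), ← mk_add, ← mk_add]
    refine Quotient.sound (Setoid.symm ?_)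
    let e : (K × K) ≃ₗ[K] (K × K) :=
      { toFun := fun p => (p.1 - b * p.2, p.1 + a * p.2)
        invFun := fun p => ((a * p.1 + b * p.2) / (a + b), (p.2 - p.1) / (a + b))
        map_add' := fun p r => by ext <;> simp <;> ring
        map_smul' := fun c p => by ext <;> simp <;> ring
        left_inv := fun p => by ext <;> simp <;> field_simp <;> ring
        right_inv := fun p => by ext <;> simp <;> field_simp <;> ring }
    refine iso_of_forall (V := (QuadSpace.unary (a + b) hab).add
      (QuadSpace.unary (a * b * (a + b)) (mul_ne_zero (mul_ne_zero ha hb) hab)))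
      (W := (QuadSpace.unary a ha).add (QuadSpace.unary b hb)) e ?_
    rintro ⟨(x : K), (y : K)⟩
    change a * ((x - b * y) * (x - b * y)) + b * ((x + a * y) * (x + a * y)) =
      (a + b) * (x * x) + a * b * (a + b) * (y * y)
    ring

end FormSum

end WittEt
namespace WittEt

/-! ### Metabolic forms as sums of hyperbolic planes. -/

section Metabolic

open QuadraticMap

variable {K : Type*} [Field K]

/-- A metabolic space has an orthogonal basis on which the form takes the values `1` and `-1` equally often. -/
theorem exists_orthFam_of_metabolic (h2 : (2 : K) ≠ 0) (d : ℕ) :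
    ∀ (V : Type v) [AddCommGroup V] [Module K V] [Module.Finite K V] (q : QuadraticForm K V)
      (U : Submodule K V), Module.finrank K V = d → (∀ x, (∀ y, polar q x y = 0) → x = 0) →
      (∀ x, x ∈ U ↔ ∀ y ∈ U, polar q y x = 0) →
      ∃ (k : ℕ) (v : Fin k × Bool → V), OrthFam q v ∧ Submodule.span K (Set.range v) = ⊤ ∧
        ∀ i, q (v i) = if i.2 then 1 else -1 := by
  induction d using Nat.strong_induction_on with
  | _ d ih =>
  intro V _ _ _ q U hd hnd hU
  by_cases hV : ∀ x : V, x = 0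
  · refine ⟨0, fun i => i.1.elim0, ⟨fun i => i.1.elim0, fun i => i.1.elim0⟩, ?_, fun i => i.1.elim0⟩
    refine eq_top_iff.mpr fun x _ => ?_
    rw [hV x]
    exact zero_mem _
  -- If `U` were zero, its orthogonal complement would be the whole nonzero space.
  obtain ⟨u, huU, hu0⟩ : ∃ u ∈ U, u ≠ 0 := by
    by_contra! hcon
    push Not at hV
    obtain ⟨x, hx⟩ := hV
    refine hx (hcon x ((hU x).mpr fun y hy => ?_))
    rw [hcon y hy, polar_zero_left]
  have hqU : ∀ y ∈ U, q y = 0 := fun y hy => by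
    have h1 := (hU y).mp hy y hy
    rw [polar_self, nsmul_eq_mul] at h1
    exact (mul_eq_zero.mp h1).resolve_left (by exact_mod_cast h2)
  have hqu := hqU u huU
  obtain ⟨z₀, hz₀⟩ : ∃ z, polar q u z ≠ 0 := by
    by_contra! hcon
    exact hu0 (hnd u hcon)
  set p := polar q u z₀ with hp
  -- `z` completes `u` to a hyperbolic pair: scaling makes the pairing with `u` equal to `1`, and
  -- subtracting a multiple of the isotropic `u` makes `z` isotropic.
  set z := p⁻¹ • z₀ - (q (p⁻¹ • z₀)) • u with hz
  have huu : polar q u u = 0 := (hU u).mp huU u huU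
  have huz : polar q u z = 1 := by
    rw [hz, polar_sub_right, polar_smul_right, polar_smul_right, huu, ← hp]
    simp [hz₀]
  have hqz : q z = 0 := by
    have h1 : polar q (p⁻¹ • z₀) u = 1 := by
      rw [polar_smul_left, polar_comm, ← hp, smul_eq_mul, inv_mul_cancel₀ hz₀]
    rw [hz, sub_eq_add_neg, QuadraticMap.map_add (⇑q), QuadraticMap.map_neg,
      QuadraticMap.map_smul q (q (p⁻¹ • z₀)) u, hqu, polar_neg_right, polar_smul_right, h1]
    simp
  have hzu : polar q z u = 1 := by rw [polar_comm, huz]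
  have hzz : polar q z z = 0 := by rw [polar_self, hqz, smul_zero]
  set e := u + z with he
  set f := u - z with hf
  have hqe : q e = 1 := by rw [he, QuadraticMap.map_add (⇑q), hqu, hqz, huz]; simp
  have hqf : q f = -1 := by
    rw [hf, sub_eq_add_neg, QuadraticMap.map_add (⇑q), hqu, QuadraticMap.map_neg, hqz,
      polar_neg_right, huz]
    simp
  have hef : polar q e f = 0 := by
    simp only [he, hf, polar_add_left, polar_sub_right, huu, huz, hzu, hzz]
    ring
  let W : Submodule K V := LinearMap.ker (q.polarBilin u) ⊓ LinearMap.ker (q.polarBilin z)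
  have hW : ∀ x, x ∈ W ↔ polar q u x = 0 ∧ polar q z x = 0 := fun x => Iff.rfl
  have hdec : ∀ x : V, x - polar q z x • u - polar q u x • z ∈ W := fun x => by
    rw [hW]
    simp only [polar_sub_right, polar_smul_right, huu, huz, hzu, hzz]
    simp
  have hWe : ∀ x ∈ W, polar q e x = 0 ∧ polar q f x = 0 := fun x hx => by
    obtain ⟨h1, h3⟩ := (hW x).mp hx
    simp [he, hf, polar_add_left, polar_sub_left, h1, h3]
  have hlt : Module.finrank K W < d := by
    rw [← hd]
    refine Submodule.finrank_lt ?_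
    intro hWt
    have : z ∈ W := hWt ▸ Submodule.mem_top
    have := ((hW z).mp this).1
    rw [huz] at this
    exact one_ne_zero this
  have hndW : ∀ x : W, (∀ y : W, polar (q.restrict W) x y = 0) → x = 0 := by
    intro x hx
    have hpx : ∀ y : W, polar q (x : V) y = 0 := fun y => hx y
    obtain ⟨h1, h3⟩ := (hW x).mp x.2
    refine Subtype.ext (hnd x fun y => ?_)
    have h4 := hpx ⟨_, hdec y⟩
    simp only [polar_sub_right, polar_smul_right] at h4
    rw [polar_comm q (x : V) u, polar_comm q (x : V) z, h1, h3] at h4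
    simpa using h4
  -- `U ∩ W` is its own orthogonal complement in `W`: an element `y` of `U` differs by a multiple of
  -- `u` from an element of `U ∩ W`, and `W` is orthogonal to `u`.
  obtain ⟨k, v, hv, hs, hval⟩ := ih _ hlt W (q.restrict W) (U.comap W.subtype) rfl hndW (by
    intro x
    constructor
    · intro hx y hy
      exact (hU x).mp hx y hy
    · intro hx
      refine (hU x).mpr fun y hy => ?_
      have hyu : polar q u y = 0 := (hU y).mp hy u huU
      have h1 := hdec y
      rw [hyu, zero_smul, sub_zero] at h1
      have h3 : polar q (y - polar q z y • u) (x : V) = 0 :=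
        hx ⟨_, h1⟩ (U.sub_mem hy (U.smul_mem _ huU))
      rw [polar_sub_left, polar_smul_left, ((hW x).mp x.2).1, smul_zero, sub_zero] at h3
      exact h3)
  let w : Fin (k + 1) × Bool → V := fun i =>
    Fin.cases (motive := fun _ => V) (if i.2 then e else f) (fun j => (v (j, i.2) : V)) i.1
  have hw0 : w (0, true) = e := rfl
  have hw0' : w (0, false) = f := rfl
  have hws : ∀ j b, w (j.succ, b) = v (j, b) := fun j b => rfl
  have hvW : ∀ j, (v j : V) ∈ W := fun j => (v j).2
  have hval' : ∀ j, q (v j : V) = if j.2 then 1 else -1 := hval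
  refine ⟨k + 1, w, ⟨?_, ?_⟩, ?_, ?_⟩
  · have hsym : ∀ i j, polar q (w i) (w j) = polar q (w j) (w i) := fun i j => polar_comm _ _ _
    have h0 : ∀ b j b', polar q (w (0, b)) (w (Fin.succ j, b')) = 0 := by
      intro b j b'
      rw [hws]
      cases b
      · exact (hWe _ (hvW _)).2
      · exact (hWe _ (hvW _)).1
    rintro ⟨i, b⟩ ⟨j, b'⟩ hij
    refine Fin.cases ?_ (fun i => ?_) i (motive := fun i => (i, b) ≠ (j, b') →
      polar q (w (i, b)) (w (j, b')) = 0) hij <;>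
    refine Fin.cases ?_ (fun j => ?_) j <;> intro hij
    · cases b <;> cases b'
      · exact absurd rfl hij
      · rw [hw0, hw0', polar_comm, hef]
      · rw [hw0, hw0', hef]
      · exact absurd rfl hij
    · exact h0 _ _ _
    · rw [hsym]; exact h0 _ _ _
    · rw [hws, hws]
      exact hv.1 (i, b) (j, b') (by
        intro h
        apply hij
        simp only [Prod.mk.injEq] at h ⊢
        exact ⟨by rw [h.1], h.2⟩)
  · rintro ⟨i, b⟩
    refine Fin.cases ?_ (fun i => ?_) i
    · cases b
      · rw [hw0', hqf]; simp
      · rw [hw0, hqe]; simp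
    · rw [hws]; exact hv.2 _
  · have he' : e ∈ Submodule.span K (Set.range w) := Submodule.subset_span ⟨_, hw0⟩
    have hf' : f ∈ Submodule.span K (Set.range w) := Submodule.subset_span ⟨_, hw0'⟩
    have hu' : u ∈ Submodule.span K (Set.range w) := by
      have : u = (2 : K)⁻¹ • (e + f) := by
        rw [he, hf, add_add_sub_cancel, ← two_smul K u, smul_smul, inv_mul_cancel₀ h2, one_smul]
      rw [this]
      exact Submodule.smul_mem _ _ (add_mem he' hf')
    have hz' : z ∈ Submodule.span K (Set.range w) := by
      have : z = e - u := by rw [he, add_sub_cancel_left]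
      rw [this]
      exact sub_mem he' hu'
    have hW' : W ≤ Submodule.span K (Set.range w) := by
      have h1 : (⊤ : Submodule K W).map W.subtype = W := by simp
      rw [← h1, ← hs, Submodule.map_span, Submodule.span_le]
      rintro _ ⟨_, ⟨⟨j, b⟩, rfl⟩, rfl⟩
      exact Submodule.subset_span ⟨(j.succ, b), rfl⟩
    refine eq_top_iff.mpr fun x _ => ?_
    have hx : x = (x - polar q z x • u - polar q u x • z) + polar q z x • u + polar q u x • z := by
      abel
    rw [hx]
    exact add_mem (add_mem (hW' (hdec x)) (Submodule.smul_mem _ _ hu')) (Submodule.smul_mem _ _ hz')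
  · rintro ⟨i, b⟩
    refine Fin.cases ?_ (fun i => ?_) i
    · cases b
      · rw [hw0', hqf]; simp
      · rw [hw0, hqe]; simp
    · rw [hws, hval']

end Metabolic

/-! ### The Witt ring presented by one-dimensional forms. -/

section WittRingPresentation

variable {K : Type u} [Field K] [NeZero (2 : K)]

open QuadSpace

theorem QuadSpace.IsMetabolic.class_eq {V : QuadSpace K} (hV : V.IsMetabolic) :
    ∃ k : ℕ, FormClass.mk V = k • (FormClass.unary 1 + FormClass.unary (-1)) := by
  obtain ⟨U, hU⟩ := hV
  obtain ⟨k, v, hv, hs, hval⟩ := exists_orthFam_of_metabolic (K := K) (NeZero.ne 2) _ V.carrier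
    V.form U rfl ((nondegenerate_iff _).mp V.nondegenerate) (fun x => by
      constructor
      · intro hx y hy
        have hx' : x ∈ LinearMap.BilinForm.orthogonal V.form.polarBilin U := by rwa [hU]
        exact hx' y hy
      · intro hx
        rw [← hU]
        exact fun y hy => hx y hy)
  refine ⟨k, ?_⟩
  rw [FormClass.mk_eq_sum V hv hs, Fintype.sum_prod_type]
  simp [hval]

theorem FormClass.exists_sum (c : FormClass K) :
    ∃ (n : ℕ) (a : Fin n → K), (∀ i, a i ≠ 0) ∧ c = ∑ i, FormClass.unary (a i) := by
  obtain ⟨V, rfl⟩ := Quotient.exists_rep c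
  obtain ⟨v, hv, hs⟩ := V.exists_orthFam
  exact ⟨_, fun i => V.form (v i), hv.2, FormClass.mk_eq_sum V hv hs⟩

theorem hyperbolic_isMetabolic :
    ((unary (1 : K) one_ne_zero).add (unary (-1) (neg_ne_zero.mpr one_ne_zero))).IsMetabolic := by
  have hform : ∀ x : K × K, ((unary (1 : K) one_ne_zero).add
      (unary (-1) (neg_ne_zero.mpr one_ne_zero))).form x = x.1 * x.1 - x.2 * x.2 := fun x => by
    change 1 * (x.1 * x.1) + -1 * (x.2 * x.2) = _
    ring
  refine ⟨LinearMap.ker (LinearMap.fst K K K - LinearMap.snd K K K), ?_⟩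
  have h2 : (2 : K) ≠ 0 := NeZero.ne 2
  have hmem' : ∀ y : K × K, y ∈ LinearMap.ker (LinearMap.fst K K K - LinearMap.snd K K K) ↔
      y.1 = y.2 := fun y => by
    rw [LinearMap.mem_ker, LinearMap.sub_apply, sub_eq_zero]; rfl
  ext (x : K × K)
  have hpol : ∀ y : K × K, QuadraticMap.polar ((unary (1 : K) one_ne_zero).add
      (unary (-1) (neg_ne_zero.mpr one_ne_zero))).form y x = 2 * (y.1 * x.1 - y.2 * x.2) := by
    intro y
    have := hform (y + x)
    unfold QuadraticMap.polar
    rw [hform x, hform y]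
    refine (congrArg (fun t => t - _ - _) this).trans ?_
    simp only [Prod.fst_add, Prod.snd_add]
    ring
  refine Iff.trans ?_ (hmem' x).symm
  constructor
  · intro hx
    have h1 := hx ((1, 1) : K × K) ((hmem' (1, 1)).mpr rfl)
    have h3 := (hpol (1, 1)).symm.trans h1
    have := (mul_eq_zero.mp h3).resolve_left h2
    simpa [sub_eq_zero] using this
  · intro hx (y : K × K) hy
    refine (hpol y).trans ?_
    have hy' : y.1 = y.2 := (hmem' y).mp hy
    rw [hx, hy', sub_self, mul_zero]

/-- A metabolic form is already a multiple of the hyperbolic plane among isometry classes, so a map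
out of the Witt ring has only one relation to respect beyond those of isometry classes. -/
theorem metabolicIdeal_eq_span :
    metabolicIdeal K = Ideal.span
      {GrothendieckRing.ofHom (FormClass.unary 1 + FormClass.unary (-1) : FormClass K)} := by
  apply le_antisymm
  · rw [metabolicIdeal, Ideal.span_le]
    rintro _ ⟨V, hV, rfl⟩
    obtain ⟨k, hk⟩ := hV.class_eq
    rw [hk, map_nsmul]
    exact nsmul_mem (Ideal.mem_span_singleton_self _) k
  · rw [Ideal.span_singleton_le_iff_mem]
    refine Ideal.subset_span ⟨_, hyperbolic_isMetabolic, ?_⟩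
    rw [FormClass.mk_add, ← FormClass.unary_of_ne, ← FormClass.unary_of_ne]

namespace WittRing

/-- The class of `a x ^ 2` in the Witt ring, with value `0` at `0`. -/
noncomputable def dg : K →*₀ WittRing K where
  toFun a := Ideal.Quotient.mk _ (GrothendieckRing.ofHom (FormClass.unary a))
  map_zero' := by simp [FormClass.unary]
  map_one' := by simp [FormClass.unary_one]
  map_mul' a b := by simp [FormClass.unary_mul]

theorem dg_def (a : K) :
    dg a = Ideal.Quotient.mk (metabolicIdeal K) (GrothendieckRing.ofHom (FormClass.unary a)) := rfl

theorem mk_eq_sum {ι : Type*} [Fintype ι] (V : QuadSpace K) {v : ι → V.carrier}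
    (hv : OrthFam V.form v) (hs : Submodule.span K (Set.range v) = ⊤) :
    mk V = ∑ i, dg (V.form (v i)) := by
  rw [mk, FormClass.mk_eq_sum V hv hs, map_sum, map_sum]
  rfl

theorem dg_mul_sq (a b : K) (hb : b ≠ 0) : dg (a * b ^ 2) = dg a := by
  rw [dg_def, FormClass.unary_mul_sq a b hb, ← dg_def]

theorem dg_sq (b : K) (hb : b ≠ 0) : dg (b ^ 2) = 1 := by
  rw [← one_mul (b ^ 2), dg_mul_sq 1 b hb, map_one]

theorem dg_mul_self {a : K} (ha : a ≠ 0) : dg a * dg a = 1 := by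
  rw [← map_mul, ← pow_two, dg_sq a ha]

theorem one_add_dg_neg_one : (1 : WittRing K) + dg (-1) = 0 := by
  rw [← map_one dg, dg_def, dg_def, ← map_add, ← map_add, Ideal.Quotient.eq_zero_iff_mem,
    metabolicIdeal_eq_span]
  exact Ideal.mem_span_singleton_self _

theorem dg_neg (a : K) : dg (-a) = -dg a := by
  rw [← neg_one_mul, map_mul]
  linear_combination dg a * one_add_dg_neg_one (K := K)

/-- The convention `dg 0 = 0` removes all side conditions: for `a + b = 0` both sides vanish by
`dg_neg`, and for `a = 0` or `b = 0` the relation is trivial. -/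
theorem dg_add (a b : K) : dg a + dg b = dg (a + b) * (1 + dg (a * b)) := by
  by_cases ha : a = 0
  · simp [ha]
  by_cases hb : b = 0
  · simp [hb]
  by_cases hab : a + b = 0
  · rw [hab, map_zero, zero_mul, eq_neg_of_add_eq_zero_left hab, dg_neg, neg_add_cancel]
  have h := congrArg (fun c => Ideal.Quotient.mk (metabolicIdeal K) (GrothendieckRing.ofHom c))
    (FormClass.isFormFunction_unary.add a b ha hb hab)
  simp only [_root_.map_add, ← dg_def] at h
  rw [h, map_mul dg (a * b)]
  ring

/-- Formal differences are not needed, since `-⟨b⟩ = ⟨-b⟩` in the Witt ring. -/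
theorem exists_sum (w : WittRing K) : ∃ (n : ℕ) (a : Fin n → K), (∀ i, a i ≠ 0) ∧
    w = ∑ i, dg (a i) := by
  obtain ⟨x, rfl⟩ := Ideal.Quotient.mk_surjective w
  induction x using GrothendieckRing.ind with
  | h c d =>
    obtain ⟨n, a, ha, rfl⟩ := c.exists_sum
    obtain ⟨m, b, hb, rfl⟩ := d.exists_sum
    refine ⟨n + m, Fin.append a fun i => -b i, fun i => ?_, ?_⟩
    · refine Fin.addCases (fun i => ?_) (fun i => ?_) i
      · simpa using ha i
      · simpa using hb i
    · rw [Fin.sum_univ_add]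
      simp only [Fin.append_left, Fin.append_right, dg_neg, Finset.sum_neg_distrib]
      rw [← sub_eq_add_neg, map_sub]
      congr 1
      · exact (map_sum ((Ideal.Quotient.mk (metabolicIdeal K)).comp GrothendieckRing.ofHom) _ _)
      · exact (map_sum ((Ideal.Quotient.mk (metabolicIdeal K)).comp GrothendieckRing.ofHom) _ _)

@[elab_as_elim]
theorem induction_on {P : WittRing K → Prop} (w : WittRing K) (h0 : P 0)
    (hadd : ∀ (a : K) (w), a ≠ 0 → P w → P (dg a + w)) : P w := by
  obtain ⟨n, a, ha, rfl⟩ := exists_sum w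
  induction n with
  | zero => simpa using h0
  | succ n ih =>
    rw [Fin.sum_univ_succ]
    exact hadd _ _ (ha 0) (ih _ fun i => ha _)

theorem addHom_ext {A : Type*} [AddMonoid A] {f g : WittRing K →+ A}
    (h : ∀ a, a ≠ 0 → f (dg a) = g (dg a)) : f = g := by
  ext w
  induction w using induction_on with
  | h0 => simp
  | hadd a w ha ih => rw [map_add, map_add, ih, h a ha]

theorem ringHom_ext_dg {A : Type*} [Semiring A] {f g : WittRing K →+* A}
    (h : ∀ a, a ≠ 0 → f (dg a) = g (dg a)) : f = g :=
  RingHom.ext fun w => DFunLike.congr_fun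
    (addHom_ext (f := f.toAddMonoidHom) (g := g.toAddMonoidHom) h) w

/-- Additive maps out of the Witt ring, from their values on one-dimensional forms. -/
noncomputable def lift {A : Type*} [AddCommGroup A] {φ : K → A} (hφ : IsFormFunction φ)
    (hneg : ∀ a, a ≠ 0 → φ a + φ (-a) = 0) : WittRing K →+ A :=
  QuotientAddGroup.lift (metabolicIdeal K).toAddSubgroup
    (GrothendieckRing.liftAdd (FormClass.sumHom hφ)) (by
      intro x hx
      have hx' : x ∈ metabolicIdeal K := hx
      rw [metabolicIdeal_eq_span, Ideal.mem_span_singleton'] at hx'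
      obtain ⟨y, rfl⟩ := hx'
      -- It suffices to treat diagonal forms: `⟨a⟩ * (⟨1⟩ + ⟨-1⟩)` goes to `φ a + φ (-a)`.
      have key : ∀ c : FormClass K, GrothendieckRing.liftAdd (FormClass.sumHom hφ)
          (GrothendieckRing.ofHom c * GrothendieckRing.ofHom
            (FormClass.unary 1 + FormClass.unary (-1) : FormClass K)) = 0 := by
        intro c
        obtain ⟨n, a, ha, rfl⟩ := c.exists_sum
        rw [← map_mul]
        refine (GrothendieckRing.liftAdd_of _ _).trans ?_
        rw [Finset.sum_mul, map_sum]
        refine Finset.sum_eq_zero fun i _ => ?_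
        rw [mul_add, ← FormClass.unary_mul, ← FormClass.unary_mul, mul_one, mul_neg_one, map_add,
          FormClass.sumHom_unary hφ (ha i), FormClass.sumHom_unary hφ (neg_ne_zero.mpr (ha i)),
          hneg _ (ha i)]
      induction y using GrothendieckRing.ind with
      | h c d =>
        change GrothendieckRing.liftAdd (FormClass.sumHom hφ) ((GrothendieckRing.ofHom c -
          GrothendieckRing.ofHom d) * _) = 0
        rw [sub_mul, map_sub, key, key, sub_zero])

theorem lift_dg {A : Type*} [AddCommGroup A] {φ : K → A} (hφ : IsFormFunction φ)
    (hneg : ∀ a, a ≠ 0 → φ a + φ (-a) = 0) {a : K} (ha : a ≠ 0) : lift hφ hneg (dg a) = φ a :=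
  (GrothendieckRing.liftAdd_of _ _).trans (FormClass.sumHom_unary hφ ha)

/-- Functoriality of the Witt ring along a homomorphism of fields. -/
noncomputable def map {L : Type u} [Field L] [NeZero (2 : L)] (f : K →+* L) :
    WittRing K →+* WittRing L :=
  letI := f.toAlgebra
  baseChange K L

theorem map_algebraMap (L : Type u) [Field L] [NeZero (2 : L)] [Algebra K L] :
    map (algebraMap K L) = baseChange K L := by
  have h : ∀ (i j : Algebra K L), i = j →
      @baseChange K _ _ L _ _ i = @baseChange K _ _ L _ _ j := by
    rintro i _ rfl
    rfl
  exact h _ _ (Algebra.algebra_ext _ _ fun _ => rfl)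

@[simp]
theorem map_dg {L : Type u} [Field L] [NeZero (2 : L)] (f : K →+* L) (a : K) :
    map f (dg a) = dg (f a) := by
  by_cases ha : a = 0
  · simp [ha]
  have hfa : f a ≠ 0 := (map_ne_zero f).mpr ha
  let _ := f.toAlgebra
  have h1 : ∀ {F : Type u} [Field F] [NeZero (2 : F)] {b : F} (hb : b ≠ 0),
      dg b = mk (QuadSpace.unary b hb) := fun hb => by
    rw [dg_def, FormClass.unary_of_ne hb]; rfl
  change baseChange K L (dg a) = _
  rw [h1 ha, h1 hfa, baseChange_mk]
  refine congrArg (fun c => Ideal.Quotient.mk _ (GrothendieckRing.ofHom c)) (Quotient.sound ?_)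
  refine iso_of_comp (V := (QuadSpace.unary a ha).baseChange L) (W := QuadSpace.unary (f a) hfa)
    (TensorProduct.AlgebraTensorModule.rid K L L) ?_
  refine baseChange_ext fun (m : K) => ?_
  change (f a) * ((m • (1 : L)) * (m • (1 : L))) =
    (QuadraticForm.baseChange L (a • QuadraticMap.sq : QuadraticForm K K)) (1 ⊗ₜ[K] m)
  simp [Algebra.smul_def]
  exact Or.inl rfl

theorem map_map {L M : Type u} [Field L] [NeZero (2 : L)] [Field M] [NeZero (2 : M)]
    (f : K →+* L) (g : L →+* M) (w : WittRing K) : map g (map f w) = map (g.comp f) w := by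
  have : (map g).comp (map f) = map (g.comp f) := ringHom_ext_dg fun a _ => by simp
  exact DFunLike.congr_fun this w

theorem map_id (w : WittRing K) : map (RingHom.id K) w = w := by
  have : map (RingHom.id K) = RingHom.id (WittRing K) := ringHom_ext_dg fun a _ => by simp
  exact DFunLike.congr_fun this w

end WittRing

end WittRingPresentation

end WittEt
namespace WittEt

/-! ### Residue homomorphisms of the field of Laurent series. -/

section Laurent

open HahnSeries

variable {K : Type u} [Field K]

instance [NeZero (2 : K)] : NeZero (2 : LaurentSeries K) :=
  ⟨by
    have h := (map_ne_zero (C : K →+* LaurentSeries K)).mpr (NeZero.ne (2 : K))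
    rwa [map_ofNat] at h⟩

/-- The constant Laurent series. -/
noncomputable abbrev laurentC (K : Type u) [Field K] : K →+* LaurentSeries K := C

theorem order_mul_mul (x y z : LaurentSeries K) (hx : x ≠ 0) (hy : y ≠ 0) (hz : z ≠ 0) :
    ((x * y * z).order : ZMod 2) = x.order + y.order + z.order := by
  rw [order_mul (mul_ne_zero hx hy) hz, order_mul hx hy]
  push_cast
  rfl

theorem order_add_of_lt {x y : LaurentSeries K} (hx : x ≠ 0) (hy : y ≠ 0) (h : x.order < y.order) :
    (x + y).order = x.order ∧ (x + y).leadingCoeff = x.leadingCoeff := by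
  have h' : x.orderTop < y.orderTop := by
    rw [← order_eq_orderTop_of_ne_zero hx, ← order_eq_orderTop_of_ne_zero hy]
    exact_mod_cast h
  refine ⟨?_, leadingCoeff_add_eq_left h'⟩
  have h1 := orderTop_add_eq_left h'
  have hxy : x + y ≠ 0 := by
    rw [← orderTop_ne_top, h1, orderTop_ne_top]; exact hx
  rw [← order_eq_orderTop_of_ne_zero hx, ← order_eq_orderTop_of_ne_zero hxy] at h1
  exact_mod_cast h1

theorem order_add_of_eq {x y : LaurentSeries K} (h : x.order = y.order)
    (hs : x.leadingCoeff + y.leadingCoeff ≠ 0) :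
    (x + y).order = x.order ∧ (x + y).leadingCoeff = x.leadingCoeff + y.leadingCoeff := by
  have hc : (x + y).coeff x.order = x.leadingCoeff + y.leadingCoeff := by
    rw [coeff_add, leadingCoeff_eq, leadingCoeff_eq, h]
  have hxy : x + y ≠ 0 := by
    intro h0
    rw [h0, coeff_zero] at hc
    exact hs hc.symm
  have h1 : (x + y).order = x.order := by
    apply le_antisymm
    · exact order_le_of_coeff_ne_zero (by rwa [hc])
    · have := min_order_le_order_add (x := x) (y := y) hxy
      rwa [← h, min_self] at this
  exact ⟨h1, by rw [leadingCoeff_eq, h1, hc]⟩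

variable [NeZero (2 : K)]

open WittRing

/-- The class of the leading coefficient of `f` if the order of `f` is `r` modulo two, else zero. -/
noncomputable def resFun (r : ZMod 2) (f : LaurentSeries K) : WittRing K :=
  if (f.order : ZMod 2) = r then dg f.leadingCoeff else 0

theorem resFun_congr (r : ZMod 2) {f g : LaurentSeries K} (h : (f.order : ZMod 2) = g.order)
    (h' : dg f.leadingCoeff = dg g.leadingCoeff) : resFun r f = resFun r g := by
  rw [resFun, resFun, h, h']

theorem resFun_neg_congr (r : ZMod 2) {f g : LaurentSeries K} (h : (f.order : ZMod 2) = g.order)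
    (h' : dg f.leadingCoeff = -dg g.leadingCoeff) : resFun r f + resFun r g = 0 := by
  rw [resFun, resFun, h, h']
  split_ifs <;> simp

theorem zmod_two_add_self (a : ZMod 2) : a + a = 0 := CharTwo.add_self_eq_zero a

/-- Compare orders. If `a` has smaller order than `b`, then `a + b` looks like `a`, and `a * b * (a
+ b)` looks like `b` up to a square. If the orders agree and the leading coefficients do not cancel,
the relation is `dg_add` for them. If they cancel, both sides are zero: the two leading coefficients
are opposite, and `a * b * (a + b)` has the order parity of `a + b` and the opposite leading class,
however small `a + b` is. -/
theorem resFun_isFormFunction (r : ZMod 2) : IsFormFunction (resFun (K := K) r) where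
  mul_sq a b ha hb := by
    refine resFun_congr r ?_ ?_
    · rw [pow_two, ← mul_assoc, order_mul_mul _ _ _ ha hb hb, add_assoc, zmod_two_add_self, add_zero]
    · rw [pow_two, leadingCoeff_mul, leadingCoeff_mul, ← pow_two,
        dg_mul_sq _ _ (leadingCoeff_ne_zero.mpr hb)]
  add := by
    have hlt : ∀ a b : LaurentSeries K, a ≠ 0 → b ≠ 0 → a + b ≠ 0 → a.order < b.order →
        resFun r a + resFun r b = resFun r (a + b) + resFun r (a * b * (a + b)) := by
      intro a b ha hb hab h
      obtain ⟨h1, h2⟩ := order_add_of_lt ha hb h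
      congr 1
      · exact resFun_congr r (by rw [h1]) (by rw [h2])
      · refine resFun_congr r ?_ ?_
        · rw [order_mul_mul _ _ _ ha hb hab, h1, add_right_comm, zmod_two_add_self, zero_add]
        · rw [leadingCoeff_mul, leadingCoeff_mul, h2, ← dg_mul_sq b.leadingCoeff a.leadingCoeff
            (leadingCoeff_ne_zero.mpr ha)]
          congr 1
          ring
    intro a b ha hb hab
    rcases lt_trichotomy a.order b.order with h | h | h
    · exact hlt a b ha hb hab h
    · by_cases hs : a.leadingCoeff + b.leadingCoeff = 0
      · have hb' : b.leadingCoeff = -a.leadingCoeff := eq_neg_of_add_eq_zero_right hs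
        rw [resFun_neg_congr r (by rw [h]) (by rw [hb', dg_neg, neg_neg]), resFun_neg_congr r]
        · rw [order_mul_mul _ _ _ ha hb hab, h, zmod_two_add_self, zero_add]
        · rw [leadingCoeff_mul, leadingCoeff_mul, hb', ← dg_neg,
            ← dg_mul_sq (a + b).leadingCoeff a.leadingCoeff (leadingCoeff_ne_zero.mpr ha)]
          congr 1
          ring
      · obtain ⟨h1, h2⟩ := order_add_of_eq h hs
        have h3 : ((a * b * (a + b)).order : ZMod 2) = a.order := by
          rw [order_mul_mul _ _ _ ha hb hab, h1, ← h, zmod_two_add_self, zero_add]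
        rw [resFun, resFun, resFun, resFun, h3, h1, ← h]
        split_ifs
        · rw [leadingCoeff_mul, leadingCoeff_mul, h2, dg_add, map_mul dg (_ * _)]
          ring
        · rfl
    · rw [add_comm (resFun r a), add_comm a b, mul_comm a b]
      exact hlt b a hb ha (by rwa [add_comm]) h

/-- The residue homomorphisms of the field of Laurent series. -/
noncomputable def residue (r : ZMod 2) : WittRing (LaurentSeries K) →+ WittRing K :=
  lift (resFun_isFormFunction r) fun a _ => by
    rw [add_comm]
    exact resFun_neg_congr r (by rw [order_neg]) (by rw [leadingCoeff_neg, dg_neg])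

theorem residue_dg (r : ZMod 2) {f : LaurentSeries K} (hf : f ≠ 0) :
    residue r (dg f) = if (f.order : ZMod 2) = r then dg f.leadingCoeff else 0 :=
  lift_dg _ _ hf

theorem residue_dg_mul (r : ZMod 2) {f : LaurentSeries K} (hf : f ≠ 0) (w : WittRing K) :
    residue r (dg f * map (laurentC K) w) =
      if (f.order : ZMod 2) = r then dg f.leadingCoeff * w else 0 := by
  induction w using induction_on with
  | h0 => simp
  | hadd a w ha ih =>
    have hCa : (C a : LaurentSeries K) ≠ 0 := (map_ne_zero (C : K →+* LaurentSeries K)).mpr ha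
    have hlc : (C a : LaurentSeries K).leadingCoeff = a := leadingCoeff_of_single
    rw [map_add, mul_add, map_add, ih, map_dg, ← map_mul, residue_dg r (mul_ne_zero hf hCa),
      order_mul hf hCa, order_C, add_zero, leadingCoeff_mul, hlc]
    split_ifs
    · rw [map_mul, mul_add]
    · rw [add_zero]

theorem residue_zero_map (w : WittRing K) : residue 0 (map (laurentC K) w) = w := by
  have := residue_dg_mul 0 (one_ne_zero (α := LaurentSeries K)) w
  simpa using this

theorem residue_one_map (w : WittRing K) : residue 1 (map (laurentC K) w) = 0 := by
  have := residue_dg_mul 1 (one_ne_zero (α := LaurentSeries K)) w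
  simpa using this

/-- Brings identities over `K((s))` back to `K`, both after specializing a family and when a finite
base field has to be replaced by an infinite one. -/
theorem map_laurentC_injective : Function.Injective (map (laurentC K)) :=
  Function.LeftInverse.injective residue_zero_map

end Laurent

end WittEt
namespace WittEt

open Polynomial

/-! ### Expansion of rational functions at a point. -/

section Places

theorem neZero_two_of_hom {K L : Type*} [Field K] [NeZero (2 : K)] [Field L] (f : K →+* L) :
    NeZero (2 : L) :=
  ⟨by
    have h := (map_ne_zero f).mpr (NeZero.ne (2 : K))
    rwa [map_ofNat] at h⟩

variable {K : Type u} [Field K]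

instance [NeZero (2 : K)] : NeZero (2 : RatFunc K) := neZero_two_of_hom (RatFunc.C (K := K))

instance [NeZero (2 : K)] (π : K[X]) [Fact (Irreducible π)] : NeZero (2 : AdjoinRoot π) :=
  neZero_two_of_hom (AdjoinRoot.of π)

variable {L : Type u} [Field L]

/-- Expansion of a polynomial at the point `θ`, as a Laurent series. -/
noncomputable def expandPoly (i : K →+* L) (θ : L) : K[X] →+* LaurentSeries L :=
  (HahnSeries.ofPowerSeries ℤ L).comp <| (Polynomial.coeToPowerSeries.ringHom (R := L)).comp <|
    (taylorAlgHom θ).toRingHom.comp (mapRingHom i)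

theorem expandPoly_apply (i : K →+* L) (θ : L) (f : K[X]) :
    expandPoly i θ f = HahnSeries.ofPowerSeries ℤ L ((taylor θ (f.map i) : L[X]) : PowerSeries L) :=
  rfl

theorem expandPoly_injective (i : K →+* L) (θ : L) : Function.Injective (expandPoly i θ) := by
  intro f g h
  rw [expandPoly_apply, expandPoly_apply] at h
  have h1 := HahnSeries.ofPowerSeries_injective h
  exact Polynomial.map_injective i i.injective
    (taylor_injective θ (Polynomial.coe_injective L h1))

/-- The embedding of `K(t)` in the field of Laurent series over `L` sending `t` to `θ + s`. -/
noncomputable def expandAt (i : K →+* L) (θ : L) : RatFunc K →+* LaurentSeries L :=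
  RatFunc.liftRingHom (expandPoly i θ) (fun f hf => by
    rw [Submonoid.mem_comap, mem_nonZeroDivisors_iff_ne_zero]
    exact (map_ne_zero_iff _ (expandPoly_injective i θ)).mpr (nonZeroDivisors.ne_zero hf))

theorem expandAt_algebraMap (i : K →+* L) (θ : L) (f : K[X]) :
    expandAt i θ (algebraMap K[X] (RatFunc K) f) = expandPoly i θ f := by
  rw [expandAt, RatFunc.liftRingHom_algebraMap]

theorem expandAt_C (i : K →+* L) (θ : L) (a : K) :
    expandAt i θ (RatFunc.C a) = laurentC L (i a) := by
  rw [← RatFunc.algebraMap_C, expandAt_algebraMap, expandPoly_apply]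
  simp [laurentC]

theorem expandAt_comp_C (i : K →+* L) (θ : L) :
    (expandAt i θ).comp RatFunc.C = (laurentC L).comp i :=
  RingHom.ext fun a => expandAt_C i θ a

theorem expandAt_X (i : K →+* L) (θ : L) :
    expandAt i θ RatFunc.X = laurentC L θ + HahnSeries.single 1 1 := by
  rw [← RatFunc.algebraMap_X, expandAt_algebraMap, expandPoly_apply]
  simp [laurentC, add_comm]

theorem order_ofPowerSeries {Q : PowerSeries L} (hQ : PowerSeries.constantCoeff Q ≠ 0) :
    (HahnSeries.ofPowerSeries ℤ L Q).order = 0 ∧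
      (HahnSeries.ofPowerSeries ℤ L Q).leadingCoeff = PowerSeries.constantCoeff Q := by
  have h0 : (HahnSeries.ofPowerSeries ℤ L Q).coeff 0 = PowerSeries.constantCoeff Q := by
    have := HahnSeries.ofPowerSeries_apply_coeff (Γ := ℤ) Q 0
    simpa using this
  have hne : HahnSeries.ofPowerSeries ℤ L Q ≠ 0 := by
    intro h
    rw [h, HahnSeries.coeff_zero] at h0
    exact hQ h0.symm
  have h1 : (HahnSeries.ofPowerSeries ℤ L Q).order = 0 := by
    apply le_antisymm
    · exact HahnSeries.order_le_of_coeff_ne_zero (by rwa [h0])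
    · rw [HahnSeries.le_order_iff_forall hne]
      intro j hj
      rw [HahnSeries.ofPowerSeries_apply, HahnSeries.embDomain_of_notMem_range]
      rintro ⟨n, hn⟩
      have : (n : ℤ) = j := hn
      omega
  exact ⟨h1, by rw [HahnSeries.leadingCoeff_eq, h1, h0]⟩

theorem order_expandPoly {i : K →+* L} {θ : L} {f : K[X]} {e : ℕ} {Q : L[X]} (hQ : Q.coeff 0 ≠ 0)
    (h : taylor θ (f.map i) = X ^ e * Q) :
    (expandPoly i θ f).order = e ∧ (expandPoly i θ f).leadingCoeff = Q.coeff 0 := by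
  have hc : PowerSeries.constantCoeff (Q : PowerSeries L) = Q.coeff 0 := by
    rw [Polynomial.constantCoeff_coe]
  obtain ⟨h1, h2⟩ := order_ofPowerSeries (L := L) (Q := Q) (by rwa [hc])
  have hne : HahnSeries.ofPowerSeries ℤ L (Q : PowerSeries L) ≠ 0 := by
    rw [← HahnSeries.leadingCoeff_ne_zero, h2, hc]; exact hQ
  have hX : HahnSeries.ofPowerSeries ℤ L ((X ^ e * Q : L[X]) : PowerSeries L) =
      HahnSeries.single (e : ℤ) 1 * HahnSeries.ofPowerSeries ℤ L (Q : PowerSeries L) := by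
    rw [Polynomial.coe_mul, Polynomial.coe_pow, Polynomial.coe_X, map_mul,
      HahnSeries.ofPowerSeries_X_pow]
  have hs : (HahnSeries.single (e : ℤ) (1 : L)) ≠ 0 := HahnSeries.single_ne_zero one_ne_zero
  rw [expandPoly_apply, h, hX]
  constructor
  · rw [HahnSeries.order_mul hs hne, h1, HahnSeries.order_single one_ne_zero, add_zero]
  · rw [HahnSeries.leadingCoeff_mul, h2, HahnSeries.leadingCoeff_of_single, one_mul, hc]

theorem order_expandPoly_of_eval {i : K →+* L} {θ : L} {f : K[X]} (h : f.eval₂ i θ ≠ 0) :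
    (expandPoly i θ f).order = 0 ∧ (expandPoly i θ f).leadingCoeff = f.eval₂ i θ := by
  have h0 : (taylor θ (f.map i)).coeff 0 = f.eval₂ i θ := by
    rw [taylor_coeff_zero, eval_map]
  have := order_expandPoly (i := i) (θ := θ) (f := f) (e := 0) (Q := taylor θ (f.map i))
    (by rwa [h0]) (by simp)
  simpa [h0] using this

/-- An irreducible polynomial vanishes to odd order at each of its roots, in characteristic not two. -/
theorem exists_taylor_eq [NeZero (2 : K)] (i : K →+* L) {θ : L} {π : K[X]} (hπ : Irreducible π)
    (hθ : π.eval₂ i θ = 0) :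
    ∃ (e : ℕ) (Q : L[X]), Odd e ∧ Q.coeff 0 ≠ 0 ∧ taylor θ (π.map i) = X ^ e * Q := by
  obtain ⟨q, hq⟩ := ExpChar.exists K
  -- The residue field of `π` may be inseparable. Then `π` is a separable polynomial in `X ^ N`,
  -- where `N` is a power of the exponential characteristic; `N` is odd because the characteristic
  -- is not two, and every root of `π` has multiplicity `N`.
  obtain ⟨g, hg, m, hgm⟩ := hπ.hasSeparableContraction q
  have hN : Odd (q ^ m) := by
    refine Odd.pow ?_
    rcases hq with _ | hprime
    · exact odd_one
    · refine hprime.odd_of_ne_two ?_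
      rintro rfl
      exact NeZero.ne (2 : K) (by exact_mod_cast CharP.cast_eq_zero K 2)
  set N := q ^ m with hNdef
  have : ExpChar L q := expChar_of_injective_ringHom i.injective q
  have hexp : taylor θ (π.map i) = (g.map i).eval₂ C (C (θ ^ N) + X ^ N) := by
    rw [← hgm, map_expand, taylor_apply, expand_eq_comp_X_pow, comp_assoc, X_pow_comp,
      add_pow_expChar_pow, C_pow, add_comm, comp]
  set η := θ ^ N with hη
  have hgη : (g.map i).eval η = 0 := by
    rw [← hθ, ← hgm, ← eval_map, map_expand, expand_eval]
  have hsep : (g.map i).Separable := hg.map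
  have hg' : (g.map i).derivative.eval η ≠ 0 := hsep.eval₂_derivative_ne_zero (RingHom.id L) hgη
  -- First-order expansion of `g` at `η` with increment `X ^ N`: the constant term vanishes and the
  -- linear coefficient does not, so exactly `X ^ N` splits off.
  obtain ⟨k, hk⟩ := binomExpansion ((g.map i).map (C : L →+* L[X])) (C η) (X ^ N)
  refine ⟨N, C ((g.map i).derivative.eval η) + k * X ^ N, hN, ?_, ?_⟩
  · have hN0 : N ≠ 0 := hN.pos.ne'
    rw [coeff_add, coeff_C_zero, mul_coeff_zero, coeff_X_pow, if_neg hN0.symm, mul_zero, add_zero]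
    exact hg'
  · rw [hexp, ← eval_map, hk, derivative_map, eval_map, eval_map, ← hom_eval₂_id, ← hom_eval₂_id,
      hgη, C_0]
    ring
where
  hom_eval₂_id {p : L[X]} {x : L} : C (p.eval x) = p.eval₂ C (C x) := by
    rw [← eval₂_id, hom_eval₂, RingHom.comp_id]

end Places

end WittEt
namespace WittEt

open Polynomial

/-! ### Milnor's theorem on the Witt ring of `K(t)`, by filtration by degree. -/

section Milnor

set_option linter.unusedSectionVars false

open WittRing hiding map

variable {K : Type u} [Field K] [NeZero (2 : K)]

/-- The class over `K(t)` of a polynomial in `t`. -/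
noncomputable def dgPoly : K[X] →*₀ WittRing (RatFunc K) :=
  (dg : RatFunc K →*₀ WittRing (RatFunc K)).comp
    (algebraMap K[X] (RatFunc K)).toMonoidWithZeroHom

theorem dgPoly_apply (f : K[X]) : dgPoly f = dg (algebraMap K[X] (RatFunc K) f) := rfl

theorem dgPoly_add (f g : K[X]) : dgPoly f + dgPoly g = dgPoly (f + g) * (1 + dgPoly (f * g)) := by
  simp only [dgPoly_apply, map_add, map_mul (algebraMap K[X] (RatFunc K)), dg_add]

theorem dgPoly_neg (f : K[X]) : dgPoly (-f) = -dgPoly f := by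
  rw [dgPoly_apply, map_neg, dg_neg]; rfl

theorem dgPoly_mul_self {f : K[X]} (hf : f ≠ 0) : dgPoly f * dgPoly f = 1 :=
  dg_mul_self ((map_ne_zero_iff _ (IsFractionRing.injective K[X] (RatFunc K))).mpr hf)

/-- Nonzero polynomials all of whose irreducible factors have degree at most `d`. -/
def FactorsLE (d : ℕ) (f : K[X]) : Prop :=
  f ≠ 0 ∧ ∀ p : K[X], Irreducible p → p ∣ f → p.natDegree ≤ d

theorem FactorsLE.mul {d : ℕ} {f g : K[X]} (hf : FactorsLE d f) (hg : FactorsLE d g) :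
    FactorsLE d (f * g) :=
  ⟨mul_ne_zero hf.1 hg.1, fun p hp h => (hp.prime.dvd_or_dvd h).elim (hf.2 p hp) (hg.2 p hp)⟩

theorem FactorsLE.of_natDegree_le {d : ℕ} {f : K[X]} (hf : f ≠ 0) (h : f.natDegree ≤ d) :
    FactorsLE d f :=
  ⟨hf, fun _ _ hp => (natDegree_le_of_dvd hp hf).trans h⟩

/-- The subgroup of the Witt ring of `K(t)` generated by the polynomials whose irreducible factors have degree at
most `d`. -/
noncomputable def degFiltration (K : Type u) [Field K] [NeZero (2 : K)] (d : ℕ) :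
    AddSubgroup (WittRing (RatFunc K)) :=
  AddSubgroup.closure {w | ∃ f : K[X], FactorsLE d f ∧ w = dgPoly f}

theorem dgPoly_mem {d : ℕ} {f : K[X]} (hf : FactorsLE d f) : dgPoly f ∈ degFiltration K d :=
  AddSubgroup.subset_closure ⟨f, hf, rfl⟩

theorem dgPoly_mem_of_natDegree_le {d : ℕ} {f : K[X]} (h : f.natDegree ≤ d) :
    dgPoly f ∈ degFiltration K d := by
  by_cases hf : f = 0
  · rw [hf, map_zero]; exact zero_mem _
  · exact dgPoly_mem (FactorsLE.of_natDegree_le hf h)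

theorem dgPoly_mul_mem {d : ℕ} {f : K[X]} (hf : FactorsLE d f) {w : WittRing (RatFunc K)}
    (hw : w ∈ degFiltration K d) : dgPoly f * w ∈ degFiltration K d := by
  induction hw using AddSubgroup.closure_induction with
  | mem x hx =>
    obtain ⟨g, hg, rfl⟩ := hx
    rw [← map_mul]
    exact dgPoly_mem (hf.mul hg)
  | zero => rw [mul_zero]; exact zero_mem _
  | add x y _ _ hx hy => rw [mul_add]; exact add_mem hx hy
  | neg x _ hx => rw [mul_neg]; exact neg_mem hx

section Step

variable {d : ℕ} {π : K[X]}

theorem modByMonic_ne_zero_of_not_dvd (hm : π.Monic) {f : K[X]} (h : ¬π ∣ f) : f %ₘ π ≠ 0 :=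
  fun h' => h ((modByMonic_eq_zero_iff_dvd hm).mp h')

theorem natDegree_modByMonic_le_of (hm : π.Monic) (hd : π.natDegree = d + 1) (f : K[X]) :
    (f %ₘ π).natDegree ≤ d := by
  have := natDegree_modByMonic_lt f hm (by rintro rfl; simp at hd)
  omega

theorem FactorsLE.not_dvd {f : K[X]} (hf : FactorsLE d f) (hπ : Irreducible π)
    (hd : π.natDegree = d + 1) : ¬π ∣ f := fun h => by
  have := hf.2 π hπ h
  omega

/-- Write `g * h = r + π * s`. The relation `dgPoly_add` for this sum, multiplied by `⟨π⟩` with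
`⟨π⟩² = 1`, turns the difference into `⟨s⟩ - ⟨s r g h⟩`, where `π` no longer occurs. So modulo the
filtration `⟨π g h⟩` depends only on the residue class of `g * h`. -/
theorem dgPoly_mul_mod (hm : π.Monic) (hπ : Irreducible π) (hd : π.natDegree = d + 1) {g h : K[X]}
    (hg : g ≠ 0) (hh : h ≠ 0) (hgd : g.natDegree ≤ d) (hhd : h.natDegree ≤ d) :
    dgPoly (π * (g * h)) - dgPoly (π * ((g * h) %ₘ π)) ∈ degFiltration K d := by
  set r := (g * h) %ₘ π with hr
  set s := (g * h) /ₘ π with hs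
  have hgh : r + π * s = g * h := modByMonic_add_div (g * h) π
  have hg' := FactorsLE.of_natDegree_le hg hgd
  have hh' := FactorsLE.of_natDegree_le hh hhd
  have hr0 : r ≠ 0 := modByMonic_ne_zero_of_not_dvd hm ((hg'.mul hh').not_dvd hπ hd)
  have hrd : r.natDegree ≤ d := natDegree_modByMonic_le_of hm hd _
  have hsd : s.natDegree ≤ d := by
    rw [hs, natDegree_divByMonic _ hm, natDegree_mul hg hh]
    omega
  by_cases hs0 : s = 0
  · rw [← hgh, hs0, mul_zero, add_zero, sub_self]
    exact zero_mem _
  have h1 := dgPoly_add (π * s) r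
  rw [add_comm (π * s) r, hgh] at h1
  have h2 : dgPoly (π * (g * h)) - dgPoly (π * r) =
      dgPoly s - dgPoly (s * r * (g * h)) := by
    simp only [map_mul] at h1 ⊢
    linear_combination (-dgPoly π) * h1 + (dgPoly s - dgPoly s * dgPoly r * dgPoly g * dgPoly h) *
      dgPoly_mul_self hm.ne_zero
  rw [h2]
  have hs' := FactorsLE.of_natDegree_le hs0 hsd
  exact sub_mem (dgPoly_mem hs')
    (dgPoly_mem ((hs'.mul (FactorsLE.of_natDegree_le hr0 hrd)).mul (hg'.mul hh')))

/-- The polynomial is reduced modulo `π` after each irreducible factor, so that only products of two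
polynomials of degree at most `d` ever have to be reduced. -/
theorem dgPoly_mul_mod_of_factorsLE (hm : π.Monic) (hπ : Irreducible π)
    (hd : π.natDegree = d + 1) {h : K[X]} :
    FactorsLE d h → dgPoly (π * h) - dgPoly (π * (h %ₘ π)) ∈ degFiltration K d := by
  induction h using WfDvdMonoid.induction_on_irreducible with
  | zero => exact fun h => absurd rfl h.1
  | unit h hu =>
    intro _
    rw [(modByMonic_eq_self_iff hm).mpr, sub_self]
    · exact zero_mem _
    · rw [degree_eq_zero_of_isUnit hu]
      exact natDegree_pos_iff_degree_pos.mp (by omega)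
  | mul a p ha hp ih =>
    intro hpa
    have hfp : FactorsLE d p := ⟨hp.ne_zero, fun q hq hqp => hpa.2 q hq (hqp.mul_right a)⟩
    have hfa : FactorsLE d a := ⟨ha, fun q hq hqa => hpa.2 q hq (hqa.mul_left p)⟩
    have hpd : p.natDegree ≤ d := hpa.2 p hp (dvd_mul_right _ _)
    have h1 := dgPoly_mul_mem hfp (ih hfa)
    have h2 := dgPoly_mul_mod hm hπ hd hp.ne_zero
      (modByMonic_ne_zero_of_not_dvd hm (hfa.not_dvd hπ hd)) hpd (natDegree_modByMonic_le_of hm hd a)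
    have h3 : (p * (a %ₘ π)) %ₘ π = (p * a) %ₘ π := by
      have hdvd : π ∣ p * (a %ₘ π) - p * a := by
        rw [← mul_sub]
        refine Dvd.dvd.mul_left ⟨-(a /ₘ π), ?_⟩ p
        linear_combination modByMonic_add_div a π
      rw [← sub_eq_zero, ← sub_modByMonic, (modByMonic_eq_zero_iff_dvd hm).mpr hdvd]
    rw [h3] at h2
    have h4 : dgPoly (π * (p * a)) - dgPoly (π * ((p * a) %ₘ π)) =
        dgPoly p * (dgPoly (π * a) - dgPoly (π * (a %ₘ π))) +
          (dgPoly (π * (p * (a %ₘ π))) - dgPoly (π * ((p * a) %ₘ π))) := by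
      simp only [map_mul]
      ring
    rw [h4]
    exact add_mem h1 h2

/-- The generators of the next step of the degree filtration. -/
noncomputable def degGenerators (K : Type u) [Field K] [NeZero (2 : K)] (d : ℕ) :
    AddSubgroup (WittRing (RatFunc K)) :=
  AddSubgroup.closure {w | (∃ h : K[X], FactorsLE d h ∧ w = dgPoly h) ∨
    ∃ π h : K[X], π.Monic ∧ Irreducible π ∧ π.natDegree = d + 1 ∧ FactorsLE d h ∧
      w = dgPoly (π * h)}

/-- Two monic primes of degree `d + 1` differ by some `g` of degree at most `d`. The relation for
`π₁ = π₂ + g`, multiplied by `⟨π₁⟩`, reads `⟨π₁ π₂⟩ = 1 + ⟨π₂ g⟩ - ⟨π₁ g⟩`, so a product of several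
primes is traded for products with fewer. -/
theorem dgPoly_prod_mem_degGenerators (k : ℕ) : ∀ (s : List K[X]) (h : K[X]), s.length = k →
    (∀ π ∈ s, π.Monic ∧ Irreducible π ∧ π.natDegree = d + 1) → FactorsLE d h →
    dgPoly (s.prod * h) ∈ degGenerators K d := by
  induction k using Nat.strong_induction_on with
  | _ k ih =>
  intro s h hk hs hh
  match s, hk with
  | [], _ =>
    rw [List.prod_nil, one_mul]
    exact AddSubgroup.subset_closure (Or.inl ⟨h, hh, rfl⟩)
  | [π], _ =>
    obtain ⟨h1, h2, h3⟩ := hs π (by simp)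
    rw [List.prod_singleton]
    exact AddSubgroup.subset_closure (Or.inr ⟨π, h, h1, h2, h3, hh, rfl⟩)
  | π₁ :: π₂ :: s, hk =>
    simp only [List.length_cons] at hk
    obtain ⟨h1, h2, h3⟩ := hs π₁ (by simp)
    obtain ⟨h1', h2', h3'⟩ := hs π₂ (by simp)
    have hs' : ∀ π ∈ s, π.Monic ∧ Irreducible π ∧ π.natDegree = d + 1 := fun π hπ =>
      hs π (by simp [hπ])
    have hI := ih s.length (by omega) s h rfl hs' hh
    simp only [List.prod_cons]
    by_cases hne : π₁ - π₂ = 0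
    · rw [sub_eq_zero.mp hne]
      have : dgPoly (π₂ * (π₂ * s.prod) * h) = dgPoly (s.prod * h) := by
        simp only [map_mul]
        linear_combination (dgPoly s.prod * dgPoly h) * dgPoly_mul_self h1'.ne_zero
      rw [this]
      exact hI
    have hdeg : (π₁ - π₂).natDegree ≤ d := by
      have h5 := degree_sub_lt_left (by
        rw [degree_eq_natDegree h1.ne_zero, degree_eq_natDegree h1'.ne_zero, h3, h3']) h1.ne_zero (h1.leadingCoeff.trans h1'.leadingCoeff.symm)
      have h6 := natDegree_lt_natDegree hne h5
      omega
    set g := π₁ - π₂ with hg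
    have hgh : FactorsLE d (g * h) := (FactorsLE.of_natDegree_le hne hdeg).mul hh
    have hI1 := ih (s.length + 1) (by omega) (π₁ :: s) (g * h) rfl (by
      simpa using ⟨⟨h1, h2, h3⟩, hs'⟩) hgh
    have hI2 := ih (s.length + 1) (by omega) (π₂ :: s) (g * h) rfl (by
      simpa using ⟨⟨h1', h2', h3'⟩, hs'⟩) hgh
    have hadd := dgPoly_add π₂ g
    have hsum : π₂ + g = π₁ := by rw [hg]; ring
    rw [hsum] at hadd
    have : dgPoly (π₁ * (π₂ * s.prod) * h) = dgPoly (s.prod * h) +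
        dgPoly ((π₂ :: s).prod * (g * h)) - dgPoly ((π₁ :: s).prod * (g * h)) := by
      simp only [List.prod_cons, map_mul] at hadd ⊢
      linear_combination (dgPoly π₁ * dgPoly s.prod * dgPoly h) * hadd +
        (dgPoly s.prod * dgPoly h * (1 + dgPoly π₂ * dgPoly g)) * dgPoly_mul_self h1.ne_zero
    rw [this]
    exact sub_mem (add_mem hI hI2) hI1

theorem FactorsLE.exists_eq_prod_mul {f : K[X]} : FactorsLE (d + 1) f →
    ∃ (s : List K[X]) (h : K[X]), (∀ π ∈ s, π.Monic ∧ Irreducible π ∧ π.natDegree = d + 1) ∧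
      FactorsLE d h ∧ f = s.prod * h := by
  induction f using WfDvdMonoid.induction_on_irreducible with
  | zero => exact fun h => absurd rfl h.1
  | unit u hu =>
    refine fun _ => ⟨[], u, by simp, ⟨hu.ne_zero, fun p hp hpu => ?_⟩, by simp⟩
    exact absurd (isUnit_of_dvd_unit hpu hu) hp.not_isUnit
  | mul a p ha hp ih =>
    intro hpa
    obtain ⟨s, h, hs, hh, rfl⟩ := ih ⟨ha, fun q hq hqa => hpa.2 q hq (hqa.mul_left p)⟩
    have hpd : p.natDegree ≤ d + 1 := hpa.2 p hp (dvd_mul_right _ _)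
    by_cases hpd' : p.natDegree ≤ d
    · exact ⟨s, p * h, hs, (FactorsLE.of_natDegree_le hp.ne_zero hpd').mul hh, by ring⟩
    have hlc : p.leadingCoeff ≠ 0 := leadingCoeff_ne_zero.mpr hp.ne_zero
    have hC : FactorsLE d (C p.leadingCoeff) :=
      FactorsLE.of_natDegree_le (C_ne_zero.mpr hlc) (by simp)
    have hCu : IsUnit (C p.leadingCoeff⁻¹) := isUnit_C.mpr (IsUnit.mk0 _ (inv_ne_zero hlc))
    refine ⟨(p * C p.leadingCoeff⁻¹) :: s, C p.leadingCoeff * h, ?_, hC.mul hh, ?_⟩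
    · intro π hπ
      rcases List.mem_cons.mp hπ with rfl | hπ
      · refine ⟨monic_mul_leadingCoeff_inv hp.ne_zero, ?_, ?_⟩
        · rw [irreducible_mul_isUnit hCu]
          exact hp
        · rw [natDegree_mul_C (inv_ne_zero hlc)]
          omega
      · exact hs π hπ
    · have : C p.leadingCoeff⁻¹ * C p.leadingCoeff = 1 := by
        rw [← C_mul, inv_mul_cancel₀ hlc, C_1]
      rw [List.prod_cons]
      linear_combination (-p * s.prod * h) * this

theorem degFiltration_succ_le : degFiltration K (d + 1) ≤ degGenerators K d := by
  rw [degFiltration, AddSubgroup.closure_le]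
  rintro _ ⟨f, hf, rfl⟩
  obtain ⟨s, h, hs, hh, rfl⟩ := hf.exists_eq_prod_mul
  exact dgPoly_prod_mem_degGenerators s.length s h rfl hs hh

/-- The map `ā ↦ π a` from the residue field at `π` to the graded pieces of the degree filtration. -/
noncomputable def inducedFun (d : ℕ) (hm : π.Monic) (a : AdjoinRoot π) :
    WittRing (RatFunc K) ⧸ degFiltration K d :=
  QuotientAddGroup.mk (dgPoly (π * AdjoinRoot.modByMonicHom hm a))

theorem inducedFun_mk (hm : π.Monic) (hπ : Irreducible π) (hd : π.natDegree = d + 1) {h : K[X]}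
    (hh : FactorsLE d h) :
    inducedFun d hm (AdjoinRoot.mk π h) = QuotientAddGroup.mk (dgPoly (π * h)) := by
  rw [inducedFun, AdjoinRoot.modByMonicHom_mk, QuotientAddGroup.eq, neg_add_eq_sub]
  exact dgPoly_mul_mod_of_factorsLE hm hπ hd hh

theorem factorsLE_modByMonicHom (hm : π.Monic) (hd : π.natDegree = d + 1) {a : AdjoinRoot π}
    (ha : a ≠ 0) : FactorsLE d (AdjoinRoot.modByMonicHom hm a) := by
  refine FactorsLE.of_natDegree_le (fun h => ha ?_) ?_
  · rw [← AdjoinRoot.mk_leftInverse hm a, h, map_zero]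
  · obtain ⟨f, rfl⟩ := AdjoinRoot.mk_surjective a
    rw [AdjoinRoot.modByMonicHom_mk]
    exact natDegree_modByMonic_le_of hm hd f

/-- By `inducedFun_mk` an element of the residue field may be represented by any product of
polynomials of degree at most `d`. With products of reduced representatives, the relations of the
residue field become relations between classes of polynomials. -/
theorem inducedFun_isFormFunction [hπ : Fact (Irreducible π)] (hm : π.Monic)
    (hd : π.natDegree = d + 1) : IsFormFunction (inducedFun d hm) where
  mul_sq a b ha hb := by
    have hfa := factorsLE_modByMonicHom hm hd ha
    have hfb := factorsLE_modByMonicHom hm hd hb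
    have hab : a * b ^ 2 = AdjoinRoot.mk π (AdjoinRoot.modByMonicHom hm a *
        (AdjoinRoot.modByMonicHom hm b * AdjoinRoot.modByMonicHom hm b)) := by
      rw [map_mul, map_mul, AdjoinRoot.mk_leftInverse hm a, AdjoinRoot.mk_leftInverse hm b, pow_two]
    rw [hab, inducedFun_mk hm hπ.out hd (hfa.mul (hfb.mul hfb)), inducedFun]
    congr 1
    simp only [map_mul, dgPoly_mul_self hfb.1, mul_one]
  add a b ha hb hab := by
    have hfa := factorsLE_modByMonicHom hm hd ha
    have hfb := factorsLE_modByMonicHom hm hd hb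
    have hfab := factorsLE_modByMonicHom hm hd hab
    have hprod : a * b * (a + b) = AdjoinRoot.mk π (AdjoinRoot.modByMonicHom hm a *
        AdjoinRoot.modByMonicHom hm b * AdjoinRoot.modByMonicHom hm (a + b)) := by
      rw [map_mul, map_mul, AdjoinRoot.mk_leftInverse hm a, AdjoinRoot.mk_leftInverse hm b,
        AdjoinRoot.mk_leftInverse hm (a + b)]
    rw [hprod, inducedFun_mk hm hπ.out hd ((hfa.mul hfb).mul hfab), inducedFun, inducedFun,
      inducedFun, ← QuotientAddGroup.mk_add, ← QuotientAddGroup.mk_add]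
    congr 1
    have h := dgPoly_add (AdjoinRoot.modByMonicHom hm a) (AdjoinRoot.modByMonicHom hm b)
    rw [← map_add (AdjoinRoot.modByMonicHom hm)] at h
    simp only [map_mul] at h ⊢
    linear_combination dgPoly π * h

/-- The additive extension of `inducedFun`. -/
noncomputable def inducedHom [Fact (Irreducible π)] (hm : π.Monic) (hd : π.natDegree = d + 1) :
    WittRing (AdjoinRoot π) →+ WittRing (RatFunc K) ⧸ degFiltration K d :=
  lift (inducedFun_isFormFunction hm hd) fun a _ => by
    rw [inducedFun, inducedFun, map_neg, mul_neg, dgPoly_neg, QuotientAddGroup.mk_neg, add_neg_cancel]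

theorem inducedHom_mk [hπ : Fact (Irreducible π)] (hm : π.Monic) (hd : π.natDegree = d + 1)
    {h : K[X]} (hh : FactorsLE d h) :
    inducedHom hm hd (dg (AdjoinRoot.mk π h)) = QuotientAddGroup.mk (dgPoly (π * h)) := by
  rw [inducedHom, lift_dg, inducedFun_mk hm hπ.out hd hh]
  rw [Ne, AdjoinRoot.mk_eq_zero]
  exact hh.not_dvd hπ.out hd

end Step

/-- The residue at the place of `K(t)` given by an irreducible polynomial. -/
noncomputable def residueAt (π : K[X]) [Fact (Irreducible π)] :
    WittRing (RatFunc K) →+ WittRing (AdjoinRoot π) :=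
  (residue 1).comp (WittRing.map (expandAt (AdjoinRoot.of π) (AdjoinRoot.root π))).toAddMonoidHom

theorem residueAt_apply (π : K[X]) [Fact (Irreducible π)] (w : WittRing (RatFunc K)) :
    residueAt π w = residue 1 (WittRing.map (expandAt (AdjoinRoot.of π) (AdjoinRoot.root π)) w) := rfl

theorem residueAt_dgPoly (π : K[X]) [Fact (Irreducible π)] {f : K[X]} (hf : f ≠ 0) :
    residueAt π (dgPoly f) =
      if ((expandPoly (AdjoinRoot.of π) (AdjoinRoot.root π) f).order : ZMod 2) = 1 then
        dg (expandPoly (AdjoinRoot.of π) (AdjoinRoot.root π) f).leadingCoeff else 0 := by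
  rw [residueAt_apply, dgPoly_apply, WittRing.map_dg, expandAt_algebraMap, residue_dg]
  exact (map_ne_zero_iff _ (expandPoly_injective _ _)).mpr hf

theorem _root_.AdjoinRoot.eval₂_root_eq_mk {R : Type*} [CommRing R] {π f : R[X]} :
    f.eval₂ (AdjoinRoot.of π) (AdjoinRoot.root π) = AdjoinRoot.mk π f := by
  rw [← AdjoinRoot.aeval_eq, aeval_def]; rfl

theorem residueAt_dgPoly_of_not_dvd (π : K[X]) [Fact (Irreducible π)] {f : K[X]} (hf : ¬π ∣ f) :
    residueAt π (dgPoly f) = 0 := by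
  have hf0 : f ≠ 0 := by rintro rfl; exact hf (dvd_zero _)
  have h : f.eval₂ (AdjoinRoot.of π) (AdjoinRoot.root π) ≠ 0 := by
    rwa [AdjoinRoot.eval₂_root_eq_mk, Ne, AdjoinRoot.mk_eq_zero]
  rw [residueAt_dgPoly π hf0, (order_expandPoly_of_eval h).1]
  simp
-- `u` is the leading coefficient of `π` expanded at its root. It does not depend on `f`, and
-- multiplication by `⟨u⟩` undoes it. The residue is nonzero because the order of `π` is odd, even
-- over an inseparable residue field (`exists_taylor_eq`).
theorem exists_residueAt_dgPoly_mul (π : K[X]) [hπ : Fact (Irreducible π)] :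
    ∃ u : AdjoinRoot π, u ≠ 0 ∧ ∀ f : K[X], ¬π ∣ f →
      residueAt π (dgPoly (π * f)) = dg u * dg (AdjoinRoot.mk π f) := by
  obtain ⟨e, Q, he, hQ, h⟩ := exists_taylor_eq (AdjoinRoot.of π) hπ.out (AdjoinRoot.eval₂_root π)
  refine ⟨Q.coeff 0, hQ, fun f hf => ?_⟩
  have hf0 : f ≠ 0 := by rintro rfl; exact hf (dvd_zero _)
  have hfe : f.eval₂ (AdjoinRoot.of π) (AdjoinRoot.root π) ≠ 0 := by
    rwa [AdjoinRoot.eval₂_root_eq_mk, Ne, AdjoinRoot.mk_eq_zero]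
  obtain ⟨h1, h2⟩ := order_expandPoly hQ h
  obtain ⟨h3, h4⟩ := order_expandPoly_of_eval hfe
  have hinj := expandPoly_injective (AdjoinRoot.of π) (AdjoinRoot.root π)
  rw [residueAt_dgPoly π (mul_ne_zero hπ.out.ne_zero hf0), map_mul, HahnSeries.order_mul
    ((map_ne_zero_iff _ hinj).mpr hπ.out.ne_zero) ((map_ne_zero_iff _ hinj).mpr hf0), h1, h3,
    HahnSeries.leadingCoeff_mul, h2, h4, if_pos, map_mul, AdjoinRoot.eval₂_root_eq_mk]
  obtain ⟨k, rfl⟩ := he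
  push_cast
  rw [add_zero, show (2 : ZMod 2) = 0 from rfl, zero_mul, zero_add]

/-- Residue at a prime of degree `d + 1`, correction by `⟨u⟩`, then `inducedHom`: the sum of these
maps over all such primes is the identity on the graded piece, as one checks on the generators.
Hence a class without residues in degree `d + 1` drops to degree `d`. Only this injectivity half of
Milnor's exact sequence is needed. -/
theorem mem_degFiltration_of_residueAt {d : ℕ} {w : WittRing (RatFunc K)}
    (hw : w ∈ degFiltration K (d + 1))
    (hres : ∀ (π : K[X]) [Fact (Irreducible π)], π.Monic → π.natDegree = d + 1 →
      residueAt π w = 0) : w ∈ degFiltration K d := by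
  classical
  let Pl := {π : K[X] // π.Monic ∧ Irreducible π ∧ π.natDegree = d + 1}
  have hfact : ∀ P : Pl, Fact (Irreducible P.1) := fun P => ⟨P.2.2.1⟩
  have hchoice := fun P : Pl => exists_residueAt_dgPoly_mul P.1
  choose u hu0 hu using hchoice
  let T : Pl → WittRing (RatFunc K) →+ WittRing (RatFunc K) ⧸ degFiltration K d := fun P =>
    (inducedHom P.2.1 P.2.2.2).comp ((AddMonoidHom.mulLeft (dg (u P))).comp (residueAt P.1))
  have hT : ∀ P w, residueAt P.1 w = 0 → T P w = 0 := fun P w h => by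
    simp only [T, AddMonoidHom.comp_apply, h, map_zero]
  -- The sum over primes has finite support. It is stated for all finite sets containing a given
  -- one, so that the statement is stable under sums.
  have key : ∀ w ∈ degGenerators K d, ∃ P₀ : Finset Pl, ∀ P, P₀ ⊆ P →
      (QuotientAddGroup.mk w : WittRing (RatFunc K) ⧸ degFiltration K d) = ∑ p ∈ P, T p w := by
    intro w hw
    induction hw using AddSubgroup.closure_induction with
    | mem x hx =>
      rcases hx with ⟨h, hh, rfl⟩ | ⟨π, h, hm, hπ, hd, hh, rfl⟩
      · refine ⟨∅, fun P _ => ?_⟩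
        rw [(QuotientAddGroup.eq_zero_iff _).mpr (dgPoly_mem hh)]
        exact (Finset.sum_eq_zero fun p _ => hT p _ (residueAt_dgPoly_of_not_dvd _
          (hh.not_dvd p.2.2.1 p.2.2.2))).symm
      · let p₀ : Pl := ⟨π, hm, hπ, hd⟩
        refine ⟨{p₀}, fun P hP => ?_⟩
        rw [Finset.sum_eq_single p₀]
        · simp only [T, AddMonoidHom.comp_apply]
          rw [hu p₀ h (hh.not_dvd hπ hd), AddMonoidHom.coe_mulLeft, ← mul_assoc,
            dg_mul_self (hu0 p₀), one_mul]
          exact (inducedHom_mk p₀.2.1 p₀.2.2.2 hh).symm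
        · intro p _ hp
          refine hT p _ (residueAt_dgPoly_of_not_dvd _ fun hdvd => ?_)
          rcases p.2.2.1.prime.dvd_or_dvd hdvd with h1 | h1
          · exact hp (Subtype.ext (eq_of_monic_of_associated p.2.1 hm
              (p.2.2.1.associated_of_dvd hπ h1)))
          · exact hh.not_dvd p.2.2.1 p.2.2.2 h1
        · exact fun h => absurd (hP (Finset.mem_singleton_self p₀)) h
    | zero => exact ⟨∅, fun P _ => by simp⟩
    | add x y _ _ hx hy =>
      obtain ⟨P, hP⟩ := hx
      obtain ⟨Q, hQ⟩ := hy
      refine ⟨P ∪ Q, fun R hR => ?_⟩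
      rw [QuotientAddGroup.mk_add, hP R (Finset.union_subset_left hR),
        hQ R (Finset.union_subset_right hR), ← Finset.sum_add_distrib]
      simp only [map_add]
    | neg x _ hx =>
      obtain ⟨P, hP⟩ := hx
      refine ⟨P, fun R hR => ?_⟩
      rw [QuotientAddGroup.mk_neg, hP R hR, ← Finset.sum_neg_distrib]
      simp only [map_neg]
  obtain ⟨P, hP⟩ := key w (degFiltration_succ_le hw)
  rw [← QuotientAddGroup.eq_zero_iff, hP P subset_rfl]
  exact Finset.sum_eq_zero fun p _ => hT p w (hres p.1 p.2.1 p.2.2.2)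

theorem exists_mem_degFiltration (w : WittRing (RatFunc K)) : ∃ d, w ∈ degFiltration K d := by
  have hmono : ∀ {d e : ℕ}, d ≤ e → degFiltration K d ≤ degFiltration K e := fun hde =>
    AddSubgroup.closure_mono fun _ ⟨f, hf, h⟩ =>
      ⟨f, ⟨hf.1, fun p hp hpf => (hf.2 p hp hpf).trans hde⟩, h⟩
  induction w using WittRing.induction_on with
  | h0 => exact ⟨0, zero_mem _⟩
  | hadd a w ha ih =>
    obtain ⟨d, hd⟩ := ih
    have h1 : dg a = dgPoly (a.num * a.denom) := by
      have hden : algebraMap K[X] (RatFunc K) a.denom ≠ 0 :=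
        (map_ne_zero_iff _ (IsFractionRing.injective K[X] (RatFunc K))).mpr a.denom_ne_zero
      have : algebraMap K[X] (RatFunc K) (a.num * a.denom) =
          a * algebraMap K[X] (RatFunc K) a.denom ^ 2 := by
        conv_rhs => rw [← RatFunc.num_div_denom a]
        rw [map_mul]
        field_simp
        simp
      rw [dgPoly_apply, this, dg_mul_sq _ _ hden]
    refine ⟨max d (a.num * a.denom).natDegree, add_mem ?_ (hmono (le_max_left _ _) hd)⟩
    rw [h1]
    exact dgPoly_mem_of_natDegree_le (le_max_right _ _)

/-- A Witt class over `K(t)` without residues on the affine line comes from `K`. -/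
theorem exists_eq_map_C (w : WittRing (RatFunc K))
    (hres : ∀ (π : K[X]) [Fact (Irreducible π)], π.Monic → residueAt π w = 0) :
    ∃ c : WittRing K, w = WittRing.map RatFunc.C c := by
  obtain ⟨d, hd⟩ := exists_mem_degFiltration w
  have h0 : w ∈ degFiltration K 0 := by
    induction d with
    | zero => exact hd
    | succ d ih => exact ih (mem_degFiltration_of_residueAt hd fun π _ hm _ => hres π hm)
  have hle : degFiltration K 0 ≤ (WittRing.map (RatFunc.C (K := K))).toAddMonoidHom.range := by
    rw [degFiltration, AddSubgroup.closure_le]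
    rintro _ ⟨f, hf, rfl⟩
    have hdeg : f.natDegree = 0 := by
      by_contra hne
      have hu : ¬IsUnit f := fun hu => hne (natDegree_eq_zero_of_isUnit hu)
      obtain ⟨p, hp, hpf⟩ := WfDvdMonoid.exists_irreducible_factor hu hf.1
      have := hf.2 p hp hpf
      exact hp.natDegree_pos.ne' (by omega)
    obtain ⟨a, rfl⟩ := natDegree_eq_zero.mp hdeg
    refine ⟨dg a, ?_⟩
    change WittRing.map RatFunc.C (dg a) = _
    rw [WittRing.map_dg, dgPoly_apply, RatFunc.algebraMap_C]
  obtain ⟨c, hc⟩ := hle h0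
  exact ⟨c, hc.symm⟩

end Milnor

end WittEt
namespace WittEt

/-! ### Extension of scalars for étale algebras along field homomorphisms. -/

section EtaleFunctor

variable {K L M : Type u} [Field K] [Field L] [Field M] {n : ℕ}

namespace EtaleAlg

/-- Extension of scalars along a ring homomorphism. -/
noncomputable def map (f : K →+* L) (A : EtaleAlg K n) : EtaleAlg L n :=
  letI := f.toAlgebra
  A.baseChange L

/-- The canonical map from an étale algebra to its extension of scalars. -/
noncomputable def incl (f : K →+* L) (A : EtaleAlg K n) : A.carrier →+* (A.map f).carrier :=
  letI := f.toAlgebra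
  (Algebra.TensorProduct.includeRight (R := K) (A := L) (B := A.carrier)).toRingHom

theorem incl_algebraMap (f : K →+* L) (A : EtaleAlg K n) (a : K) :
    A.incl f (algebraMap K A.carrier a) = algebraMap L (A.map f).carrier (f a) := by
  let _ := f.toAlgebra
  change (Algebra.TensorProduct.includeRight (R := K) (A := L) (B := A.carrier)) _ =
    algebraMap L (L ⊗[K] A.carrier) (algebraMap K L a)
  rw [AlgHom.commutes, IsScalarTower.algebraMap_apply K L (L ⊗[K] A.carrier)]

theorem span_range_incl (f : K →+* L) (A : EtaleAlg K n) :
    Submodule.span L (Set.range (A.incl f)) = ⊤ := by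
  let _ := f.toAlgebra
  refine eq_top_iff.mpr fun (x : L ⊗[K] A.carrier) _ => ?_
  change x ∈ (Submodule.span L
    (Set.range (Algebra.TensorProduct.includeRight (R := K) (A := L) (B := A.carrier))) :
      Submodule L (L ⊗[K] A.carrier))
  induction x using TensorProduct.induction_on with
  | zero => exact zero_mem _
  | tmul l a =>
    have : l ⊗ₜ[K] a = l • ((1 : L) ⊗ₜ[K] a) := by rw [TensorProduct.smul_tmul', smul_eq_mul, mul_one]
    rw [this]
    exact Submodule.smul_mem _ _ (Submodule.subset_span ⟨a, rfl⟩)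
  | add x y hx hy => exact add_mem (hx trivial) (hy trivial)

end EtaleAlg

/-- A ring homomorphism over `f` exhibits its target as an extension of scalars of its source as soon as its
image spans. -/
structure IsExtension (f : K →+* L) {A B : Type*} [CommRing A] [CommRing B] [Algebra K A]
    [Algebra L B] (φ : A →+* B) : Prop where
  algebraMap_eq : ∀ a, φ (algebraMap K A a) = algebraMap L B (f a)
  span_eq : Submodule.span L (Set.range φ) = ⊤

theorem IsExtension.comp {f : K →+* L} {g : L →+* M} {A B C : Type*} [CommRing A] [CommRing B]
    [CommRing C] [Algebra K A] [Algebra L B] [Algebra M C] {φ : A →+* B} {ψ : B →+* C}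
    (hψ : IsExtension g ψ) (hφ : IsExtension f φ) : IsExtension (g.comp f) (ψ.comp φ) where
  algebraMap_eq a := by
    rw [RingHom.comp_apply, hφ.algebraMap_eq, hψ.algebraMap_eq, RingHom.comp_apply]
  span_eq := by
    rw [eq_top_iff, ← hψ.span_eq, Submodule.span_le]
    rintro _ ⟨b, rfl⟩
    have hb : b ∈ Submodule.span L (Set.range φ) := by rw [hφ.span_eq]; trivial
    induction hb using Submodule.span_induction with
    | mem x hx =>
      obtain ⟨a, rfl⟩ := hx
      exact Submodule.subset_span ⟨a, rfl⟩
    | zero => rw [map_zero]; exact zero_mem _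
    | add x y _ _ hx hy => rw [map_add]; exact add_mem hx hy
    | smul l x _ hx =>
      rw [Algebra.smul_def, map_mul, hψ.algebraMap_eq, ← Algebra.smul_def]
      exact Submodule.smul_mem _ _ hx

theorem EtaleAlg.isExtension_incl (f : K →+* L) (A : EtaleAlg K n) : IsExtension f (A.incl f) :=
  ⟨A.incl_algebraMap f, A.span_range_incl f⟩

/-- The induced map from the tensor product is onto because the image spans, and it is injective
because both sides have rank `n`. Base changes can thus be recognized from a semilinear map with
spanning image. -/
theorem IsExtension.equiv_map {f : K →+* L} {A : EtaleAlg K n} {B : EtaleAlg L n}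
    {φ : A.carrier →+* B.carrier} (h : IsExtension f φ) : A.map f ≈ B := by
  let _ := f.toAlgebra
  let _ : Algebra K B.carrier := ((algebraMap L B.carrier).comp f).toAlgebra
  have : IsScalarTower K L B.carrier := IsScalarTower.of_algebraMap_eq' rfl
  let φ' : A.carrier →ₐ[K] B.carrier := { φ with commutes' := h.algebraMap_eq }
  let Φ : L ⊗[K] A.carrier →ₐ[L] B.carrier :=
    Algebra.TensorProduct.lift (Algebra.ofId L B.carrier) φ' fun _ _ => Commute.all _ _
  have hsurj : Function.Surjective Φ := by
    rw [← AlgHom.range_eq_top, ← top_le_iff]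
    intro b _
    have hb : b ∈ Submodule.span L (Set.range φ) := by rw [h.span_eq]; trivial
    induction hb using Submodule.span_induction with
    | mem x hx =>
      obtain ⟨a, rfl⟩ := hx
      exact ⟨1 ⊗ₜ a, by simp [Φ, φ']⟩
    | zero => exact zero_mem _
    | add x y _ _ hx hy => exact add_mem (hx trivial) (hy trivial)
    | smul l x _ hx => exact Subalgebra.smul_mem _ (hx trivial) l
  have hfr : Module.finrank L (L ⊗[K] A.carrier) = Module.finrank L B.carrier := by
    rw [Module.finrank_baseChange, A.finrank_eq, B.finrank_eq]
  have hinj : Function.Injective Φ :=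
    (LinearMap.injective_iff_surjective_of_finrank_eq_finrank (f := Φ.toLinearMap) hfr).mpr hsurj
  exact ⟨AlgEquiv.ofBijective Φ ⟨hinj, hsurj⟩⟩

namespace Et

/-- Functoriality of `Et` along ring homomorphisms. -/
noncomputable def map (f : K →+* L) : Et K n → Et L n :=
  letI := f.toAlgebra
  Et.baseChange L

theorem map_algebraMap [Algebra K L] (x : Et K n) :
    map (algebraMap K L) x = x.baseChange L := by
  have h : ∀ (i j : Algebra K L), i = j →
      @baseChange K _ L _ i n x = @baseChange K _ L _ j n x := by
    rintro i _ rfl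
    rfl
  exact h _ _ (Algebra.algebra_ext _ _ fun _ => rfl)

theorem mk_eq_mk {A B : EtaleAlg K n} : mk A = mk B ↔ Nonempty (A.carrier ≃ₐ[K] B.carrier) :=
  Quotient.eq

theorem exists_mk (x : Et K n) : ∃ A, x = mk A :=
  let ⟨A, h⟩ := Quotient.exists_rep x
  ⟨A, h.symm⟩

theorem map_mk (f : K →+* L) (A : EtaleAlg K n) : map f (mk A) = mk (A.map f) := rfl

theorem map_mk_eq {f : K →+* L} {A : EtaleAlg K n} {B : EtaleAlg L n}
    {φ : A.carrier →+* B.carrier} (h : IsExtension f φ) : map f (mk A) = mk B :=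
  Quotient.sound h.equiv_map

theorem map_map (f : K →+* L) (g : L →+* M) (x : Et K n) : map g (map f x) = map (g.comp f) x := by
  obtain ⟨A, rfl⟩ := x.exists_mk
  exact (map_mk_eq (((A.map f).isExtension_incl g).comp (A.isExtension_incl f))).symm

theorem map_id (x : Et K n) : map (RingHom.id K) x = x := by
  obtain ⟨A, rfl⟩ := x.exists_mk
  exact map_mk_eq (φ := RingHom.id A.carrier) ⟨fun _ => rfl, by
    rw [RingHom.coe_id, Set.range_id, Submodule.span_univ]⟩

end Et

/-- The product of two étale algebras. -/
def EtaleAlg.prod {m n : ℕ} (A : EtaleAlg K m) (B : EtaleAlg K n) : EtaleAlg K (m + n) where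
  carrier := A.carrier × B.carrier
  etale := etale_prod _ _
  finrank_eq := by rw [Module.finrank_prod, A.finrank_eq, B.finrank_eq]

theorem IsExtension.prodMap {f : K →+* L} {A B A' B' : Type*} [CommRing A] [CommRing B]
    [CommRing A'] [CommRing B'] [Algebra K A] [Algebra L B] [Algebra K A'] [Algebra L B']
    {φ : A →+* B} {ψ : A' →+* B'} (hφ : IsExtension f φ) (hψ : IsExtension f ψ) :
    IsExtension f (φ.prodMap ψ) where
  algebraMap_eq a := Prod.ext (hφ.algebraMap_eq a) (hψ.algebraMap_eq a)
  span_eq := by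
    have h1 : ∀ b : B, (b, (0 : B')) ∈ Submodule.span L (Set.range (φ.prodMap ψ)) := fun b => by
      have hb : b ∈ Submodule.span L (Set.range φ) := by rw [hφ.span_eq]; trivial
      have := Submodule.apply_mem_span_image_of_mem_span (LinearMap.inl L B B') hb
      refine Submodule.span_mono ?_ this
      rintro _ ⟨_, ⟨a, rfl⟩, rfl⟩
      exact ⟨(a, 0), by simp⟩
    have h2 : ∀ b : B', ((0 : B), b) ∈ Submodule.span L (Set.range (φ.prodMap ψ)) := fun b => by
      have hb : b ∈ Submodule.span L (Set.range ψ) := by rw [hψ.span_eq]; trivial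
      have := Submodule.apply_mem_span_image_of_mem_span (LinearMap.inr L B B') hb
      refine Submodule.span_mono ?_ this
      rintro _ ⟨_, ⟨a, rfl⟩, rfl⟩
      exact ⟨(0, a), by simp⟩
    refine eq_top_iff.mpr fun x _ => ?_
    have : x = (x.1, 0) + (0, x.2) := by simp
    rw [this]
    exact add_mem (h1 _) (h2 _)

theorem IsExtension.piMap {f : K →+* L} {J : Type*} [Finite J] {A B : J → Type*}
    [∀ j, CommRing (A j)] [∀ j, CommRing (B j)] [∀ j, Algebra K (A j)] [∀ j, Algebra L (B j)]
    {φ : ∀ j, A j →+* B j} (hφ : ∀ j, IsExtension f (φ j)) :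
    IsExtension f (RingHom.pi fun j => (φ j).comp (Pi.evalRingHom A j)) where
  algebraMap_eq a := funext fun j => (hφ j).algebraMap_eq a
  span_eq := by
    classical
    cases nonempty_fintype J
    refine eq_top_iff.mpr fun x _ => ?_
    rw [← LinearMap.sum_single_apply B x]
    refine sum_mem fun j _ => ?_
    have hb : x j ∈ Submodule.span L (Set.range (φ j)) := by rw [(hφ j).span_eq]; trivial
    have := Submodule.apply_mem_span_image_of_mem_span (LinearMap.single L B j) hb
    refine Submodule.span_mono ?_ this
    rintro _ ⟨_, ⟨a, rfl⟩, rfl⟩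
    refine ⟨Pi.single j a, funext fun i => ?_⟩
    by_cases h : i = j
    · subst h; simp
    · simp [h]

theorem IsExtension.self (f : K →+* L) : IsExtension f f where
  algebraMap_eq _ := rfl
  span_eq := by
    refine eq_top_iff.mpr fun x _ => ?_
    have : x = x • f 1 := by simp
    rw [this]
    exact Submodule.smul_mem _ _ (Submodule.subset_span ⟨1, rfl⟩)

open Polynomial in
theorem IsExtension.adjoinRoot (f : K →+* L) (p : K[X]) :
    IsExtension f (AdjoinRoot.map f p (p.map f) dvd_rfl) where
  algebraMap_eq a := AdjoinRoot.map_of _ _ _ _ _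
  span_eq := by
    refine eq_top_iff.mpr fun x _ => ?_
    obtain ⟨q, rfl⟩ := AdjoinRoot.mk_surjective x
    induction q using Polynomial.induction_on' with
    | add p q hp hq => rw [map_add]; exact add_mem (hp trivial) (hq trivial)
    | monomial i a =>
      have : AdjoinRoot.mk (p.map f) (monomial i a) =
          a • AdjoinRoot.map f p (p.map f) dvd_rfl (AdjoinRoot.root p ^ i) := by
        rw [map_pow, AdjoinRoot.map_root, ← C_mul_X_pow_eq_monomial, map_mul, map_pow,
          AdjoinRoot.mk_X, AdjoinRoot.mk_C, Algebra.smul_def]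
        rfl
      rw [this]
      exact Submodule.smul_mem _ _ (Submodule.subset_span ⟨_, rfl⟩)

namespace Et

/-- The product of isomorphism classes of étale algebras. -/
def prod {m n : ℕ} : Et K m → Et K n → Et K (m + n) :=
  Quotient.map₂ EtaleAlg.prod fun _ _ ⟨e⟩ _ _ ⟨e'⟩ => ⟨AlgEquiv.prodCongr e e'⟩

theorem map_prod (f : K →+* L) {m n : ℕ} (x : Et K m) (y : Et K n) :
    map f (prod x y) = prod (map f x) (map f y) := by
  obtain ⟨A, rfl⟩ := x.exists_mk
  obtain ⟨B, rfl⟩ := y.exists_mk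
  exact map_mk_eq (A := A.prod B) (B := (A.map f).prod (B.map f))
    ((A.isExtension_incl f).prodMap (B.isExtension_incl f))

end Et

namespace EtaleAlg

open Polynomial

/-- The étale algebra defined by a separable polynomial. -/
noncomputable def ofPoly (F : K[X]) (hm : F.Monic) (hs : F.Separable) (hn : F.natDegree = n) :
    EtaleAlg K n where
  carrier := AdjoinRoot F
  etale := by
    obtain ⟨a, b, h⟩ := hs
    -- A standard étale pair in which nothing is inverted: the Bézout identity of separability is
    -- its condition, with `g = 1`.
    let P : StandardEtalePair K :=
      { f := F
        monic_f := hm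
        g := 1
        cond := ⟨b, a, 0, by rw [pow_zero]; linear_combination h⟩ }
    have e := P.equivAwayAdjoinRoot
    have h1 : IsUnit (AdjoinRoot.mk P.f P.g) := by
      change IsUnit (AdjoinRoot.mk F 1)
      rw [map_one]; exact isUnit_one
    have e' : AdjoinRoot F ≃ₐ[AdjoinRoot F] Localization.Away (AdjoinRoot.mk P.f P.g) :=
      IsLocalization.atUnit _ _ _ h1
    exact Algebra.Etale.of_equiv (e.trans (e'.restrictScalars K).symm)
  finrank_eq := by
    rw [(AdjoinRoot.powerBasis hm.ne_zero).finrank, AdjoinRoot.powerBasis_dim, hn]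

end EtaleAlg

open Polynomial in
theorem Et.map_mk_ofPoly (f : K →+* L) (F : K[X]) (hm : F.Monic) (hs : F.Separable)
    (hn : F.natDegree = n) : Et.map f (Et.mk (EtaleAlg.ofPoly F hm hs hn)) =
      Et.mk (EtaleAlg.ofPoly (F.map f) (hm.map f) hs.map (by rw [hm.natDegree_map, hn])) :=
  Et.map_mk_eq (A := EtaleAlg.ofPoly F hm hs hn) (IsExtension.adjoinRoot f F)

open Polynomial in
theorem Et.mk_ofPoly_congr {F G : K[X]} (h : F = G) {hm : F.Monic} {hs : F.Separable}
    {hn : F.natDegree = n} {hm' : G.Monic} {hs' : G.Separable} {hn' : G.natDegree = n} :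
    Et.mk (EtaleAlg.ofPoly F hm hs hn) = Et.mk (EtaleAlg.ofPoly G hm' hs' hn') := by
  subst h; rfl

section Multiquadratic

set_option linter.unusedSectionVars false

variable [NeZero (2 : K)] [NeZero (2 : L)]

theorem isExtension_quadratic (f : K →+* L) (a : Kˣ) : ∃ φ : EtaleAlg.quadraticCarrier a →+*
    EtaleAlg.quadraticCarrier (Units.map (f : K →* L) a), IsExtension f φ := by
  have h : (Polynomial.X ^ 2 - Polynomial.C (a : K)).map f =
      Polynomial.X ^ 2 - Polynomial.C ((Units.map (f : K →* L) a : Lˣ) : L) := by simp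
  unfold EtaleAlg.quadraticCarrier
  rw [← h]
  exact ⟨_, IsExtension.adjoinRoot f _⟩

theorem Et.map_mk_quadratic (f : K →+* L) (a : Kˣ) : Et.map f (Et.mk (EtaleAlg.quadratic a)) =
    Et.mk (EtaleAlg.quadratic (Units.map (f : K →* L) a)) := by
  obtain ⟨φ, hφ⟩ := isExtension_quadratic f a
  exact Et.map_mk_eq (A := EtaleAlg.quadratic a) hφ

theorem Et.map_mk_multiquadratic (f : K →+* L) (a : Fin (n / 2) → Kˣ) :
    Et.map f (Et.mk (EtaleAlg.multiquadratic n a)) =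
      Et.mk (EtaleAlg.multiquadratic n fun j => Units.map (f : K →* L) (a j)) := by
  choose φ hφ using isExtension_quadratic (K := K) (L := L) f
  exact Et.map_mk_eq (A := EtaleAlg.multiquadratic n a)
    ((IsExtension.piMap fun j => hφ (a j)).prodMap (IsExtension.piMap fun _ => IsExtension.self f))

end Multiquadratic

end EtaleFunctor

end WittEt
namespace WittEt

open Polynomial

/-! ### Adic completeness of finite free modules. -/

section AdicComplete

variable {R M : Type*} [CommRing R] [AddCommGroup M] [Module R M]

theorem mem_ideal_smul_top_iff {ι : Type*} [Finite ι] (b : Module.Basis ι R M) (I : Ideal R)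
    (x : M) : x ∈ (I • ⊤ : Submodule R M) ↔ ∀ i, b.repr x i ∈ I := by
  cases nonempty_fintype ι
  constructor
  · intro hx i
    induction hx using Submodule.smul_induction_on' with
    | smul r hr m _ =>
      rw [map_smul, Finsupp.smul_apply, smul_eq_mul]
      exact I.mul_mem_right _ hr
    | add x _ y _ hx hy => rw [map_add, Finsupp.add_apply]; exact add_mem hx hy
  · intro h
    rw [← b.sum_repr x]
    exact sum_mem fun i _ => Submodule.smul_mem_smul (h i) trivial

theorem isAdicComplete_of_basis {ι : Type*} [Finite ι] (b : Module.Basis ι R M) (I : Ideal R)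
    [IsAdicComplete I R] : IsAdicComplete I M := by
  have key : ∀ (n : ℕ) (x y : M), x ≡ y [SMOD (I ^ n • ⊤ : Submodule R M)] ↔
      ∀ i, b.repr x i ≡ b.repr y i [SMOD (I ^ n • ⊤ : Submodule R R)] := fun n x y => by
    rw [SModEq.sub_mem, mem_ideal_smul_top_iff b]
    refine forall_congr' fun i => ?_
    rw [SModEq.sub_mem, smul_eq_mul, Ideal.mul_top, map_sub, Finsupp.sub_apply]
  have h1 : IsHausdorff I M := ⟨fun x hx => by
    refine b.repr.map_eq_zero_iff.mp (Finsupp.ext fun i => ?_)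
    refine IsHausdorff.haus (I := I) (M := R) inferInstance _ fun n => ?_
    simpa using (key n x 0).mp (hx n) i⟩
  have h2 : IsPrecomplete I M := ⟨fun f hf => by
    have := fun i => IsPrecomplete.prec (I := I) (M := R) inferInstance
      (f := fun n => b.repr (f n) i) (fun {m n} hmn => (key m _ _).mp (hf hmn) i)
    choose l hl using this
    refine ⟨b.repr.symm (Finsupp.equivFunOnFinite.symm l), fun n => (key n _ _).mpr fun i => ?_⟩
    simpa using hl i n⟩
  exact { }

end AdicComplete

/-! ### Algebras over a complete local ring with a coefficient field. -/

section Hensel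

/-- A complete principal local ring with a residue field `κ` that it contains, inside a field `Λ`. -/
structure CompleteModel (R κ Λ : Type u) [CommRing R] [Field κ] [Field Λ] where
  residue : R →+* κ
  section' : κ →+* R
  residue_section' : ∀ a, residue (section' a) = a
  uniformizer : R
  residue_uniformizer : residue uniformizer = 0
  uniformizer_dvd : ∀ r, residue r = 0 → uniformizer ∣ r
  isAdicComplete : IsAdicComplete (Ideal.span {uniformizer}) R
  generic : R →+* Λ
  generic_injective : Function.Injective generic

/-- The ring of formal power series in the field of Laurent series. -/
noncomputable def powerSeriesModel (κ : Type u) [Field κ] :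
    CompleteModel (PowerSeries κ) κ (LaurentSeries κ) where
  residue := PowerSeries.constantCoeff
  section' := PowerSeries.C
  residue_section' a := PowerSeries.constantCoeff_C a
  uniformizer := PowerSeries.X
  residue_uniformizer := PowerSeries.constantCoeff_X
  uniformizer_dvd _ h := PowerSeries.X_dvd_iff.mpr h
  isAdicComplete := inferInstance
  generic := HahnSeries.ofPowerSeries ℤ κ
  generic_injective := HahnSeries.ofPowerSeries_injective

namespace CompleteModel

variable {R κ Λ : Type u} [CommRing R] [Field κ] [Field Λ] (D : CompleteModel R κ Λ) {F : R[X]}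

/-- The reduction of the algebra defined by a polynomial over the ring of formal power series. -/
noncomputable def reduction (F : R[X]) :
    AdjoinRoot F →+* AdjoinRoot (F.map D.residue) :=
  AdjoinRoot.map D.residue F _ dvd_rfl

theorem reduction_mk (p : R[X]) :
    D.reduction F (AdjoinRoot.mk F p) = AdjoinRoot.mk _ (p.map D.residue) := by
  induction p using Polynomial.induction_on' with
  | add p q hp hq => simp only [map_add, hp, hq, Polynomial.map_add]
  | monomial n a =>
    rw [← C_mul_X_pow_eq_monomial, map_mul, map_mul, map_pow, map_pow, AdjoinRoot.mk_X,
      AdjoinRoot.mk_C, reduction, AdjoinRoot.map_root, AdjoinRoot.map_of, Polynomial.map_mul,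
      Polynomial.map_pow, map_C, map_X, map_mul, map_pow, AdjoinRoot.mk_X, AdjoinRoot.mk_C]

theorem map_map_section' (p : κ[X]) : (p.map (D.section')).map
    D.residue = p := by
  have : D.residue.comp D.section' = RingHom.id κ := RingHom.ext D.residue_section'
  rw [Polynomial.map_map, this, Polynomial.map_id]

/-- The ideal generated by the uniformizer. -/
noncomputable def uniformizerIdeal (F : R[X]) : Ideal (AdjoinRoot F) :=
  (Ideal.span {(D.uniformizer)}).map (algebraMap (R) (AdjoinRoot F))

theorem reduction_eq_zero_iff {b : AdjoinRoot F} : D.reduction F b = 0 ↔ b ∈ D.uniformizerIdeal F := by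
  constructor
  · intro h
    obtain ⟨p, rfl⟩ := AdjoinRoot.mk_surjective b
    rw [D.reduction_mk, AdjoinRoot.mk_eq_zero] at h
    obtain ⟨q, hq⟩ := h
    have h0 : (p - F * q.map D.section').map D.residue = 0 := by
      rw [Polynomial.map_sub, Polynomial.map_mul, D.map_map_section', hq, sub_self]
    have hd : C (D.uniformizer) ∣ p - F * q.map D.section' := by
      rw [C_dvd_iff_dvd_coeff]
      intro i
      refine D.uniformizer_dvd _ ?_
      rw [← coeff_map, h0, coeff_zero]
    obtain ⟨r, hr⟩ := hd
    have : AdjoinRoot.mk F p = AdjoinRoot.mk F (p - F * q.map D.section') := by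
      rw [map_sub, map_mul, AdjoinRoot.mk_self, zero_mul, sub_zero]
    rw [this, hr, map_mul, AdjoinRoot.mk_C]
    exact Ideal.mul_mem_right _ _ (Ideal.mem_map_of_mem _ (Ideal.mem_span_singleton_self _))
  · intro h
    have hle : D.uniformizerIdeal F ≤ RingHom.ker (D.reduction F) := by
      rw [uniformizerIdeal, Ideal.map_le_iff_le_comap, Ideal.span_le]
      rintro _ rfl
      change D.reduction F (AdjoinRoot.of F D.uniformizer) = 0
      rw [reduction, AdjoinRoot.map_of, D.residue_uniformizer, map_zero]
    exact hle h

theorem isAdicComplete_uniformizerIdeal (hm : F.Monic) :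
    IsAdicComplete (D.uniformizerIdeal F) (AdjoinRoot F) := by
  have := D.isAdicComplete
  have := isAdicComplete_of_basis (AdjoinRoot.powerBasisAux' hm)
    (Ideal.span {(D.uniformizer)})
  have h1 := (IsHausdorff.map_algebraMap_iff (S := AdjoinRoot F) (M := AdjoinRoot F)
    (I := Ideal.span {(D.uniformizer)})).mpr inferInstance
  have h2 := (IsPrecomplete.map_algebraMap_iff (S := AdjoinRoot F) (M := AdjoinRoot F)
    (I := Ideal.span {(D.uniformizer)})).mpr inferInstance
  exact { toIsHausdorff := h1, toIsPrecomplete := h2 }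

theorem isUnit_quotient_mk_of_reduction {b : AdjoinRoot F} (h : IsUnit (D.reduction F b)) :
    IsUnit (Ideal.Quotient.mk (D.uniformizerIdeal F) b) := by
  obtain ⟨c, hc⟩ := isUnit_iff_exists_inv.mp h
  obtain ⟨q, rfl⟩ := AdjoinRoot.mk_surjective c
  refine isUnit_iff_exists_inv.mpr
    ⟨Ideal.Quotient.mk _ (AdjoinRoot.mk F (q.map D.section')), ?_⟩
  rw [← map_mul, ← map_one (Ideal.Quotient.mk _), Ideal.Quotient.eq, ← D.reduction_eq_zero_iff,
    map_sub, map_mul, map_one, D.reduction_mk, D.map_map_section', hc, sub_self]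

theorem isUnit_of_reduction (hm : F.Monic) {b : AdjoinRoot F} (h : IsUnit (D.reduction F b)) :
    IsUnit b := by
  have := D.isAdicComplete_uniformizerIdeal hm
  have := isLocalHom_of_le_jacobson_bot (D.uniformizerIdeal F) (IsAdicComplete.le_jacobson_bot _)
  exact (isUnit_map_iff (Ideal.Quotient.mk (D.uniformizerIdeal F)) b).mp
    (D.isUnit_quotient_mk_of_reduction h)

/-- Hensel's lemma in `R[X]/F`, which is finite free over `R` and hence complete for the ideal
generated by the uniformizer. -/
theorem exists_root_of_reduction (hm : F.Monic) {f : (AdjoinRoot F)[X]} (hf : f.Monic)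
    {b : AdjoinRoot F} (h0 : D.reduction F (f.eval b) = 0)
    (h1 : IsUnit (D.reduction F (f.derivative.eval b))) :
    ∃ a, f.eval a = 0 ∧ D.reduction F a = D.reduction F b := by
  have := D.isAdicComplete_uniformizerIdeal hm
  obtain ⟨a, ha, hab⟩ := HenselianRing.is_henselian (I := D.uniformizerIdeal F) f hf b
    (D.reduction_eq_zero_iff.mp h0) (D.isUnit_quotient_mk_of_reduction h1)
  refine ⟨a, ha, ?_⟩
  rw [← sub_eq_zero, ← map_sub]
  exact D.reduction_eq_zero_iff.mpr hab

/-- The generic fibre of a polynomial over the ring of formal power series. -/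
noncomputable abbrev genericFibre (F : R[X]) : (Λ)[X] :=
  F.map D.generic

/-- Separability says that the derivative is a unit modulo `F`, and units of `R[X]/F` are detected
on the reduction. -/
theorem separable_of_reduction (hm : F.Monic)
    (hs : (F.map D.residue).Separable) : F.Separable := by
  have h : IsUnit (AdjoinRoot.mk F F.derivative) := by
    refine D.isUnit_of_reduction hm ?_
    rw [D.reduction_mk, ← derivative_map]
    obtain ⟨a, b, hab⟩ := hs
    refine isUnit_iff_exists_inv.mpr ⟨AdjoinRoot.mk _ b, ?_⟩
    rw [← map_mul, ← sub_eq_zero, ← map_one (AdjoinRoot.mk _), ← map_sub, AdjoinRoot.mk_eq_zero]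
    exact ⟨-a, by linear_combination hab⟩
  obtain ⟨c, hc⟩ := isUnit_iff_exists_inv.mp h
  obtain ⟨q, rfl⟩ := AdjoinRoot.mk_surjective c
  rw [← map_mul, ← sub_eq_zero, ← map_one (AdjoinRoot.mk _), ← map_sub, AdjoinRoot.mk_eq_zero] at hc
  obtain ⟨r, hr⟩ := hc
  exact ⟨-r, q, by linear_combination hr⟩

/-- The algebra defined by a polynomial over the ring of formal power series inside its generic fibre. -/
noncomputable def toGeneric (F : R[X]) : AdjoinRoot F →+* AdjoinRoot (D.genericFibre F) :=
  AdjoinRoot.map D.generic F _ dvd_rfl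

theorem toGeneric_mk (p : R[X]) :
    D.toGeneric F (AdjoinRoot.mk F p) = AdjoinRoot.mk _ (p.map D.generic) := by
  induction p using Polynomial.induction_on' with
  | add p q hp hq => simp only [map_add, hp, hq, Polynomial.map_add]
  | monomial n a =>
    rw [← C_mul_X_pow_eq_monomial, map_mul, map_mul, map_pow, map_pow, AdjoinRoot.mk_X,
      AdjoinRoot.mk_C, toGeneric, AdjoinRoot.map_root, AdjoinRoot.map_of, Polynomial.map_mul,
      Polynomial.map_pow, map_C, map_X, map_mul, map_pow, AdjoinRoot.mk_X, AdjoinRoot.mk_C]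

theorem toGeneric_injective (hm : F.Monic) : Function.Injective (D.toGeneric F) := by
  rw [injective_iff_map_eq_zero]
  intro b hb
  obtain ⟨p, rfl⟩ := AdjoinRoot.mk_surjective b
  rw [D.toGeneric_mk, AdjoinRoot.mk_eq_zero, map_dvd_map _ D.generic_injective hm] at hb
  rwa [AdjoinRoot.mk_eq_zero]

/-- A factorization of the reduction into coprime factors lifts to an idempotent of the generic fibre. -/
theorem not_isDomain_genericFibre (hm : F.Monic) {g h : κ[X]} (hg : ¬IsUnit g) (hh : ¬IsUnit h)
    (hc : IsCoprime g h) (hF : F.map D.residue = g * h) :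
    ¬IsDomain (AdjoinRoot (D.genericFibre F)) := by
  intro hdom
  obtain ⟨a, b, hab⟩ := hc
  have hF0 : AdjoinRoot.mk (F.map D.residue) (a * g * (b * h)) = 0 := by
    rw [AdjoinRoot.mk_eq_zero, hF]
    exact ⟨a * b, by ring⟩
  set e := AdjoinRoot.mk F ((a * g).map D.section') with he
  have hre : D.reduction F e = AdjoinRoot.mk _ (a * g) := by
    rw [he, D.reduction_mk, D.map_map_section']
  have hre' : 1 - D.reduction F e = AdjoinRoot.mk _ (b * h) := by
    rw [hre, ← map_one (AdjoinRoot.mk _), ← map_sub, ← hab, add_sub_cancel_left]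
  have hmul : D.reduction F e * (1 - D.reduction F e) = 0 := by rw [hre', hre, ← map_mul, hF0]
  -- Since `a * g + b * h = 1` and `g * h` vanishes in the reduction, `a * g` is idempotent there.
  -- It is lifted as a root of `X ^ 2 - X`, whose derivative `2e - 1` has square one at an
  -- idempotent.
  obtain ⟨ε, hε, hεe⟩ := D.exists_root_of_reduction hm (f := X ^ 2 - X) (b := e)
    (by monicity!) (by
      simp only [eval_sub, eval_pow, eval_X, map_sub, map_pow]
      linear_combination -hmul) (by
      simp only [derivative_X_pow, derivative_X, eval_sub, eval_mul, eval_pow,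
        eval_X, eval_one, map_sub, map_mul, map_pow, map_one, Nat.cast_ofNat, eval_C]
      refine isUnit_iff_exists_inv.mpr ⟨2 * D.reduction F e - 1, ?_⟩
      rw [map_ofNat]
      simp only [Nat.add_one_sub_one, pow_one]
      linear_combination -4 * hmul)
  simp only [eval_sub, eval_pow, eval_X] at hε
  have hε' : D.toGeneric F ε * (D.toGeneric F ε - 1) = 0 := by
    rw [← map_one (D.toGeneric F), ← map_sub, ← map_mul, ← map_zero (D.toGeneric F)]
    congr 1
    linear_combination hε
  -- In a domain `ε` is `0` or `1`. Then `g * h` divides `a * g` or `b * h`, so `h` divides `a` or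
  -- `g` divides `b`, and `a * g + b * h = 1` makes that factor a unit.
  rcases mul_eq_zero.mp hε' with h0 | h1
  · have : ε = 0 := D.toGeneric_injective hm (by rw [h0, map_zero])
    rw [this, map_zero, hre, eq_comm, AdjoinRoot.mk_eq_zero, hF] at hεe
    have hg0 : g ≠ 0 := by
      rintro rfl
      have := (hm.map D.residue).ne_zero
      rw [hF, zero_mul] at this
      exact this rfl
    rw [mul_comm a g] at hεe
    obtain ⟨q, hq⟩ := (mul_dvd_mul_iff_left hg0).mp hεe
    exact hh (IsUnit.of_mul_eq_one (q * g + b) (by rw [← hab, hq]; ring))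
  · have h1' : ε = 1 := D.toGeneric_injective hm (by rw [map_one]; exact sub_eq_zero.mp h1)
    rw [h1', map_one, ← sub_eq_zero, hre', AdjoinRoot.mk_eq_zero, hF] at hεe
    have hh0 : h ≠ 0 := by
      rintro rfl
      have := (hm.map D.residue).ne_zero
      rw [hF, mul_zero] at this
      exact this rfl
    obtain ⟨q, hq⟩ := (mul_dvd_mul_iff_right hh0).mp hεe
    exact hg (IsUnit.of_mul_eq_one (a + q * h) (by rw [← hab, hq]; ring))

/-- A monic polynomial with separable reduction defines an unramified extension. -/
theorem exists_isExtension_genericFibre (hm : F.Monic)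
    (hs : (F.map D.residue).Separable) :
    ∃ φ : AdjoinRoot (F.map D.residue) →+* AdjoinRoot (D.genericFibre F),
      IsExtension (D.generic.comp D.section') φ := by
  set F₀ := F.map D.residue with hF₀
  have hm₀ : F₀.Monic := hm.map _
  let i : κ →+* AdjoinRoot F := (AdjoinRoot.of F).comp D.section'
  have hired : ∀ p : κ[X], (p.eval₂ i (AdjoinRoot.root F)) = AdjoinRoot.mk F (p.map D.section') := by
    intro p
    rw [← AdjoinRoot.eval₂_root_eq_mk, eval₂_map]
  have hri : (D.reduction F).comp i = AdjoinRoot.of F₀ := by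
    ext a
    simp [i, reduction, D.residue_section']
    rfl
  -- The class of `X` is a simple root of the reduced polynomial modulo the uniformizer. Lifting it
  -- to a true root gives a ring section of the reduction map.
  obtain ⟨ξ, hξ, hξr⟩ := D.exists_root_of_reduction hm (f := F₀.map i) (b := AdjoinRoot.root F)
    (hm₀.map i) (by
      rw [eval_map, hired, D.reduction_mk, D.map_map_section', AdjoinRoot.mk_self]) (by
      rw [derivative_map, eval_map, hired, D.reduction_mk, D.map_map_section']
      obtain ⟨a, b, hab⟩ := hs
      refine isUnit_iff_exists_inv.mpr ⟨AdjoinRoot.mk _ b, ?_⟩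
      rw [← map_mul, ← sub_eq_zero, ← map_one (AdjoinRoot.mk _), ← map_sub, AdjoinRoot.mk_eq_zero]
      exact ⟨-a, by linear_combination hab⟩)
  rw [eval_map] at hξ
  let ψ : AdjoinRoot F₀ →+* AdjoinRoot F := AdjoinRoot.lift i ξ hξ
  have hψr : ∀ x, D.reduction F (ψ x) = x := by
    intro x
    obtain ⟨p, rfl⟩ := AdjoinRoot.mk_surjective x
    simp only [ψ, AdjoinRoot.lift_mk]
    rw [hom_eval₂, hri, hξr]
    simp only [reduction, AdjoinRoot.map_root]
    exact AdjoinRoot.eval₂_root_eq_mk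
  -- Nakayama: the section meets every class modulo the uniformizer.
  have hspan : Submodule.span (R) (Set.range ψ) = ⊤ := by
    have := D.isAdicComplete
    have hfin : Module.Finite (R) (AdjoinRoot F) := hm.finite_adjoinRoot
    refine top_le_iff.mp (Submodule.le_of_le_smul_of_le_jacobson_bot
      (I := Ideal.span {(D.uniformizer)}) hfin.fg_top
      (IsAdicComplete.le_jacobson_bot _) fun b _ => ?_)
    have : b = ψ (D.reduction F b) + (b - ψ (D.reduction F b)) := by ring
    rw [this]
    refine Submodule.add_mem_sup (Submodule.subset_span ⟨_, rfl⟩) ?_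
    have h0 : b - ψ (D.reduction F b) ∈ D.uniformizerIdeal F := by
      rw [← D.reduction_eq_zero_iff, map_sub, hψr, sub_self]
    rw [Ideal.smul_top_eq_map]
    exact h0
  refine ⟨(D.toGeneric F).comp ψ, ⟨fun a => ?_, ?_⟩⟩
  · change D.toGeneric F (ψ (AdjoinRoot.of F₀ a)) = _
    simp only [ψ, AdjoinRoot.lift_of, i, RingHom.comp_apply, toGeneric, AdjoinRoot.map_of]
    rfl
  · have h1 : ∀ b, D.toGeneric F b ∈ Submodule.span (Λ)
        (Set.range ((D.toGeneric F).comp ψ)) := by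
      intro b
      have hb : b ∈ Submodule.span (R) (Set.range ψ) := by rw [hspan]; trivial
      induction hb using Submodule.span_induction with
      | mem x hx =>
        obtain ⟨a, rfl⟩ := hx
        exact Submodule.subset_span ⟨a, rfl⟩
      | zero => rw [map_zero]; exact zero_mem _
      | add x y _ _ hx hy => rw [map_add]; exact add_mem hx hy
      | smul l x _ hx =>
        have : D.toGeneric F (l • x) = D.generic l • D.toGeneric F x := by
          rw [Algebra.smul_def, Algebra.smul_def, map_mul]
          congr 1
          exact AdjoinRoot.map_of _ _ _ _ _
        rw [this]
        exact Submodule.smul_mem _ _ hx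
    refine eq_top_iff.mpr fun x _ => ?_
    obtain ⟨p, rfl⟩ := AdjoinRoot.mk_surjective x
    induction p using Polynomial.induction_on' with
    | add p q hp hq => rw [map_add]; exact add_mem (hp trivial) (hq trivial)
    | monomial n a =>
      have : AdjoinRoot.mk (D.genericFibre F) (monomial n a) =
          a • D.toGeneric F (AdjoinRoot.root F ^ n) := by
        rw [map_pow, toGeneric, AdjoinRoot.map_root, ← C_mul_X_pow_eq_monomial, map_mul, map_pow,
          AdjoinRoot.mk_X, AdjoinRoot.mk_C, Algebra.smul_def]
        rfl
      rw [this]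
      exact Submodule.smul_mem _ _ (h1 _)

end CompleteModel

end Hensel

/-! ### Pencils of polynomials and their expansion at a member. -/

section Pencil

variable {R S : Type*} [CommRing R] [CommRing S] {K : Type*} [Field K]

/-- The member `f - t g` of the pencil of polynomials spanned by `f` and `g`. -/
noncomputable def pencil (f g : K[X]) (i : K →+* R) (t : R) : R[X] := f.map i - C t * g.map i

theorem pencil_map (f g : K[X]) (i : K →+* R) (t : R) (j : R →+* S) :
    (pencil f g i t).map j = pencil f g (j.comp i) (j t) := by
  simp [pencil, Polynomial.map_map]

theorem pencil_degree_lt {f g : K[X]} (hfg : g.natDegree < f.natDegree)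
    (i : K →+* R) (t : R) : (C t * g.map i).degree < f.natDegree :=
  degree_le_natDegree.trans_lt (by
    exact_mod_cast ((natDegree_C_mul_le _ _).trans natDegree_map_le).trans_lt hfg)

theorem pencil_monic {f g : K[X]} (hf : f.Monic) (hfg : g.natDegree < f.natDegree) (i : K →+* R)
    (t : R) : (pencil f g i t).Monic := by
  nontriviality R
  refine (hf.map i).sub_of_left ?_
  rw [degree_map_eq_of_leadingCoeff_ne_zero i (by rw [hf.leadingCoeff, map_one]; exact one_ne_zero),
    degree_eq_natDegree hf.ne_zero]
  exact pencil_degree_lt hfg i t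

theorem pencil_natDegree [Nontrivial R] {f g : K[X]} (hf : f.Monic)
    (hfg : g.natDegree < f.natDegree) (i : K →+* R) (t : R) :
    (pencil f g i t).natDegree = f.natDegree := by
  have h := hf.natDegree_map i
  rw [← h, pencil]
  refine natDegree_sub_eq_left_of_natDegree_lt ?_
  rw [h]
  exact (natDegree_C_mul_le _ _).trans_lt (natDegree_map_le.trans_lt hfg)

end Pencil

section PencilSpecialization

variable {K κ : Type u} [Field K] [Field κ] {n : ℕ} {f g : K[X]} (i : K →+* κ) (θ : κ)

/-- The expansion of a pencil at a point, over the ring of formal power series. -/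
noncomputable def pencilAt (f g : K[X]) (i : K →+* κ) (θ : κ) : (PowerSeries κ)[X] :=
  pencil f g ((PowerSeries.C (R := κ)).comp i) (PowerSeries.C θ + PowerSeries.X)

theorem pencilAt_residue :
    (pencilAt f g i θ).map (powerSeriesModel κ).residue = pencil f g i θ := by
  have h : (powerSeriesModel κ).residue.comp ((PowerSeries.C (R := κ)).comp i) = i :=
    RingHom.ext fun a => (powerSeriesModel κ).residue_section' (i a)
  have h' : (powerSeriesModel κ).residue (PowerSeries.C θ + PowerSeries.X) = θ := by
    rw [map_add]
    exact (congrArg₂ (· + ·) ((powerSeriesModel κ).residue_section' θ)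
      (powerSeriesModel κ).residue_uniformizer).trans (add_zero θ)
  rw [pencilAt, pencil_map, h, h']

theorem pencilAt_generic : (powerSeriesModel κ).genericFibre (pencilAt f g i θ) =
    pencil f g ((laurentC κ).comp i) (laurentC κ θ + HahnSeries.single 1 1) := by
  have h : (powerSeriesModel κ).generic.comp ((PowerSeries.C (R := κ)).comp i) =
      (laurentC κ).comp i :=
    RingHom.ext fun a => HahnSeries.ofPowerSeries_C (i a)
  have h' : (powerSeriesModel κ).generic (PowerSeries.C θ + PowerSeries.X) =
      laurentC κ θ + HahnSeries.single 1 1 := by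
    rw [map_add]
    exact congrArg₂ (· + ·) (HahnSeries.ofPowerSeries_C θ) HahnSeries.ofPowerSeries_X
  rw [CompleteModel.genericFibre, pencilAt, pencil_map, h, h']

theorem pencil_separable_of_residue (hf : f.Monic) (hfg : g.natDegree < f.natDegree)
    (hs : (pencil f g i θ).Separable) :
    (pencil f g ((laurentC κ).comp i) (laurentC κ θ + HahnSeries.single 1 1)).Separable := by
  rw [← pencilAt_generic]
  refine Polynomial.Separable.map ((powerSeriesModel κ).separable_of_reduction
    (pencil_monic hf hfg _ _) ?_)
  have := pencilAt_residue (f := f) (g := g) i θ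
  rw [pencilAt] at this
  rwa [this]

/-- Near a separable member the family is unramified, and over a complete base an unramified algebra
is determined by its reduction. So the pencil at `θ + s` is the constant extension of its member at
`θ`. -/
theorem Et.map_laurentC_pencil (hf : f.Monic) (hfg : g.natDegree < f.natDegree)
    (hn : f.natDegree = n) (hs : (pencil f g i θ).Separable) :
    Et.map (laurentC κ) (Et.mk (EtaleAlg.ofPoly (pencil f g i θ) (pencil_monic hf hfg _ _) hs
      ((pencil_natDegree hf hfg _ _).trans hn))) =
    Et.mk (EtaleAlg.ofPoly _ (pencil_monic hf hfg _ _) (pencil_separable_of_residue i θ hf hfg hs)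
      ((pencil_natDegree hf hfg _ _).trans hn)) := by
  have hs' := hs
  rw [← pencilAt_residue] at hs'
  have hm := pencil_monic hf hfg ((PowerSeries.C (R := κ)).comp i)
    (PowerSeries.C θ + PowerSeries.X)
  obtain ⟨φ, hφ⟩ := (powerSeriesModel κ).exists_isExtension_genericFibre hm hs'
  have hC : (powerSeriesModel κ).generic.comp (powerSeriesModel κ).section' = laurentC κ :=
    RingHom.ext fun a => HahnSeries.ofPowerSeries_C a
  rw [hC] at hφ
  have h0 := Et.mk_ofPoly_congr (n := n) (pencilAt_residue (f := f) (g := g) i θ)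
    (hm := hm.map _) (hs := hs') (hn := by
      rw [pencilAt_residue]; exact (pencil_natDegree hf hfg _ _).trans hn)
    (hm' := pencil_monic hf hfg _ _) (hs' := hs) (hn' := (pencil_natDegree hf hfg _ _).trans hn)
  have hsg := pencil_separable_of_residue i θ hf hfg hs
  have hsg' := hsg
  rw [← pencilAt_generic] at hsg'
  have h1 := Et.mk_ofPoly_congr (n := n) (pencilAt_generic (f := f) (g := g) i θ)
    (hm := hm.map _) (hs := hsg') (hn := by
      rw [pencilAt_generic]; exact (pencil_natDegree hf hfg _ _).trans hn)
    (hm' := pencil_monic hf hfg _ _) (hs' := hsg) (hn' := (pencil_natDegree hf hfg _ _).trans hn)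
  rw [← h0, ← h1]
  exact Et.map_mk_eq (A := EtaleAlg.ofPoly _ _ _ _) (B := EtaleAlg.ofPoly _ _ _ _) hφ

theorem not_isDomain_pencil (hf : f.Monic) (hfg : g.natDegree < f.natDegree) {a b : κ[X]}
    (ha : ¬IsUnit a) (hb : ¬IsUnit b) (hc : IsCoprime a b) (h : pencil f g i θ = a * b) :
    ¬IsDomain (AdjoinRoot
      (pencil f g ((laurentC κ).comp i) (laurentC κ θ + HahnSeries.single 1 1))) := by
  rw [← pencilAt_generic]
  exact (powerSeriesModel κ).not_isDomain_genericFibre (pencil_monic hf hfg _ _) ha hb hc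
    ((pencilAt_residue i θ).trans h)

end PencilSpecialization

end WittEt
namespace WittEt

open Polynomial

/-! ### Étale algebras as products of separable field extensions. -/

section EtaleStructure

variable {K : Type u} [Field K] {n : ℕ}

/-- The class of a product of two étale algebras of positive rank. -/
def Et.IsProd (x : Et K n) : Prop :=
  ∃ (m₁ m₂ : ℕ) (h : m₁ + m₂ = n) (x₁ : Et K m₁) (x₂ : Et K m₂),
    0 < m₁ ∧ 0 < m₂ ∧ x = h ▸ Et.prod x₁ x₂

theorem Et.isProd_of_equiv {A : EtaleAlg K n} {B C : Type u} [CommRing B] [CommRing C] [Algebra K B]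
    [Algebra K C] [Algebra.Etale K B] [Algebra.Etale K C] [Nontrivial B] [Nontrivial C]
    (e : A.carrier ≃ₐ[K] B × C) : (mk A).IsProd := by
  have : Module.Finite K B := Algebra.FormallyUnramified.finite_of_free K B
  have : Module.Finite K C := Algebra.FormallyUnramified.finite_of_free K C
  have hn : Module.finrank K B + Module.finrank K C = n := by
    rw [← A.finrank_eq, e.toLinearEquiv.finrank_eq, Module.finrank_prod]
  subst hn
  exact ⟨_, _, rfl, mk ⟨B, rfl⟩, mk ⟨C, rfl⟩, Module.finrank_pos, Module.finrank_pos,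
    mk_eq_mk.mpr ⟨e⟩⟩

theorem Et.eq_ofPoly_of_equiv {A : EtaleAlg K n} {E : Type u} [Field E] [Algebra K E]
    [Module.Finite K E] [Algebra.IsSeparable K E] (e : A.carrier ≃ₐ[K] E) :
    ∃ (f : K[X]) (_ : Irreducible f) (hm : f.Monic) (hs : f.Separable) (hn : f.natDegree = n),
      mk A = mk (EtaleAlg.ofPoly f hm hs hn) := by
  let pb := Field.powerBasisOfFiniteOfSeparable K E
  have hint : IsIntegral K pb.gen := pb.isIntegral_gen
  have hirr := minpoly.irreducible hint
  have hn : (minpoly K pb.gen).natDegree = n := by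
    rw [pb.natDegree_minpoly, ← pb.finrank, ← A.finrank_eq, e.toLinearEquiv.finrank_eq]
  refine ⟨minpoly K pb.gen, hirr, minpoly.monic hint, Algebra.IsSeparable.isSeparable K pb.gen, hn,
    mk_eq_mk.mpr ⟨e.trans ?_⟩⟩
  have : Fact (Irreducible (minpoly K pb.gen)) := ⟨hirr⟩
  let φ : AdjoinRoot (minpoly K pb.gen) →ₐ[K] E :=
    AdjoinRoot.liftAlgHom _ (Algebra.ofId K E) pb.gen (minpoly.aeval K pb.gen)
  have hfin : Module.Finite K (AdjoinRoot (minpoly K pb.gen)) :=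
    (minpoly.monic hint).finite_adjoinRoot
  have hfr : Module.finrank K (AdjoinRoot (minpoly K pb.gen)) = Module.finrank K E := by
    rw [(AdjoinRoot.powerBasis hirr.ne_zero).finrank, AdjoinRoot.powerBasis_dim, hn, ← A.finrank_eq,
      e.toLinearEquiv.finrank_eq]
  have hinj : Function.Injective φ := φ.toRingHom.injective
  exact (AlgEquiv.ofBijective φ ⟨hinj,
    (LinearMap.injective_iff_surjective_of_finrank_eq_finrank (f := φ.toLinearMap) hfr).mp hinj⟩).symm

theorem etale_of_isSeparable (E : Type u) [Field E] [Algebra K E] [Module.Finite K E]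
    [Algebra.IsSeparable K E] : Algebra.Etale K E :=
  { formallyEtale := (Algebra.FormallyEtale.iff_isSeparable K E).mpr inferInstance
    finitePresentation := Algebra.FinitePresentation.of_finiteType.mp inferInstance }

/-- An étale algebra is zero, is defined by an irreducible polynomial, or is a product. -/
theorem EtaleAlg.cases (A : EtaleAlg K n) : n = 0 ∨
    (IsDomain A.carrier ∧ ∃ (f : K[X]) (_ : Irreducible f) (hm : f.Monic) (hs : f.Separable)
      (hn : f.natDegree = n), Et.mk A = Et.mk (EtaleAlg.ofPoly f hm hs hn)) ∨ (Et.mk A).IsProd := by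
  classical
  obtain ⟨I, _, E, hE, hA, e, h⟩ := (Algebra.Etale.iff_exists_algEquiv_prod (K := K)
    (A := A.carrier)).mp inferInstance
  have := fun i => (h i).1
  have := fun i => (h i).2
  rcases isEmpty_or_nonempty I with hI | ⟨⟨i₀⟩⟩
  · left
    have : Subsingleton A.carrier := e.toEquiv.subsingleton
    rw [← A.finrank_eq, Module.finrank_zero_of_subsingleton]
  right
  by_cases hu : ∀ i, i = i₀
  · left
    let _ : Unique I := ⟨⟨i₀⟩, hu⟩
    let e' : A.carrier ≃ₐ[K] E i₀ := e.trans
      (AlgEquiv.ofBijective (Pi.evalAlgHom K E i₀) ⟨fun x y hxy => funext fun i => by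
        obtain rfl := hu i
        exact hxy, fun y => ⟨Pi.single i₀ y, by simp⟩⟩)
    exact ⟨e'.injective.isDomain e'.toRingEquiv.toRingHom, Et.eq_ofPoly_of_equiv e'⟩
  · right
    push Not at hu
    obtain ⟨i₁, hi₁⟩ := hu
    let φ : (∀ i, E i) →ₐ[K] E i₀ × ∀ j : {j // j ≠ i₀}, E j :=
      (Pi.evalAlgHom K E i₀).prod (AlgHom.pi fun j : {j // j ≠ i₀} => Pi.evalAlgHom K E j)
    have hφ : Function.Bijective φ := (Equiv.piSplitAt i₀ E).bijective
    have hne : Nonempty {j // j ≠ i₀} := ⟨⟨i₁, hi₁⟩⟩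
    have h1 : Algebra.Etale K (E i₀) :=
      etale_of_isSeparable (E i₀)
    have h2 : ∀ j, Algebra.Etale K (E j) := fun j =>
      etale_of_isSeparable (E j)
    have h3 : Nontrivial (∀ j : {j // j ≠ i₀}, E j) := Function.Surjective.nontrivial
      (f := fun x : (∀ j : {j // j ≠ i₀}, E j) => x ⟨i₁, hi₁⟩)
      (Function.surjective_eval _)
    exact Et.isProd_of_equiv (e.trans (AlgEquiv.ofBijective φ hφ))

end EtaleStructure

/-! ### Quadratic and multiquadratic algebras. -/

section Multiquadratic

variable {K : Type u} [Field K] [NeZero (2 : K)] {n : ℕ}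

/-- The class of a multiquadratic algebra. -/
def Et.IsMultiquadratic (x : Et K n) : Prop := ∃ a, x = mk (EtaleAlg.multiquadratic n a)

/-- Take a nonzero `y` of trace zero. By Cayley–Hamilton its square is the scalar `-det`, which is
nonzero because the algebra is reduced, and `y` is not a scalar because the characteristic is not
two. -/
theorem exists_equiv_quadraticCarrier (A : EtaleAlg K 2) :
    ∃ d : Kˣ, Nonempty (A.carrier ≃ₐ[K] EtaleAlg.quadraticCarrier d) := by
  classical
  let b := Module.finBasisOfFinrankEq K A.carrier A.finrank_eq
  have hnt : Nontrivial A.carrier := Module.nontrivial_of_finrank_pos (R := K) (by rw [A.finrank_eq]; norm_num)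
  have : IsReduced A.carrier := Algebra.FormallyUnramified.isReduced_of_field K A.carrier
  have h2 : (2 : K) ≠ 0 := NeZero.ne 2
  obtain ⟨y, hy0, hy⟩ : ∃ y : A.carrier, y ≠ 0 ∧ Algebra.trace K A.carrier y = 0 := by
    have : (LinearMap.ker (Algebra.trace K A.carrier)) ≠ ⊥ := by
      intro h
      have h1 := LinearMap.finrank_le_finrank_of_injective (LinearMap.ker_eq_bot.mp h)
      rw [A.finrank_eq, Module.finrank_self] at h1
      omega
    obtain ⟨y, hy, hy0⟩ := Submodule.exists_mem_ne_zero_of_ne_bot this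
    exact ⟨y, hy0, hy⟩
  set M := Algebra.leftMulMatrix b y with hM
  have hch := Matrix.aeval_self_charpoly M
  have hy2 : y ^ 2 = algebraMap K A.carrier (-M.det) := by
    refine Algebra.leftMulMatrix_injective b ?_
    rw [Matrix.charpoly_fin_two, hM, ← Algebra.trace_eq_matrix_trace, hy] at hch
    simp only [map_zero, zero_mul, sub_zero, map_add, map_pow, aeval_X, aeval_C] at hch
    rw [map_pow, AlgHom.commutes, map_neg]
    exact eq_neg_of_add_eq_zero_left hch
  have hd : -M.det ≠ 0 := fun h0 => by
    rw [h0, map_zero] at hy2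
    exact hy0 (pow_eq_zero_iff two_ne_zero |>.mp hy2)
  have hyK : ∀ c : K, y ≠ algebraMap K A.carrier c := by
    rintro c rfl
    rw [Algebra.trace_algebraMap, A.finrank_eq, nsmul_eq_mul, Nat.cast_ofNat] at hy
    rw [(mul_eq_zero.mp hy).resolve_left h2, map_zero] at hy0
    exact hy0 rfl
  set d : Kˣ := Units.mk0 _ hd with hdd
  let φ : EtaleAlg.quadraticCarrier d →ₐ[K] A.carrier :=
    AdjoinRoot.liftAlgHom _ (Algebra.ofId K A.carrier) y (by
      simp only [eval₂_sub, eval₂_pow, eval₂_X, eval₂_C, hy2]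
      exact sub_self _)
  have hinj : Function.Injective φ := by
    rw [injective_iff_map_eq_zero]
    intro x hx
    obtain ⟨p, rfl⟩ := AdjoinRoot.mk_surjective x
    have hmon := EtaleAlg.monic_quadratic d
    have hp : AdjoinRoot.mk (X ^ 2 - C (d : K)) p =
        AdjoinRoot.mk (X ^ 2 - C (d : K)) (p %ₘ (X ^ 2 - C (d : K))) := by
      rw [← sub_eq_zero, ← map_sub, AdjoinRoot.mk_eq_zero]
      exact ⟨p /ₘ (X ^ 2 - C (d : K)), by
        rw [sub_eq_iff_eq_add, add_comm, modByMonic_add_div p]⟩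
    have hdeg : (p %ₘ (X ^ 2 - C (d : K))).natDegree ≤ 1 := by
      have := natDegree_modByMonic_lt p hmon (by
        intro h
        have := natDegree_X_pow_sub_C (n := 2) (r := (d : K))
        rw [h, natDegree_one] at this
        omega)
      rw [natDegree_X_pow_sub_C] at this
      omega
    rw [hp] at hx ⊢
    rw [eq_X_add_C_of_natDegree_le_one hdeg] at hx ⊢
    generalize (p %ₘ (X ^ 2 - C (d : K))).coeff 1 = v at hx ⊢
    generalize (p %ₘ (X ^ 2 - C (d : K))).coeff 0 = w at hx ⊢
    have hx' : algebraMap K A.carrier v * y + algebraMap K A.carrier w = 0 := by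
      have : φ (AdjoinRoot.mk _ (C v * X + C w)) =
          algebraMap K A.carrier v * y + algebraMap K A.carrier w := by
        simp [φ, Algebra.ofId_apply]
      rw [← this]; exact hx
    have hv : v = 0 := by
      by_contra hv
      refine hyK (-(w / v)) ?_
      have hvu : IsUnit (algebraMap K A.carrier v) := (IsUnit.mk0 v hv).map _
      refine hvu.mul_left_cancel ?_
      rw [← map_mul, mul_neg, mul_div_cancel₀ _ hv, map_neg]
      exact eq_neg_of_add_eq_zero_left hx'
    rw [hv, map_zero, zero_mul, zero_add] at hx'
    have hw : w = 0 := by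
      rwa [map_eq_zero_iff _ (algebraMap K A.carrier).injective] at hx'
    rw [hv, hw, C_0, zero_mul, zero_add, map_zero]
  have hfr : Module.finrank K (EtaleAlg.quadraticCarrier d) = Module.finrank K A.carrier := by
    rw [EtaleAlg.finrank_quadratic, A.finrank_eq]
  exact ⟨d, ⟨(AlgEquiv.ofBijective φ ⟨hinj,
    (LinearMap.injective_iff_surjective_of_finrank_eq_finrank (f := φ.toLinearMap)
      hfr).mp hinj⟩).symm⟩⟩

theorem Et.exists_eq_quadratic (x : Et K 2) : ∃ d, x = mk (EtaleAlg.quadratic d) := by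
  obtain ⟨A, rfl⟩ := x.exists_mk
  obtain ⟨d, ⟨e⟩⟩ := exists_equiv_quadraticCarrier A
  exact ⟨d, mk_eq_mk.mpr ⟨e⟩⟩

/-- The algebra `K × K` is quadratic. -/
theorem exists_prod_equiv_quadraticCarrier :
    ∃ d : Kˣ, Nonempty ((K × K) ≃ₐ[K] EtaleAlg.quadraticCarrier d) := by
  have : Algebra.Etale K (K × K) := EtaleAlg.etale_prod K K
  exact exists_equiv_quadraticCarrier ⟨K × K, by simp⟩

/-- A function on `Option J` is its value at `none` and its restriction to `J`. -/
def piOptionAlgEquiv {J : Type*} (E : Option J → Type*) [∀ j, CommRing (E j)]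
    [∀ j, Algebra K (E j)] : (∀ j, E j) ≃ₐ[K] E none × ∀ j, E (some j) where
  toFun x := (x none, fun j => x (some j))
  invFun x j := match j with
    | none => x.1
    | some j => x.2 j
  left_inv x := by
    funext j
    cases j <;> rfl
  right_inv _ := rfl
  map_mul' _ _ := rfl
  map_add' _ _ := rfl
  commutes' _ := rfl

/-- A function on a sum is a pair of functions. -/
def piSumAlgEquiv {I J : Type*} (E : I ⊕ J → Type*) [∀ j, CommRing (E j)]
    [∀ j, Algebra K (E j)] : (∀ j, E j) ≃ₐ[K] (∀ i, E (.inl i)) × ∀ j, E (.inr j) where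
  toFun x := (fun i => x (.inl i), fun j => x (.inr j))
  invFun x j := match j with
    | .inl j => x.1 j
    | .inr j => x.2 j
  left_inv x := by
    funext j
    cases j <;> rfl
  right_inv _ := rfl
  map_mul' _ _ := rfl
  map_add' _ _ := rfl
  commutes' _ := rfl

/-- Commutativity of the product of algebras. -/
def prodCommAlgEquiv (A B : Type*) [CommRing A] [CommRing B] [Algebra K A] [Algebra K B] :
    (A × B) ≃ₐ[K] B × A where
  toFun x := (x.2, x.1)
  invFun x := (x.2, x.1)
  left_inv _ := rfl
  right_inv _ := rfl
  map_mul' _ _ := rfl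
  map_add' _ _ := rfl
  commutes' _ := rfl

/-- Associativity of the product of algebras. -/
def prodAssocAlgEquiv (A B C : Type*) [CommRing A] [CommRing B] [CommRing C]
    [Algebra K A] [Algebra K B] [Algebra K C] : ((A × B) × C) ≃ₐ[K] A × (B × C) where
  toFun x := (x.1.1, (x.1.2, x.2))
  invFun x := ((x.1, x.2.1), x.2.2)
  left_inv _ := rfl
  right_inv _ := rfl
  map_mul' _ _ := rfl
  map_add' _ _ := rfl
  commutes' _ := rfl

/-- Rearrangement of a product of four algebras. -/
def prodProdProdAlgEquiv (A B C D : Type*) [CommRing A] [CommRing B] [CommRing C] [CommRing D]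
    [Algebra K A] [Algebra K B] [Algebra K C] [Algebra K D] :
    ((A × B) × (C × D)) ≃ₐ[K] (A × C) × (B × D) where
  toFun x := ((x.1.1, x.2.1), (x.1.2, x.2.2))
  invFun x := ((x.1.1, x.2.1), (x.1.2, x.2.2))
  left_inv _ := rfl
  right_inv _ := rfl
  map_mul' _ _ := rfl
  map_add' _ _ := rfl
  commutes' _ := rfl

/-- The normal form has at most one factor `K`. As long as two copies of `K` remain, they are merged
into one quadratic algebra. -/
theorem Et.isMultiquadratic_of_equiv (q : ℕ) : ∀ {J I : Type} [Fintype J] [Fintype I]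
    (_ : Fintype.card I = q) (a : J → Kˣ) (A : EtaleAlg K n)
    (_ : A.carrier ≃ₐ[K] (∀ j, EtaleAlg.quadraticCarrier (a j)) × (I → K)),
    (mk A).IsMultiquadratic := by
  induction q using Nat.strong_induction_on with
  | _ q ih =>
    intro J I _ _ hq a A e
    have hn : 2 * Fintype.card J + q = n := by
      rw [← A.finrank_eq, e.toLinearEquiv.finrank_eq, Module.finrank_prod,
        Module.finrank_pi_fintype, Module.finrank_fintype_fun_eq_card, hq]
      simp only [EtaleAlg.finrank_quadratic, Finset.sum_const, Finset.card_univ, smul_eq_mul]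
      omega
    by_cases h2 : 2 ≤ q
    · obtain ⟨d, ⟨ed⟩⟩ := exists_prod_equiv_quadraticCarrier (K := K)
      let σ : I ≃ Option (Option (Fin (q - 2))) :=
        Fintype.equivOfCardEq (by simp [hq]; omega)
      let e1 : (I → K) ≃ₐ[K] (K × K) × (Fin (q - 2) → K) :=
        (AlgEquiv.piCongrLeft K (fun _ => K) σ).trans <|
          (piOptionAlgEquiv fun _ : Option (Option (Fin (q - 2))) => K).trans <|
            (AlgEquiv.prodCongr AlgEquiv.refl (piOptionAlgEquiv fun _ => K)).trans
              (prodAssocAlgEquiv K K _).symm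
      let a' : Option J → Kˣ := fun j => j.elim d a
      let e2 : (∀ j, EtaleAlg.quadraticCarrier (a' j)) ≃ₐ[K]
          EtaleAlg.quadraticCarrier d × ∀ j, EtaleAlg.quadraticCarrier (a j) :=
        piOptionAlgEquiv fun j => EtaleAlg.quadraticCarrier (a' j)
      refine ih (q - 2) (by omega) (Fintype.card_fin _) a' A (e.trans ?_)
      refine (AlgEquiv.prodCongr AlgEquiv.refl (e1.trans (AlgEquiv.prodCongr ed AlgEquiv.refl))).trans
        ((prodAssocAlgEquiv _ _ _).symm.trans (AlgEquiv.prodCongr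
          ((prodCommAlgEquiv _ _).trans e2.symm) AlgEquiv.refl))
    · let σ : Fin (n / 2) ≃ J := Fintype.equivOfCardEq (by rw [Fintype.card_fin]; omega)
      let τ : Fin (n - 2 * (n / 2)) ≃ I :=
        Fintype.equivOfCardEq (by rw [Fintype.card_fin]; omega)
      exact ⟨fun j => a (σ j), mk_eq_mk.mpr ⟨e.trans (AlgEquiv.prodCongr
        (AlgEquiv.piCongrLeft K (fun j => EtaleAlg.quadraticCarrier (a j)) σ).symm
        (AlgEquiv.piCongrLeft K (fun _ => K) τ).symm)⟩⟩

theorem Et.IsMultiquadratic.prod {m₁ m₂ : ℕ} {x : Et K m₁} {y : Et K m₂}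
    (hx : x.IsMultiquadratic) (hy : y.IsMultiquadratic) : (Et.prod x y).IsMultiquadratic := by
  obtain ⟨a, rfl⟩ := hx
  obtain ⟨b, rfl⟩ := hy
  refine Et.isMultiquadratic_of_equiv _ rfl (Sum.elim a b)
    ((EtaleAlg.multiquadratic m₁ a).prod (EtaleAlg.multiquadratic m₂ b))
    ((prodProdProdAlgEquiv _ _ _ _).trans (AlgEquiv.prodCongr
      (piSumAlgEquiv fun j => EtaleAlg.quadraticCarrier (Sum.elim a b j)).symm
      (piSumAlgEquiv fun _ : Fin (m₁ - 2 * (m₁ / 2)) ⊕ Fin (m₂ - 2 * (m₂ / 2)) => K).symm))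

theorem Et.isMultiquadratic_of_le_two (hn : n ≤ 2) (x : Et K n) : x.IsMultiquadratic := by
  obtain ⟨A, rfl⟩ := x.exists_mk
  have hA := A.finrank_eq
  interval_cases n
  · have h1 : Subsingleton A.carrier := Module.finrank_zero_iff.mp hA
    refine Et.isMultiquadratic_of_equiv 0 (J := Fin 0) (I := Fin 0) rfl Fin.elim0 A ?_
    exact { toFun := 0, invFun := 0, left_inv := fun _ => Subsingleton.elim _ _,
            right_inv := fun _ => Subsingleton.elim _ _, map_mul' := fun _ _ => Subsingleton.elim _ _,
            map_add' := fun _ _ => Subsingleton.elim _ _, commutes' := fun _ => Subsingleton.elim _ _ }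
  · have hnt : Nontrivial A.carrier := Module.nontrivial_of_finrank_pos (R := K) (by omega)
    let φ : K →ₐ[K] A.carrier := Algebra.ofId K A.carrier
    have hinj : Function.Injective φ := (algebraMap K A.carrier).injective
    let e : K ≃ₐ[K] A.carrier := AlgEquiv.ofBijective φ ⟨hinj,
      (LinearMap.injective_iff_surjective_of_finrank_eq_finrank (f := φ.toLinearMap)
        (by rw [Module.finrank_self, hA])).mp hinj⟩
    let e' : K ≃ₐ[K] (∀ j : Fin 0, EtaleAlg.quadraticCarrier (Fin.elim0 j : Kˣ)) × (Fin 1 → K) :=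
      { toFun := fun x => (fun j => Fin.elim0 j, fun _ => x)
        invFun := fun x => x.2 0
        left_inv := fun _ => rfl
        right_inv := fun x => Prod.ext (Subsingleton.elim _ _) (funext fun i => by
          rw [Subsingleton.elim i 0])
        map_mul' := fun _ _ => Prod.ext (Subsingleton.elim _ _) rfl
        map_add' := fun _ _ => Prod.ext (Subsingleton.elim _ _) rfl
        commutes' := fun _ => Prod.ext (Subsingleton.elim _ _) rfl }
    exact Et.isMultiquadratic_of_equiv 1 rfl _ A (e.symm.trans e')
  · obtain ⟨d, ⟨e⟩⟩ := exists_equiv_quadraticCarrier A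
    let e' : EtaleAlg.quadraticCarrier d ≃ₐ[K]
        (∀ _ : Fin 1, EtaleAlg.quadraticCarrier d) × (Fin 0 → K) :=
      { toFun := fun x => (fun _ => x, fun j => Fin.elim0 j)
        invFun := fun x => x.1 0
        left_inv := fun _ => rfl
        right_inv := fun x => Prod.ext (funext fun i => by rw [Subsingleton.elim i 0])
          (Subsingleton.elim _ _)
        map_mul' := fun _ _ => Prod.ext rfl (Subsingleton.elim _ _)
        map_add' := fun _ _ => Prod.ext rfl (Subsingleton.elim _ _)
        commutes' := fun _ => Prod.ext rfl (Subsingleton.elim _ _) }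
    exact Et.isMultiquadratic_of_equiv 0 rfl (fun _ : Fin 1 => d) A (e.trans e')

end Multiquadratic

end WittEt
-- Functors on fields and their Witt invariants.
namespace WittEt

/-- A functor on the category of fields of characteristic different from two. -/
structure FieldFunctor where
  obj : ∀ (K : Type u) [Field K] [NeZero (2 : K)], Type (u + 1)
  map : ∀ {K L : Type u} [Field K] [NeZero (2 : K)] [Field L] [NeZero (2 : L)] (_ : K →+* L),
    obj K → obj L
  map_map : ∀ {K L M : Type u} [Field K] [NeZero (2 : K)] [Field L] [NeZero (2 : L)] [Field M]
    [NeZero (2 : M)] (f : K →+* L) (g : L →+* M) (x : obj K), map g (map f x) = map (g.comp f) x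
  map_id : ∀ {K : Type u} [Field K] [NeZero (2 : K)] (x : obj K), map (RingHom.id K) x = x

namespace FieldFunctor

/-- Étale algebras of rank `n`. -/
noncomputable abbrev et (n : ℕ) : FieldFunctor.{u} where
  obj K _ _ := Et K n
  map f := Et.map f
  map_map f g x := Et.map_map f g x
  map_id x := Et.map_id x

/-- The product of two functors. -/
abbrev prod (F G : FieldFunctor.{u}) : FieldFunctor.{u} where
  obj K _ _ := F.obj K × G.obj K
  map f x := (F.map f x.1, G.map f x.2)
  map_map f g x := Prod.ext (F.map_map f g x.1) (G.map_map f g x.2)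
  map_id x := Prod.ext (F.map_id x.1) (G.map_id x.2)

/-- The product of a family of functors. -/
abbrev pi {ι : Type} (F : ι → FieldFunctor.{u}) : FieldFunctor.{u} where
  obj K _ _ := ∀ j, (F j).obj K
  map f x j := (F j).map f (x j)
  map_map f g x := funext fun j => (F j).map_map f g (x j)
  map_id x := funext fun j => (F j).map_id (x j)

/-- A natural transformation. -/
structure Hom (F G : FieldFunctor.{u}) where
  app : ∀ {K : Type u} [Field K] [NeZero (2 : K)], F.obj K → G.obj K
  natural : ∀ {K L : Type u} [Field K] [NeZero (2 : K)] [Field L] [NeZero (2 : L)] (f : K →+* L)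
    (x : F.obj K), G.map f (app x) = app (F.map f x)

end FieldFunctor

/-- A Witt invariant of a functor over the field `k`. -/
structure Inv (k : Type u) [Field k] (F : FieldFunctor.{u}) where
  toFun : ∀ {K : Type u} [Field K] [NeZero (2 : K)] (_ : k →+* K), F.obj K → WittRing K
  natural : ∀ {K L : Type u} [Field K] [NeZero (2 : K)] [Field L] [NeZero (2 : L)] (i : k →+* K)
    (f : K →+* L) (x : F.obj K), WittRing.map f (toFun i x) = toFun (f.comp i) (F.map f x)

namespace Inv

variable {k K L : Type u} [Field k] [Field K] [Field L] [NeZero (2 : K)]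
  {F G : FieldFunctor.{u}}

/-- Restriction of an invariant to a field extension. -/
def restrict (α : Inv k F) (j : k →+* K) : Inv K F where
  toFun i x := α.toFun (i.comp j) x
  natural i f x := α.natural (i.comp j) f x

/-- Pullback of an invariant along a natural transformation. -/
def pullback (α : Inv k G) (s : F.Hom G) : Inv k F where
  toFun i x := α.toFun i (s.app x)
  natural i f x := by rw [α.natural, s.natural]

/-- The invariant of the first variable obtained by fixing the second variable. -/
def fixSnd (α : Inv k (F.prod G)) (i : k →+* K) (y : G.obj K) : Inv K F where
  toFun j x := α.toFun (j.comp i) (x, G.map j y)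
  natural j f x := by
    rw [α.natural]
    exact congrArg _ (Prod.ext rfl (G.map_map _ _ _))

/-- The invariant of the second variable obtained by fixing the first variable. -/
def fixFst (α : Inv k (F.prod G)) (i : k →+* K) (x : F.obj K) : Inv K G where
  toFun j y := α.toFun (j.comp i) (F.map j x, y)
  natural j f y := by
    rw [α.natural]
    exact congrArg _ (Prod.ext (F.map_map _ _ _) rfl)

end Inv

namespace FieldFunctor

/-- The product of étale algebras. -/
noncomputable def etProd (m n : ℕ) : ((et m).prod (et n)).Hom (et.{u} (m + n)) where
  app x := Et.prod x.1 x.2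
  natural f x := Et.map_prod f x.1 x.2

end FieldFunctor

/-! ### A pencil without inseparable members or proper powers. -/

section Polynomials

open Polynomial

variable {K : Type u} [Field K]

/-- A monic polynomial that is neither irreducible nor a proper power is a product of coprime factors. -/
theorem exists_isCoprime_mul_eq {P : K[X]} (hm : P.Monic) (hu : ¬IsUnit P) (hirr : ¬Irreducible P)
    (hpow : ∀ (h : K[X]) (e : ℕ), h.Monic → 2 ≤ e → P ≠ h ^ e) :
    ∃ a b : K[X], ¬IsUnit a ∧ ¬IsUnit b ∧ IsCoprime a b ∧ P = a * b := by
  obtain ⟨q, hqm, hq, hqP⟩ := exists_monic_irreducible_factor P hu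
  have hfin := finiteMultiplicity_of_degree_pos_of_monic
    (Polynomial.degree_pos_of_irreducible hq) hqm hm.ne_zero
  obtain ⟨r, hr, hqr⟩ := hfin.exists_eq_pow_mul_and_not_dvd
  set e := multiplicity q P
  have he : e ≠ 0 := by
    intro h0
    rw [h0, pow_zero, one_mul] at hr
    exact hqr (hr ▸ hqP)
  refine ⟨q ^ e, r, ?_, ?_, (hq.coprime_iff_not_dvd.mpr hqr).pow_left, hr⟩
  · rw [isUnit_pow_iff he]; exact hq.not_isUnit
  · intro hru
    have hrm : r.Monic := (hqm.pow e).of_mul_monic_left (hr ▸ hm)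
    rw [hrm.isUnit_iff.mp hru, mul_one] at hr
    rcases Nat.lt_or_ge e 2 with h | h
    · have : e = 1 := by omega
      rw [this, pow_one] at hr
      exact hirr (hr ▸ hq)
    · exact hpow q e hqm h hr

/-- Distinct monic polynomials with the same power have powers far apart. -/
theorem eq_of_natDegree_pow_sub_pow_le_one {h₁ h₂ : K[X]} {e n : ℕ} (hm₁ : h₁.Monic) (hm₂ : h₂.Monic)
    (hd₁ : (h₁ ^ e).natDegree = n) (hd₂ : (h₂ ^ e).natDegree = n) (he : 2 ≤ e) (heK : (e : K) ≠ 0)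
    (hn : 3 ≤ n) (hd : (h₁ ^ e - h₂ ^ e).natDegree ≤ 1) : h₁ = h₂ := by
  by_contra hne
  rw [hm₁.natDegree_pow] at hd₁
  rw [hm₂.natDegree_pow] at hd₂
  have hdeg : h₁.natDegree = h₂.natDegree :=
    Nat.eq_of_mul_eq_mul_left (by omega : 0 < e) (hd₁.trans hd₂.symm)
  set d := h₁.natDegree with hdd
  -- `S` is the cofactor of `h₁ - h₂` in the difference of powers. Its coefficient in degree `d * (e
  -- - 1)` is `e`, which is nonzero in `K`, so that degree is at most `1`. This leaves `d = 0`, or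
  -- `d = 1` and `e = 2`, both with `n ≤ 2`.
  set S := ∑ i ∈ Finset.range e, h₁ ^ i * h₂ ^ (e - 1 - i) with hS
  have hfac : (h₁ - h₂) * S = h₁ ^ e - h₂ ^ e := (Commute.all h₁ h₂).mul_geom_sum₂ e
  have hcoeff : S.coeff (d * (e - 1)) = e := by
    rw [hS, finsetSum_coeff]
    have : ∀ i ∈ Finset.range e, (h₁ ^ i * h₂ ^ (e - 1 - i)).coeff (d * (e - 1)) = 1 := by
      intro i hi
      have hi' : i < e := Finset.mem_range.mp hi
      have hmon : (h₁ ^ i * h₂ ^ (e - 1 - i)).Monic := (hm₁.pow i).mul (hm₂.pow _)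
      have hnd : (h₁ ^ i * h₂ ^ (e - 1 - i)).natDegree = d * (e - 1) := by
        rw [(hm₁.pow i).natDegree_mul (hm₂.pow _), hm₁.natDegree_pow, hm₂.natDegree_pow, ← hdeg,
          ← add_mul, mul_comm]
        congr 1
        omega
      rw [← hnd]; exact hmon.coeff_natDegree
    rw [Finset.sum_congr rfl this]
    simp
  have hSd : d * (e - 1) ≤ S.natDegree := le_natDegree_of_ne_zero (by rw [hcoeff]; exact heK)
  have hS0 : S ≠ 0 := by
    intro h0
    rw [h0, coeff_zero] at hcoeff
    exact heK hcoeff.symm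
  have h1 : S.natDegree ≤ 1 := by
    refine le_trans ?_ hd
    rw [← hfac, natDegree_mul (sub_ne_zero.mpr hne) hS0]
    exact Nat.le_add_left _ _
  have h2 : d * (e - 1) ≤ 1 := hSd.trans h1
  obtain ⟨e', rfl⟩ : ∃ e', e = e' + 2 := ⟨e - 2, by omega⟩
  have h3 : d * (e' + 1) ≤ 1 := h2
  have h4 : d ≤ 1 := by nlinarith
  have h5 : (e' + 2) * d = n := hd₁
  interval_cases d
  · omega
  · omega

/-- A separable polynomial is a member of a pencil none of whose members is a proper power or has zero
derivative. -/
theorem exists_pencil [Infinite K] {f : K[X]} (hf : f.Monic) (hs : f.Separable)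
    (hn : 3 ≤ f.natDegree) : ∃ g : K[X], g ≠ 0 ∧ g.natDegree < f.natDegree ∧
      ∀ {L : Type u} [Field L] [Algebra K L] [Algebra.IsAlgebraic K L] (θ : L),
        derivative (pencil f g (algebraMap K L) θ) ≠ 0 ∧
          ∀ (h : L[X]) (e : ℕ), h.Monic → 2 ≤ e → pencil f g (algebraMap K L) θ ≠ h ^ e := by
  let Kbar := AlgebraicClosure K
  suffices ∃ g : K[X], g ≠ 0 ∧ g.natDegree < f.natDegree ∧ ∀ θ : Kbar,
      derivative (pencil f g (algebraMap K Kbar) θ) ≠ 0 ∧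
        ∀ (h : Kbar[X]) (e : ℕ), h.Monic → 2 ≤ e → pencil f g (algebraMap K Kbar) θ ≠ h ^ e by
    obtain ⟨g, hg0, hg, h⟩ := this
    refine ⟨g, hg0, hg, fun {L} _ _ _ θ => ?_⟩
    let j : L →ₐ[K] Kbar := IsAlgClosed.lift
    have hj : (pencil f g (algebraMap K L) θ).map (j : L →+* Kbar) = pencil f g (algebraMap K Kbar) (j θ) := by
        rw [pencil_map, j.comp_algebraMap]; rfl
    refine ⟨fun h0 => (h (j θ)).1 ?_, fun p e hp he h0 => (h (j θ)).2 (p.map j) e (hp.map _) he ?_⟩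
    · rw [← hj, derivative_map, h0, Polynomial.map_zero]
    · rw [← hj, h0, Polynomial.map_pow]
  have hsep : f.derivative ≠ 0 := fun h0 => by
    rw [Separable, h0, isCoprime_zero_right] at hs
    rw [natDegree_eq_zero_of_isUnit hs] at hn
    omega
  -- If the derivative of `f` is a nonzero constant, then `g = 1` works: every member has that
  -- derivative, whereas `h` divides the derivative of `h ^ e` for `e ≥ 2`.
  by_cases hc : f.derivative.natDegree = 0
  · obtain ⟨c, hc⟩ := natDegree_eq_zero.mp hc
    have hc0 : c ≠ 0 := by rintro rfl; rw [C_0] at hc; exact hsep hc.symm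
    have hder : ∀ θ : Kbar, derivative (pencil f 1 (algebraMap K Kbar) θ) = C (algebraMap K Kbar c) := fun θ => by
      simp [pencil, derivative_map, ← hc]
    have hcKbar : algebraMap K Kbar c ≠ 0 := (_root_.map_ne_zero _).mpr hc0
    refine ⟨1, one_ne_zero, by rw [natDegree_one]; omega, fun θ => ⟨?_, fun h e hm he heq => ?_⟩⟩
    · rw [hder]; exact C_ne_zero.mpr hcKbar
    · have hd := hder θ
      obtain ⟨e, rfl⟩ : ∃ e', e = e' + 2 := ⟨e - 2, by omega⟩
      rw [heq, derivative_pow] at hd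
      have hdvd : h ∣ C (algebraMap K Kbar c) := by
        rw [← hd]
        exact Dvd.dvd.mul_right (Dvd.dvd.mul_left (dvd_pow_self _ (by omega)) _) _
      have hu : IsUnit h := isUnit_of_dvd_unit hdvd (isUnit_C.mpr hcKbar.isUnit)
      have hh : h = 1 := hm.isUnit_iff.mp hu
      have hnd := pencil_natDegree hf (g := 1) (by rw [natDegree_one]; omega) (algebraMap K Kbar) θ
      rw [heq, hh, one_pow, natDegree_one] at hnd
      omega
  · have hlt : ∀ c : K, (X - C c).natDegree < f.natDegree := fun c => by
      rw [natDegree_X_sub_C]; omega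
    -- Otherwise `g = X - c`. Each exponent `e` excludes at most one `c`. First, `e` is nonzero in
    -- the field, since otherwise the derivative of `f` would be the constant `θ`. Two powers in the
    -- two pencils differ by a linear polynomial, so they coincide; this gives the same `θ`, and the
    -- same `c` unless `θ = 0`, which separability of `f` forbids. As `K` is infinite, some `c` is
    -- good for all exponents up to the degree.
    let bad : Fin (f.natDegree + 1) → K → Prop := fun e c => ∃ (θ : Kbar) (h : Kbar[X]), h.Monic ∧
      2 ≤ (e : ℕ) ∧ pencil f (X - C c) (algebraMap K Kbar) θ = h ^ (e : ℕ)
    have hbad : ∀ e c₁ c₂, bad e c₁ → bad e c₂ → c₁ = c₂ := by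
      rintro e c₁ c₂ ⟨θ₁, h₁, hm₁, he, hp₁⟩ ⟨θ₂, h₂, hm₂, -, hp₂⟩
      have heKbar : ((e : ℕ) : Kbar) ≠ 0 := by
        intro h0
        have hd := congrArg derivative hp₁
        rw [derivative_pow, h0, C_0, zero_mul, zero_mul] at hd
        simp only [pencil, derivative_sub, derivative_mul, derivative_C, zero_mul, zero_add,
          Polynomial.map_sub, map_X, map_C, derivative_X, sub_zero, mul_one, derivative_map] at hd
        apply hc
        rw [← natDegree_map (algebraMap K Kbar), sub_eq_zero.mp hd, natDegree_C]
      have hdiff : h₁ ^ (e : ℕ) - h₂ ^ (e : ℕ) =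
          C (θ₂ - θ₁) * X + C (θ₁ * algebraMap K Kbar c₁ - θ₂ * algebraMap K Kbar c₂) := by
        rw [← hp₁, ← hp₂]
        simp only [pencil, Polynomial.map_sub, map_X, map_C, map_sub, map_mul]
        ring
      have heq := eq_of_natDegree_pow_sub_pow_le_one hm₁ hm₂
        (by rw [← hp₁]; exact pencil_natDegree hf (hlt _) _ _)
        (by rw [← hp₂]; exact pencil_natDegree hf (hlt _) _ _) he heKbar hn
        (by rw [hdiff]; exact natDegree_linear_le)
      rw [heq, sub_self] at hdiff
      have hθ : θ₂ = θ₁ := by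
        have := congrArg (fun p => coeff p 1) hdiff
        simp only [coeff_zero, coeff_add, coeff_C_mul, coeff_X_one, mul_one, coeff_C_succ,
          add_zero] at this
        exact (sub_eq_zero.mp this.symm)
      have hcc : θ₁ * (algebraMap K Kbar c₁ - algebraMap K Kbar c₂) = 0 := by
        have := congrArg (fun p => coeff p 0) hdiff
        simp only [coeff_zero, coeff_add, coeff_C_mul, coeff_X_zero, mul_zero, coeff_C_zero,
          zero_add, hθ] at this
        rw [mul_sub]; exact this.symm
      rcases mul_eq_zero.mp hcc with h0 | h0
      · exfalso
        rw [h0] at hp₁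
        have hfe : f.map (algebraMap K Kbar) = h₁ ^ (e : ℕ) := by
          rw [← hp₁]; simp [pencil]
        have hsf : (h₁ ^ (e : ℕ)).Separable := hfe ▸ hs.map
        have hu : IsUnit h₁ := by
          have h2 : h₁ * h₁ ∣ h₁ ^ (e : ℕ) := by rw [← pow_two]; exact pow_dvd_pow _ he
          exact hsf.squarefree h₁ h2
        rw [hm₁.isUnit_iff.mp hu, one_pow] at hfe
        have := hf.natDegree_map (algebraMap K Kbar)
        rw [hfe, natDegree_one] at this
        omega
      · exact (algebraMap K Kbar).injective (sub_eq_zero.mp h0)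
    have hfin : (⋃ e, {c | bad e c}).Finite := Set.finite_iUnion fun e =>
      Set.Subsingleton.finite fun c₁ h₁ c₂ h₂ => hbad e c₁ c₂ h₁ h₂
    obtain ⟨c, hcb⟩ := hfin.exists_notMem
    refine ⟨X - C c, X_sub_C_ne_zero c, hlt c, fun θ => ⟨fun hd => ?_, fun h e hm he heq => ?_⟩⟩
    · simp only [pencil, derivative_sub, derivative_mul, derivative_C, zero_mul, zero_add,
          Polynomial.map_sub, map_X, map_C, derivative_X, sub_zero, mul_one, derivative_map] at hd
      apply hc
      rw [← natDegree_map (algebraMap K Kbar), sub_eq_zero.mp hd, natDegree_C]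
    · have hnd := pencil_natDegree hf (hlt c) (algebraMap K Kbar) θ
      have hel : e ≤ f.natDegree := by
        rw [← hnd, heq, hm.natDegree_pow]
        refine Nat.le_mul_of_pos_right _ (Nat.pos_of_ne_zero fun h0 => ?_)
        rw [heq, hm.natDegree_pow, h0] at hnd
        omega
      exact hcb (Set.mem_iUnion.mpr ⟨⟨e, by omega⟩, θ, h, hm, he, heq⟩)

end Polynomials

end WittEt
namespace WittEt

open Polynomial

/-! ### The splitting principle. -/

section Splitting

set_option linter.unusedSectionVars false

variable {k K : Type u} [Field k] [Field K] [NeZero (2 : K)] {n : ℕ}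

/-- An invariant vanishes on all products of étale algebras of positive rank. -/
def Inv.VanishesOnProd (α : Inv k (FieldFunctor.et n)) : Prop :=
  ∀ {K : Type u} [Field K] [NeZero (2 : K)] (i : k →+* K) (x : Et K n), x.IsProd → α.toFun i x = 0

theorem infinite_laurentSeries (K : Type u) [Field K] : Infinite (LaurentSeries K) :=
  Infinite.of_injective (fun m : ℕ => (HahnSeries.single (m : ℤ) (1 : K) : LaurentSeries K))
    fun a b h => by
      have := congrArg HahnSeries.order h
      simp only [HahnSeries.order_single (one_ne_zero (α := K))] at this
      exact_mod_cast this

theorem not_isUnit_of_monic {f : K[X]} (hf : f.Monic) (hn : 0 < f.natDegree) : ¬IsUnit f := fun h => by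
  rw [hf.isUnit_iff.mp h, natDegree_one] at hn
  exact lt_irrefl _ hn

/-- The value at an irreducible member of a pencil of an invariant vanishing on products is zero. -/
theorem Inv.VanishesOnProd.eq_zero_of_irreducible [Infinite K] {α : Inv K (FieldFunctor.et n)}
    (hα : α.VanishesOnProd) (hn : 3 ≤ n) {f : K[X]} (hf : f.Monic) (hs : f.Separable)
    (hfn : f.natDegree = n) :
    α.toFun (RingHom.id K) (Et.mk (EtaleAlg.ofPoly f hf hs hfn)) = 0 := by
  obtain ⟨g, hg0, hfg, hg⟩ := exists_pencil hf hs (by omega)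
  have hmon : ∀ {L : Type u} [Field L] (i : K →+* L) (t : L), (pencil f g i t).Monic :=
    fun i t => pencil_monic hf hfg i t
  have hdeg : ∀ {L : Type u} [Field L] (i : K →+* L) (t : L), (pencil f g i t).natDegree = n :=
    fun i t => (pencil_natDegree hf hfg i t).trans hfn
  let E : ∀ {L : Type u} [Field L] (i : K →+* L) (t : L) (_ : (pencil f g i t).Separable), Et L n :=
    fun i t h => Et.mk (EtaleAlg.ofPoly (pencil f g i t) (hmon i t) h (hdeg i t))
  have hE : ∀ {L M : Type u} [Field L] [Field M] (i : K →+* L) (t : L)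
      (h : (pencil f g i t).Separable) (j : L →+* M) (h' : (pencil f g (j.comp i) (j t)).Separable),
      Et.map j (E i t h) = E (j.comp i) (j t) h' := fun i t h j h' =>
    (Et.map_mk_ofPoly j _ _ _ _).trans (Et.mk_ofPoly_congr (pencil_map f g i t j))
  have hEcongr : ∀ {L : Type u} [Field L] (i i' : K →+* L) (t t' : L) (hi : i = i') (ht : t = t')
      (h : (pencil f g i t).Separable) (h' : (pencil f g i' t').Separable), E i t h = E i' t' h' := by
    rintro L _ i _ t _ rfl rfl _ _
    rfl
  have hf0 : pencil f g (RingHom.id K) 0 = f := by simp [pencil]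
  have hs0 : (pencil f g (RingHom.id K) 0).Separable := hf0.symm ▸ hs
  have hE0 : E (RingHom.id K) 0 hs0 = Et.mk (EtaleAlg.ofPoly f hf hs hfn) := Et.mk_ofPoly_congr hf0
  -- the generic member
  have hsgen : (pencil f g (RatFunc.C (K := K)) RatFunc.X).Separable := by
    rw [← Polynomial.separable_map (expandAt (RingHom.id K) 0), pencil_map, expandAt_comp_C,
      expandAt_X]
    exact pencil_separable_of_residue _ _ hf hfg hs0
  set w := α.toFun (RatFunc.C (K := K)) (E RatFunc.C RatFunc.X hsgen) with hw
  have hwmap : ∀ {κ : Type u} [Field κ] [NeZero (2 : κ)] (i : K →+* κ) (θ : κ),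
      ∃ h, WittRing.map (expandAt i θ) w = α.toFun ((laurentC κ).comp i)
        (E ((laurentC κ).comp i) (laurentC κ θ + HahnSeries.single 1 1) h) := by
    intro κ _ _ i θ
    have h : (pencil f g ((expandAt i θ).comp RatFunc.C) (expandAt i θ RatFunc.X)).Separable := by
      rw [← pencil_map]; exact hsgen.map
    have h' := h
    rw [expandAt_comp_C, expandAt_X] at h'
    refine ⟨h', ?_⟩
    rw [hw, α.natural]
    have h1 : (FieldFunctor.et n).map (expandAt i θ) (E RatFunc.C RatFunc.X hsgen) = _ :=
      (hE RatFunc.C RatFunc.X hsgen (expandAt i θ) h).trans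
        (hEcongr _ _ _ _ (expandAt_comp_C i θ) (expandAt_X i θ) h h')
    rw [h1, expandAt_comp_C]
  -- specialization at a separable member
  have hsep : ∀ {κ : Type u} [Field κ] [NeZero (2 : κ)] (i : K →+* κ) (θ : κ)
      (h : (pencil f g i θ).Separable), WittRing.map (expandAt i θ) w =
        WittRing.map (laurentC κ) (α.toFun i (E i θ h)) := by
    intro κ _ _ i θ h
    obtain ⟨h', hm⟩ := hwmap i θ
    rw [hm, α.natural]
    congr 1
    exact (Et.map_laurentC_pencil i θ hf hfg hfn h).symm
  -- specialization at a reducible member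
  have hred : ∀ {κ : Type u} [Field κ] [NeZero (2 : κ)] [Algebra K κ] [Algebra.IsAlgebraic K κ]
      (θ : κ), ¬Irreducible (pencil f g (algebraMap K κ) θ) →
        WittRing.map (expandAt (algebraMap K κ) θ) w = 0 := by
    intro κ _ _ _ _ θ hirr
    have hu := not_isUnit_of_monic (hmon (algebraMap K κ) θ) (by rw [hdeg]; omega)
    -- A reducible member of this pencil is not a proper power, so it has coprime factors. By
    -- Hensel's lemma the expanded algebra is not a domain; by the structure of étale algebras it is
    -- a product, and the invariant vanishes on it.
    obtain ⟨a, b, ha, hb, hab, h⟩ := exists_isCoprime_mul_eq (hmon _ θ) hu hirr (hg θ).2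
    have hdom := not_isDomain_pencil (algebraMap K κ) θ hf hfg ha hb hab h
    obtain ⟨h', hm⟩ := hwmap (algebraMap K κ) θ
    rw [hm]
    refine hα _ _ ?_
    rcases (EtaleAlg.ofPoly _ (hmon ((laurentC κ).comp (algebraMap K κ))
      (laurentC κ θ + HahnSeries.single 1 1)) h' (hdeg _ _)).cases with h0 | ⟨h1, -⟩ | h2
    · omega
    · exact absurd h1 hdom
    · exact h2
  -- No residues: at an irreducible member, which is separable since its derivative is nonzero, the
  -- class extends from the residue field; at a reducible one it is zero.
  obtain ⟨c, hc⟩ := exists_eq_map_C w fun π hπ hπm => by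
    rw [residueAt_apply]
    have hfin : Module.Finite K (AdjoinRoot π) := hπm.finite_adjoinRoot
    have halg : Algebra.IsAlgebraic K (AdjoinRoot π) := inferInstance
    by_cases hirr : Irreducible (pencil f g (AdjoinRoot.of π) (AdjoinRoot.root π))
    · have h := (separable_iff_derivative_ne_zero hirr).mpr (hg (AdjoinRoot.root π)).1
      rw [hsep _ _ h, residue_one_map]
    · exact (congrArg _ (hred (AdjoinRoot.root π) hirr)).trans (map_zero _)
  have hcexp : ∀ {κ : Type u} [Field κ] [NeZero (2 : κ)] (i : K →+* κ) (θ : κ),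
      WittRing.map (expandAt i θ) w = WittRing.map ((laurentC κ).comp i) c := by
    intro κ _ _ i θ
    rw [hc, WittRing.map_map, expandAt_comp_C]
  -- At `t = f(x₀) / g(x₀)` the member has the root `x₀`, so it is reducible, its degree being at
  -- least three. There `w` specializes to zero, hence so does the constant `c`.
  obtain ⟨x₀, hx₀⟩ : ∃ x, g.eval x ≠ 0 := by
    by_contra! h
    exact hg0 (funext fun x => by rw [h x, eval_zero])
  have hc0 : c = 0 := by
    have hirr : ¬Irreducible (pencil f g (algebraMap K K) (f.eval x₀ / g.eval x₀)) := by
      intro hirr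
      have hroot : (pencil f g (algebraMap K K) (f.eval x₀ / g.eval x₀)).IsRoot x₀ := by
        simp [pencil, hx₀]
      have := degree_eq_one_of_irreducible_of_root hirr hroot
      have h1 := hdeg (algebraMap K K) (f.eval x₀ / g.eval x₀)
      rw [natDegree_eq_of_degree_eq_some (n := 1) this] at h1
      omega
    have h1 := hred _ hirr
    rw [hcexp] at h1
    exact map_laurentC_injective (h1.trans (map_zero _).symm)
  -- The member at `t = 0` is `f` itself, so its value is `c` as well.
  have hfin := hsep (RingHom.id K) 0 hs0
  rw [hcexp, hc0, map_zero, hE0] at hfin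
  exact map_laurentC_injective (hfin.symm.trans (map_zero _).symm)

theorem Inv.VanishesOnProd.restrict {α : Inv k (FieldFunctor.et n)} (hα : α.VanishesOnProd)
    (j : k →+* K) : (α.restrict j).VanishesOnProd := fun i x hx => hα (i.comp j) x hx

/-- The pencil argument needs an infinite field. A general `K` is replaced by `K((s))`, into whose
Witt ring `W(K)` injects. -/
theorem Inv.VanishesOnProd.eq_zero {α : Inv k (FieldFunctor.et n)} (hα : α.VanishesOnProd)
    (hn : 3 ≤ n) (i : k →+* K) (x : Et K n) : α.toFun i x = 0 := by
  have main : ∀ {L : Type u} [Field L] [NeZero (2 : L)] [Infinite L] (j : k →+* L) (y : Et L n),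
      α.toFun j y = 0 := by
    intro L _ _ _ j y
    obtain ⟨A, rfl⟩ := y.exists_mk
    rcases A.cases with h0 | ⟨-, f, -, hm, hs, hfn, hA⟩ | h2
    · omega
    · rw [hA]
      exact Inv.VanishesOnProd.eq_zero_of_irreducible (hα.restrict j) hn hm hs hfn
    · exact hα j _ h2
  have := infinite_laurentSeries K
  refine map_laurentC_injective ?_
  rw [α.natural, main, map_zero]

/-- An invariant of étale algebras that vanishes on multiquadratic algebras is zero. -/
theorem Inv.eq_zero_of_isMultiquadratic (n : ℕ) : ∀ {k : Type u} [Field k] (α : Inv k (FieldFunctor.et n))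
    (_ : ∀ {K : Type u} [Field K] [NeZero (2 : K)] (i : k →+* K) (x : Et K n),
      x.IsMultiquadratic → α.toFun i x = 0)
    {K : Type u} [Field K] [NeZero (2 : K)] (i : k →+* K) (x : Et K n), α.toFun i x = 0 := by
  induction n using Nat.strong_induction_on with
  | _ n ih =>
    intro k _ α hα K _ _ i x
    by_cases hn : n ≤ 2
    · exact hα i x (Et.isMultiquadratic_of_le_two hn x)
    refine Inv.VanishesOnProd.eq_zero ?_ (by omega) i x
    rintro L _ _ j y ⟨m₁, m₂, rfl, x₁, x₂, h₁, h₂, rfl⟩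
    let β := α.pullback (FieldFunctor.etProd m₁ m₂)
    -- Fix a multiquadratic first factor: the invariant of the second factor vanishes on
    -- multiquadratic algebras, hence identically. Then let the first factor vary, with the second
    -- fixed and arbitrary.
    have hβ : ∀ {M : Type u} [Field M] [NeZero (2 : M)] (l : L →+* M) (z : Et M m₁),
        z.IsMultiquadratic → (β.fixSnd j x₂).toFun l z = 0 := by
      intro M _ _ l z hz
      have h0 : (β.fixFst (l.comp j) z).toFun (RingHom.id M) (Et.map l x₂) = 0 :=
        ih m₂ (by omega) (β.fixFst (l.comp j) z) ?_ (RingHom.id M) (Et.map l x₂)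
      · change α.toFun (l.comp j) (Et.prod (Et.map (RingHom.id M) z) (Et.map l x₂)) = 0 at h0
        rwa [Et.map_id] at h0
      intro N _ _ o y hy
      refine hα _ _ (Et.IsMultiquadratic.prod ?_ hy)
      obtain ⟨a, rfl⟩ := hz
      exact ⟨_, Et.map_mk_multiquadratic o a⟩
    have := ih m₁ (by omega) (β.fixSnd j x₂) hβ (RingHom.id L) x₁
    change α.toFun j (Et.prod x₁ (Et.map (RingHom.id L) x₂)) = 0 at this
    rwa [Et.map_id] at this

end Splitting

end WittEt
namespace WittEt

open Polynomial QuadraticMap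

/-! ### Trace forms of étale algebras. -/

section TraceForm

set_option linter.unusedSectionVars false

variable {K L : Type u} [Field K] [NeZero (2 : K)] [Field L] [NeZero (2 : L)] {n : ℕ}

theorem EtaleAlg.traceForm_apply (A : EtaleAlg K n) (x : A.carrier) :
    A.traceForm.form x = Algebra.trace K A.carrier (x * x) := rfl

theorem EtaleAlg.polar_traceForm (A : EtaleAlg K n) (x y : A.carrier) :
    polar A.traceForm.form x y = 2 * Algebra.trace K A.carrier (x * y) := by
  have h : polar A.traceForm.form x y = Algebra.traceForm K A.carrier x y +
      Algebra.traceForm K A.carrier y x := LinearMap.BilinMap.polar_toQuadraticMap _ _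
  rw [h, Algebra.traceForm_apply, Algebra.traceForm_apply, mul_comm y x, two_mul]

theorem EtaleAlg.traceForm_congr {A B : EtaleAlg K n} (h : A ≈ B) : A.traceForm ≈ B.traceForm := by
  obtain ⟨e⟩ := h
  refine QuadSpace.iso_of_forall (V := A.traceForm) (W := B.traceForm) e.toLinearEquiv
    fun (x : A.carrier) => ?_
  change Algebra.trace K B.carrier (e x * e x) = Algebra.trace K A.carrier (x * x)
  rw [← map_mul, Algebra.trace_eq_of_algEquiv]

theorem EtaleAlg.trace_incl (f : K →+* L) (A : EtaleAlg K n) (x : A.carrier) :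
    Algebra.trace L (A.map f).carrier (A.incl f x) = f (Algebra.trace K A.carrier x) := by
  let _ := f.toAlgebra
  change Algebra.trace L (L ⊗[K] A.carrier) (1 ⊗ₜ x) = algebraMap K L _
  rw [Algebra.trace_apply, Algebra.trace_apply, ← LinearMap.trace_baseChange]
  congr 1
  ext y
  simp

theorem EtaleAlg.orthFam_incl (f : K →+* L) (A : EtaleAlg K n) {ι : Type*} {v : ι → A.carrier}
    (hv : OrthFam A.traceForm.form v) (hs : Submodule.span K (Set.range v) = ⊤) :
    OrthFam (A.map f).traceForm.form (fun i => A.incl f (v i)) ∧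
      Submodule.span L (Set.range fun i => A.incl f (v i)) = ⊤ ∧
        ∀ i, (A.map f).traceForm.form (A.incl f (v i)) = f (A.traceForm.form (v i)) := by
  have hval : ∀ i, (A.map f).traceForm.form (A.incl f (v i)) = f (A.traceForm.form (v i)) := by
    intro i
    rw [traceForm_apply, traceForm_apply, ← map_mul, trace_incl]
  refine ⟨⟨fun i j hij => ?_, fun i => ?_⟩, ?_, hval⟩
  · have := hv.1 i j hij
    rw [polar_traceForm] at this ⊢
    rw [← map_mul, trace_incl, ← map_ofNat f, ← map_mul, this, map_zero]
  · rw [hval]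
    exact (map_ne_zero f).mpr (hv.2 i)
  · rw [eq_top_iff, ← A.span_range_incl f, Submodule.span_le]
    rintro _ ⟨x, rfl⟩
    have hx : x ∈ Submodule.span K (Set.range v) := by rw [hs]; trivial
    induction hx using Submodule.span_induction with
    | mem x hx =>
      obtain ⟨i, rfl⟩ := hx
      exact Submodule.subset_span ⟨i, rfl⟩
    | zero => rw [map_zero]; exact zero_mem _
    | add x y _ _ hx hy => rw [map_add]; exact add_mem hx hy
    | smul l x _ hx =>
      rw [Algebra.smul_def, map_mul, incl_algebraMap, ← Algebra.smul_def]
      exact Submodule.smul_mem _ _ hx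

/-- The sum of the values of a form function over an orthogonal basis of the trace form. -/
noncomputable def Et.traceSum {A : Type*} [AddCommMonoid A] {φ : K → A} (hφ : IsFormFunction φ) :
    Et K n → A :=
  Quotient.lift (fun A => A.traceForm.formSum φ) fun _ _ h =>
    QuadSpace.formSum_congr hφ (EtaleAlg.traceForm_congr h)

theorem Et.traceSum_mk {A : Type*} [AddCommMonoid A] {φ : K → A} (hφ : IsFormFunction φ)
    (B : EtaleAlg K n) : traceSum hφ (mk B) = B.traceForm.formSum φ := rfl

/-- An orthogonal basis of the trace form remains one after extension of scalars. Allowing any form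
function covers both the Witt class of the trace form and its exterior powers. -/
theorem Et.traceSum_map {A A' : Type*} [AddCommMonoid A] [AddCommMonoid A'] {φ : K → A}
    (hφ : IsFormFunction φ) {φ' : L → A'} (hφ' : IsFormFunction φ') (f : K →+* L) (g : A →+ A')
    (h : ∀ a, g (φ a) = φ' (f a)) (x : Et K n) :
    g (traceSum hφ x) = traceSum hφ' (Et.map f x) := by
  obtain ⟨B, rfl⟩ := x.exists_mk
  obtain ⟨v, hv, hs⟩ := B.traceForm.exists_orthFam
  obtain ⟨h1, h2, h3⟩ := B.orthFam_incl f hv hs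
  rw [map_mk, traceSum_mk, traceSum_mk, QuadSpace.formSum_eq hφ B.traceForm hv hs,
    QuadSpace.formSum_eq hφ' (B.map f).traceForm h1 h2, map_sum]
  refine Finset.sum_congr rfl fun i _ => ?_
  rw [h3, h]

theorem isFormFunction_dg : IsFormFunction (WittRing.dg : K → WittRing K) where
  mul_sq a b _ hb := WittRing.dg_mul_sq a b hb
  add a b ha hb hab := by
    rw [WittRing.dg_add, mul_add, mul_one, ← map_mul, mul_comm (a + b)]

/-- The class of the trace form. -/
noncomputable def Et.trace (x : Et K n) : WittRing K := traceSum isFormFunction_dg x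

theorem Et.trace_mk (A : EtaleAlg K n) : Et.trace (mk A) = WittRing.mk A.traceForm := by
  obtain ⟨v, hv, hs⟩ := A.traceForm.exists_orthFam
  rw [Et.trace, traceSum_mk, QuadSpace.formSum_eq isFormFunction_dg A.traceForm hv hs,
    WittRing.mk_eq_sum A.traceForm hv hs]

theorem Et.map_trace (f : K →+* L) (x : Et K n) :
    WittRing.map f x.trace = (Et.map f x).trace :=
  traceSum_map isFormFunction_dg isFormFunction_dg f (WittRing.map f).toAddMonoidHom
    (fun a => WittRing.map_dg f a) x

theorem trace_root_quadratic (a : Kˣ) : Algebra.trace K (EtaleAlg.quadraticCarrier a)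
    (AdjoinRoot.root (X ^ 2 - C (a : K))) = 0 := by
  have hm := EtaleAlg.monic_quadratic a
  have hnt : Nontrivial (EtaleAlg.quadraticCarrier a) := Module.nontrivial_of_finrank_pos (R := K)
    (by rw [EtaleAlg.finrank_quadratic]; norm_num)
  have h := PowerBasis.trace_gen_eq_nextCoeff_minpoly (AdjoinRoot.powerBasis hm.ne_zero)
  rw [AdjoinRoot.powerBasis_gen, AdjoinRoot.minpoly_root hm.ne_zero, hm.leadingCoeff, inv_one, C_1,
    mul_one, nextCoeff_of_natDegree_pos (by rw [natDegree_X_pow_sub_C]; norm_num),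
    natDegree_X_pow_sub_C] at h
  rw [h]
  simp [coeff_X_pow]

theorem root_mul_root_quadratic (a : Kˣ) :
    (AdjoinRoot.root (X ^ 2 - C (a : K)) * AdjoinRoot.root (X ^ 2 - C (a : K)) :
      EtaleAlg.quadraticCarrier a) = algebraMap K _ (a : K) := by
  have := AdjoinRoot.eval₂_root (X ^ 2 - C (a : K))
  simp only [eval₂_sub, eval₂_pow, eval₂_X, eval₂_C] at this
  rw [← pow_two]
  exact sub_eq_zero.mp this

/-- The vectors `1` and `√a` of a quadratic algebra. -/
noncomputable def quadraticVec (a : Kˣ) : Bool → EtaleAlg.quadraticCarrier a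
  | false => 1
  | true => AdjoinRoot.root (X ^ 2 - C (a : K))

theorem trace_quadraticVec (a : Kˣ) (b c : Bool) : Algebra.trace K (EtaleAlg.quadraticCarrier a)
    (quadraticVec a b * quadraticVec a c) =
      if b = c then (if b then 2 * (a : K) else 2) else 0 := by
  have h1 : ∀ x : K, Algebra.trace K (EtaleAlg.quadraticCarrier a) (algebraMap K _ x) = 2 * x := by
    intro x
    rw [Algebra.trace_algebraMap, EtaleAlg.finrank_quadratic, nsmul_eq_mul, Nat.cast_ofNat]
  cases b <;> cases c
  · have := h1 1
    rw [map_one, mul_one] at this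
    simpa [quadraticVec] using this
  · simpa [quadraticVec] using trace_root_quadratic a
  · simpa [quadraticVec] using trace_root_quadratic a
  · have := h1 a
    rw [← root_mul_root_quadratic] at this
    simpa [quadraticVec] using this

theorem span_quadraticVec (a : Kˣ) : Submodule.span K (Set.range (quadraticVec a)) = ⊤ := by
  refine eq_top_iff.mpr fun x _ => ?_
  obtain ⟨p, rfl⟩ := AdjoinRoot.mk_surjective x
  have hs : ∀ b, quadraticVec a b ∈ Submodule.span K (Set.range (quadraticVec a)) :=
    fun b => Submodule.subset_span ⟨b, rfl⟩
  have hmul : ∀ y ∈ Submodule.span K (Set.range (quadraticVec a)),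
      AdjoinRoot.root (X ^ 2 - C (a : K)) * y ∈ Submodule.span K (Set.range (quadraticVec a)) := by
    intro y hy
    induction hy using Submodule.span_induction with
    | mem y hy =>
      obtain ⟨b, rfl⟩ := hy
      cases b
      · have := hs true
        simpa [quadraticVec] using this
      · change AdjoinRoot.root _ * AdjoinRoot.root _ ∈ _
        rw [root_mul_root_quadratic, Algebra.algebraMap_eq_smul_one]
        exact Submodule.smul_mem _ _ (hs false)
    | zero => rw [mul_zero]; exact zero_mem _
    | add x y _ _ hx hy => rw [mul_add]; exact add_mem hx hy
    | smul l x _ hx => rw [mul_smul_comm]; exact Submodule.smul_mem _ _ hx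
  have hpow : ∀ i : ℕ, (AdjoinRoot.root (X ^ 2 - C (a : K)) ^ i : EtaleAlg.quadraticCarrier a) ∈
      Submodule.span K (Set.range (quadraticVec a)) := by
    intro i
    induction i with
    | zero => rw [pow_zero]; exact hs false
    | succ i ih => simpa only [pow_succ'] using hmul _ ih
  induction p using Polynomial.induction_on' with
  | add p q hp hq => rw [map_add]; exact add_mem (hp trivial) (hq trivial)
  | monomial i c =>
    have : AdjoinRoot.mk (X ^ 2 - C (a : K)) (monomial i c) =
        c • AdjoinRoot.root (X ^ 2 - C (a : K)) ^ i := by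
      rw [← C_mul_X_pow_eq_monomial, map_mul, map_pow, AdjoinRoot.mk_X, AdjoinRoot.mk_C,
        Algebra.smul_def]
      rfl
    rw [this]
    refine Submodule.smul_mem _ _ (hpow i)

/-- The index set of an orthogonal basis of a multiquadratic algebra. -/
abbrev MultiquadraticIndex (n : ℕ) : Type := (Fin (n / 2) × Bool) ⊕ Fin (n - 2 * (n / 2))

/-- The first components of an orthogonal basis of a multiquadratic algebra. -/
noncomputable def multiquadraticFst (a : Fin (n / 2) → Kˣ) :
    MultiquadraticIndex n → ∀ j, EtaleAlg.quadraticCarrier (a j)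
  | .inl (j, b) => Pi.single j (quadraticVec (a j) b)
  | .inr _ => 0

/-- The second components of an orthogonal basis of a multiquadratic algebra. -/
def multiquadraticSnd : MultiquadraticIndex n → Fin (n - 2 * (n / 2)) → K
  | .inl _ => 0
  | .inr i => Pi.single i 1

/-- An orthogonal basis of a multiquadratic algebra. -/
noncomputable def multiquadraticVec (a : Fin (n / 2) → Kˣ) (i : MultiquadraticIndex n) :
    (EtaleAlg.multiquadratic n a).carrier :=
  (multiquadraticFst a i, multiquadraticSnd i)

/-- The diagonal entries of the trace form of a multiquadratic algebra. -/
def multiquadraticEntry (a : Fin (n / 2) → Kˣ) : MultiquadraticIndex n → K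
  | .inl (j, b) => if b then 2 * (a j : K) else 2
  | .inr _ => 1

theorem single_mul_single_of_ne {J : Type*} [DecidableEq J] {E : J → Type*}
    [∀ j, CommRing (E j)] {i j : J} (h : i ≠ j) (x : E i) (y : E j) :
    (Pi.single i x * Pi.single j y : ∀ j, E j) = 0 := by
  ext l
  by_cases hl : l = i
  · subst hl
    rw [Pi.mul_apply, Pi.single_eq_of_ne h y, mul_zero, Pi.zero_apply]
  · rw [Pi.mul_apply, Pi.single_eq_of_ne hl x, zero_mul, Pi.zero_apply]

theorem trace_multiquadraticVec (a : Fin (n / 2) → Kˣ) (i j : MultiquadraticIndex n) :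
    Algebra.trace K (EtaleAlg.multiquadratic n a).carrier
      (multiquadraticVec a i * multiquadraticVec a j) =
        if i = j then multiquadraticEntry a i else 0 := by
  have htr : Algebra.trace K (EtaleAlg.multiquadratic n a).carrier
      (multiquadraticVec a i * multiquadraticVec a j) =
        Algebra.trace K (∀ j, EtaleAlg.quadraticCarrier (a j))
          (multiquadraticFst a i * multiquadraticFst a j) +
        Algebra.trace K (Fin (n - 2 * (n / 2)) → K)
          (multiquadraticSnd i * multiquadraticSnd j) :=
    Algebra.trace_prod_apply (multiquadraticFst a i * multiquadraticFst a j,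
      multiquadraticSnd i * multiquadraticSnd j)
  rw [htr]
  rcases i with ⟨i, b⟩ | i <;> rcases j with ⟨j, c⟩ | j <;>
    simp only [multiquadraticFst, multiquadraticSnd, mul_zero, zero_mul, map_zero, add_zero, zero_add]
  · by_cases hij : i = j
    · subst hij
      rw [← Pi.single_mul, EtaleAlg.trace_single, trace_quadraticVec]
      simp [multiquadraticEntry]
    · rw [single_mul_single_of_ne hij, map_zero, if_neg (by simp [hij])]
  · simp
  · simp
  · by_cases hij : i = j
    · subst hij
      rw [← Pi.single_mul, EtaleAlg.trace_single (fun _ => K)]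
      simp [multiquadraticEntry]
    · rw [single_mul_single_of_ne hij, map_zero, if_neg (by simp [hij])]

theorem orthFam_multiquadraticVec (a : Fin (n / 2) → Kˣ) :
    OrthFam (EtaleAlg.multiquadratic n a).traceForm.form (multiquadraticVec a) := by
  have h2 : (2 : K) ≠ 0 := NeZero.ne 2
  refine ⟨fun i j hij => ?_, fun i => ?_⟩
  · rw [EtaleAlg.polar_traceForm, trace_multiquadraticVec, if_neg hij, mul_zero]
  · rw [EtaleAlg.traceForm_apply, trace_multiquadraticVec, if_pos rfl]
    rcases i with ⟨j, b⟩ | i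
    · cases b
      · simpa [multiquadraticEntry] using h2
      · simpa [multiquadraticEntry] using h2
    · exact one_ne_zero

theorem span_multiquadratic (a : Fin (n / 2) → Kˣ) :
    Submodule.span K (Set.range fun i : MultiquadraticIndex n =>
      ((multiquadraticFst a i, multiquadraticSnd i) :
        (∀ j, EtaleAlg.quadraticCarrier (a j)) × (Fin (n - 2 * (n / 2)) → K))) = ⊤ := by
  set S := Submodule.span K (Set.range fun i : MultiquadraticIndex n =>
      ((multiquadraticFst a i, multiquadraticSnd i) :
        (∀ j, EtaleAlg.quadraticCarrier (a j)) × (Fin (n - 2 * (n / 2)) → K)))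
  have h1 : ∀ j (y : EtaleAlg.quadraticCarrier (a j)),
      LinearMap.inl K _ (Fin (n - 2 * (n / 2)) → K) (Pi.single j y) ∈ S := by
    intro j y
    have hj : y ∈ Submodule.span K (Set.range (quadraticVec (a j))) := by
      rw [span_quadraticVec]; trivial
    have := Submodule.apply_mem_span_image_of_mem_span
      (LinearMap.inl K (∀ j, EtaleAlg.quadraticCarrier (a j)) (Fin (n - 2 * (n / 2)) → K) ∘ₗ
        LinearMap.single K _ j) hj
    refine Submodule.span_mono ?_ this
    rintro _ ⟨_, ⟨b, rfl⟩, rfl⟩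
    exact ⟨.inl (j, b), rfl⟩
  have h2 : ∀ j (y : K), LinearMap.inr K (∀ j, EtaleAlg.quadraticCarrier (a j)) _
      (Pi.single j y : Fin (n - 2 * (n / 2)) → K) ∈ S := by
    intro j y
    have : (Pi.single j y : Fin (n - 2 * (n / 2)) → K) = y • Pi.single j 1 := by
      rw [← Pi.single_smul, smul_eq_mul, mul_one]
    rw [this, map_smul]
    exact Submodule.smul_mem _ _ (Submodule.subset_span ⟨.inr j, rfl⟩)
  refine eq_top_iff.mpr fun x _ => ?_
  have hx : x = LinearMap.inl K _ _ x.1 + LinearMap.inr K _ _ x.2 := by simp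
  rw [hx, ← Finset.univ_sum_single x.1, ← Finset.univ_sum_single x.2, map_sum, map_sum]
  exact add_mem (sum_mem fun j _ => h1 j _) (sum_mem fun j _ => h2 j _)

theorem span_multiquadraticVec (a : Fin (n / 2) → Kˣ) :
    Submodule.span K (Set.range (multiquadraticVec a)) = ⊤ :=
  span_multiquadratic a

theorem Et.traceSum_multiquadratic {A : Type*} [AddCommMonoid A] {φ : K → A}
    (hφ : IsFormFunction φ) (a : Fin (n / 2) → Kˣ) :
    traceSum hφ (mk (EtaleAlg.multiquadratic n a)) =
      ∑ j, (φ 2 + φ (2 * (a j : K))) + (n - 2 * (n / 2)) • φ 1 := by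
  rw [traceSum_mk, QuadSpace.formSum_eq hφ _ (orthFam_multiquadraticVec a)
    (span_multiquadraticVec a)]
  have : ∀ i, (EtaleAlg.multiquadratic n a).traceForm.form (multiquadraticVec a i) =
      multiquadraticEntry a i := fun i => by
    rw [EtaleAlg.traceForm_apply, trace_multiquadraticVec, if_pos rfl]
  simp only [this, Fintype.sum_sum_type, Fintype.sum_prod_type, Fintype.sum_bool,
    multiquadraticEntry, Finset.sum_const, Finset.card_univ, Fintype.card_fin]
  simp only [if_true, Bool.false_eq_true, if_false, add_comm]

theorem traceForm_quadraticVec (a : Kˣ) (b : Bool) :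
    (EtaleAlg.quadratic a).traceForm.form (quadraticVec a b) = if b then 2 * (a : K) else 2 :=
  (trace_quadraticVec a b b).trans (if_pos rfl)

theorem orthFam_quadraticVec (a : Kˣ) : OrthFam (EtaleAlg.quadratic a).traceForm.form
    (quadraticVec a) := by
  have h2 : (2 : K) ≠ 0 := NeZero.ne 2
  refine ⟨fun i j hij => ?_, fun i => ?_⟩
  · refine ((EtaleAlg.quadratic a).polar_traceForm _ _).trans ?_
    rw [mul_eq_zero]
    exact Or.inr ((trace_quadraticVec a i j).trans (if_neg hij))
  · rw [traceForm_quadraticVec]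
    cases i
    · simpa using h2
    · simpa using h2

theorem Et.trace_quadratic (a : Kˣ) : Et.trace (mk (EtaleAlg.quadratic a)) =
    WittRing.dg 2 * (1 + WittRing.dg (a : K)) := by
  rw [Et.trace, traceSum_mk, QuadSpace.formSum_eq isFormFunction_dg (EtaleAlg.quadratic a).traceForm
    (orthFam_quadraticVec a) (span_quadraticVec a), Fintype.sum_bool, traceForm_quadraticVec,
    traceForm_quadraticVec]
  simp only [if_true, Bool.false_eq_true, if_false, map_mul]
  ring

end TraceForm

end WittEt
-- Bases of invariants valid over every base field.
namespace WittEt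

/-- A Witt invariant over all fields of characteristic different from two. -/
structure UInv (F : FieldFunctor.{u}) where
  toFun : ∀ {K : Type u} [Field K] [NeZero (2 : K)], F.obj K → WittRing K
  natural : ∀ {K L : Type u} [Field K] [NeZero (2 : K)] [Field L] [NeZero (2 : L)]
    (f : K →+* L) (x : F.obj K), WittRing.map f (toFun x) = toFun (F.map f x)

/-- Over every field `k`, the invariants `b` form a basis of the invariants of `F` over `k`. -/
structure IsBasis (F : FieldFunctor.{u}) {I : Type} [Fintype I] (b : I → UInv F) : Prop where
  exists_eq : ∀ {k : Type u} [Field k] [NeZero (2 : k)] (α : Inv k F), ∃ c : I → WittRing k,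
    ∀ {K : Type u} [Field K] [NeZero (2 : K)] (i : k →+* K) (x : F.obj K),
      α.toFun i x = ∑ j, WittRing.map i (c j) * (b j).toFun x
  eq_zero : ∀ {k : Type u} [Field k] [NeZero (2 : k)] (c : I → WittRing k),
    (∀ {K : Type u} [Field K] [NeZero (2 : K)] (i : k →+* K) (x : F.obj K),
      ∑ j, WittRing.map i (c j) * (b j).toFun x = 0) → ∀ j, c j = 0

namespace IsBasis

variable {F G : FieldFunctor.{u}} {I J : Type} [Fintype I] [Fintype J] {b : I → UInv F}
  {b' : J → UInv G}

theorem eq_of_sum_eq (hb : IsBasis F b) {k : Type u} [Field k] [NeZero (2 : k)]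
    {c d : I → WittRing k} (h : ∀ {K : Type u} [Field K] [NeZero (2 : K)] (i : k →+* K) (x : F.obj K),
      ∑ j, WittRing.map i (c j) * (b j).toFun x = ∑ j, WittRing.map i (d j) * (b j).toFun x) :
    c = d := by
  funext j
  rw [← sub_eq_zero]
  refine hb.eq_zero (fun j => c j - d j) (fun i x => ?_) j
  simp only [map_sub, sub_mul, Finset.sum_sub_distrib]
  rw [h, sub_self]

/-- Transport of a basis along a surjective natural transformation. -/
theorem of_hom (hb : IsBasis F b) (s : F.Hom G)
    (hs : ∀ {K : Type u} [Field K] [NeZero (2 : K)] (y : G.obj K), ∃ x : F.obj K, s.app x = y)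
    (e : I ≃ J) (h : ∀ {K : Type u} [Field K] [NeZero (2 : K)] (i : I) (x : F.obj K),
      (b' (e i)).toFun (s.app x) = (b i).toFun x) : IsBasis G b' where
  exists_eq α := by
    obtain ⟨c, hc⟩ := hb.exists_eq (α.pullback s)
    refine ⟨fun j => c (e.symm j), fun i y => ?_⟩
    obtain ⟨x, rfl⟩ := hs y
    refine (hc i x).trans ?_
    rw [← e.sum_comp]
    refine Finset.sum_congr rfl fun j _ => ?_
    simp only [h, e.symm_apply_apply]
  eq_zero c hc j := by
    have := hb.eq_zero (fun i => c (e i)) (fun i x => by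
      rw [← hc i (s.app x), ← e.sum_comp]
      exact Finset.sum_congr rfl fun j _ => by rw [h]) (e.symm j)
    rwa [e.apply_symm_apply] at this

/-- The product of an invariant of the first variable and an invariant of the second variable. -/
noncomputable def _root_.WittEt.UInv.prod (β : UInv F) (γ : UInv G) : UInv (F.prod G) where
  toFun x := β.toFun x.1 * γ.toFun x.2
  natural f x := by rw [map_mul, β.natural, γ.natural]

/-- Fix the second variable and expand in the first basis, over the field where the second variable
lives. Uniqueness makes the coefficients natural in the second variable, so they are invariants of
`G` over `k` and can be expanded in turn. This is why `IsBasis` is required over all base fields at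
once. -/
theorem prod (hb : IsBasis F b) (hb' : IsBasis G b') :
    IsBasis (F.prod G) fun p : I × J => (b p.1).prod (b' p.2) where
  exists_eq {k} _ _ α := by
    choose c hc using fun {K : Type u} [Field K] [NeZero (2 : K)] (i : k →+* K) (y : G.obj K) =>
      hb.exists_eq (α.fixSnd i y)
    let γ : I → Inv k G := fun j =>
      { toFun := fun i y => c i y j
        natural := fun {K L} _ _ _ _ i f y => by
          have : (fun j => WittRing.map f (c i y j)) = c (f.comp i) (G.map f y) := by
            refine hb.eq_of_sum_eq fun {M} _ _ l x => ?_
            have h1 := hc (f.comp i) (G.map f y) l x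
            have h2 := hc i y (l.comp f) x
            rw [← h1]
            simp only [WittRing.map_map]
            rw [← h2]
            change α.toFun _ (x, _) = α.toFun _ (x, _)
            rw [G.map_map]
            rfl
          exact congrFun this j }
    choose d hd using fun j => hb'.exists_eq (γ j)
    refine ⟨fun p => d p.1 p.2, fun {K} _ _ i x => ?_⟩
    have h1 : α.toFun i x = ∑ j, c i x.2 j * (b j).toFun x.1 := by
      have h2 := hc i x.2 (RingHom.id K) x.1
      simp only [WittRing.map_id] at h2
      rw [← h2]
      change α.toFun i x = α.toFun i (x.1, G.map (RingHom.id K) x.2)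
      rw [G.map_id]
    rw [h1, Fintype.sum_prod_type]
    refine Finset.sum_congr rfl fun j _ => ?_
    have h2 : c i x.2 j = _ := hd j i x.2
    rw [h2, Finset.sum_mul]
    refine Finset.sum_congr rfl fun l _ => ?_
    rw [mul_assoc, mul_comm ((b' l).toFun _)]
    rfl
  eq_zero c hc p := by
    have h1 : ∀ {K : Type u} [Field K] [NeZero (2 : K)] (i₀ : _ →+* K) (y : G.obj K) (i : I),
        ∑ j, WittRing.map i₀ (c (i, j)) * (b' j).toFun y = 0 := by
      intro K _ _ i₀ y
      refine hb.eq_zero (fun i => ∑ j, WittRing.map i₀ (c (i, j)) * (b' j).toFun y) fun l x => ?_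
      have := hc (l.comp i₀) (x, G.map l y)
      rw [Fintype.sum_prod_type] at this
      rw [← this]
      refine Finset.sum_congr rfl fun i _ => ?_
      rw [map_sum, Finset.sum_mul]
      refine Finset.sum_congr rfl fun j _ => ?_
      rw [map_mul, WittRing.map_map, (b' j).natural, mul_assoc, mul_comm ((b' j).toFun _)]
      rfl
    exact hb'.eq_zero (fun j => c (p.1, j)) (fun i y => h1 i y p.1) p.2

/-- The product of invariants of the components of a tuple. -/
noncomputable def _root_.WittEt.UInv.pi {ι : Type} [Fintype ι] {F : ι → FieldFunctor.{u}}
    (β : ∀ j, UInv (F j)) : UInv (FieldFunctor.pi F) where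
  toFun x := ∏ j, (β j).toFun (x j)
  natural f x := by
    rw [map_prod]
    exact Finset.prod_congr rfl fun j _ => (β j).natural f (x j)

/-- A tuple is its first component and its tail. -/
def _root_.WittEt.FieldFunctor.consHom {r : ℕ} (F : Fin (r + 1) → FieldFunctor.{u}) :
    ((F 0).prod (FieldFunctor.pi fun j : Fin r => F j.succ)).Hom (FieldFunctor.pi F) where
  app {K} _ _ x := Fin.cons (α := fun j => (F j).obj K) x.1 x.2
  natural f x := funext fun j => by
    refine Fin.cases ?_ (fun j => ?_) j <;> rfl

theorem pi : ∀ (r : ℕ) {F : Fin r → FieldFunctor.{u}} {I : Fin r → Type} [∀ j, Fintype (I j)]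
    {b : ∀ j, I j → UInv (F j)} (_ : ∀ j, IsBasis (F j) (b j)),
    IsBasis (FieldFunctor.pi F) fun p : ∀ j, I j => UInv.pi fun j => b j (p j)
  | 0, F, I, _, b, _ => {
    exists_eq := fun {k} _ _ α => by
      refine ⟨fun _ => α.toFun (RingHom.id k) fun j => j.elim0, fun {K} _ _ i x => ?_⟩
      rw [Fintype.sum_unique, α.natural]
      have : (UInv.pi fun j => b j ((default : ∀ j, I j) j)).toFun x = 1 := by
        exact Fintype.prod_empty fun j : Fin 0 => (b j ((default : ∀ j, I j) j)).toFun (x j)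
      rw [this, mul_one, RingHom.comp_id]
      exact congrArg _ (funext fun j => j.elim0)
    eq_zero := fun {k} _ _ c hc p => by
      have := hc (RingHom.id k) fun j => j.elim0
      rw [Fintype.sum_unique] at this
      have h1 : (UInv.pi fun j => b j ((default : ∀ j, I j) j)).toFun
        (fun j => j.elim0 : (FieldFunctor.pi F).obj k) = 1 := by
        exact Fintype.prod_empty fun j : Fin 0 =>
          (b j ((default : ∀ j, I j) j)).toFun (j.elim0 : (F j).obj k)
      rw [h1, mul_one, WittRing.map_id] at this
      rwa [Subsingleton.elim p default] }
  | r + 1, F, I, _, b, hb =>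
    ((hb 0).prod (pi r fun j => hb j.succ)).of_hom (FieldFunctor.consHom F)
      (fun y => ⟨(y 0, fun j => y j.succ), Fin.cons_self_tail y⟩) (Fin.consEquiv I)
      fun i x => Fin.prod_univ_succ _

end IsBasis

/-! ### Invariants of quadratic algebras. -/

section RankTwo

set_option linter.unusedSectionVars false

open Polynomial

variable {k : Type u} [Field k] [NeZero (2 : k)] {κ : Type u} [Field κ] [NeZero (2 : κ)]

/-- The constant invariant one. -/
noncomputable def UInv.one (F : FieldFunctor.{u}) : UInv F where
  toFun _ := 1
  natural f _ := map_one (WittRing.map f)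

/-- The class of the trace form. -/
noncomputable def UInv.trace (n : ℕ) : UInv (FieldFunctor.et n) where
  toFun x := Et.trace x
  natural f x := Et.map_trace f x

/-- The basis of the invariants of étale algebras of rank two. -/
noncomputable def rankTwoBasis : Bool → UInv (FieldFunctor.et.{u} 2)
  | false => UInv.one _
  | true => UInv.trace 2

/-- The indeterminate, as a unit of the field of rational functions. -/
noncomputable def ratFuncX (k : Type u) [Field k] : (RatFunc k)ˣ := Units.mk0 RatFunc.X RatFunc.X_ne_zero

theorem separable_pencil_quadratic (i : k →+* κ) {θ : κ} (hθ : θ ≠ 0) :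
    (pencil (X ^ 2) 1 i θ).Separable := by
  have h : pencil (X ^ 2) 1 i θ = X ^ 2 - C θ := by simp [pencil]
  rw [h]
  exact separable_X_pow_sub_C θ (by exact_mod_cast NeZero.ne (2 : κ)) hθ

theorem Et.mk_quadratic_eq_pencil (i : k →+* κ) {θ : κ} (hθ : θ ≠ 0)
    (hm : (pencil (X ^ 2) 1 i θ).Monic) (hs : (pencil (X ^ 2) 1 i θ).Separable)
    (hn : (pencil (X ^ 2) 1 i θ).natDegree = 2) :
    mk (EtaleAlg.quadratic (Units.mk0 θ hθ)) = mk (EtaleAlg.ofPoly _ hm hs hn) := by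
  have h : pencil (X ^ 2) 1 i θ = X ^ 2 - C θ := by simp [pencil]
  have hs' := hs
  have hn' := hn
  rw [h] at hs' hn'
  refine Eq.trans ?_ (mk_ofPoly_congr h (hm' := EtaleAlg.monic_quadratic (Units.mk0 θ hθ))
    (hs' := hs') (hn' := hn')).symm
  exact mk_eq_mk.mpr ⟨AlgEquiv.refl⟩

/-- `X ^ 2 - t` is the pencil spanned by `X ^ 2` and `1`, whose members are separable away from `t =
0`; there `Et.map_laurentC_pencil` applies. -/
theorem Et.map_expandAt_quadratic (i : k →+* κ) {θ : κ} (hθ : θ ≠ 0) :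
    Et.map (expandAt i θ) (mk (EtaleAlg.quadratic (ratFuncX k))) =
      Et.map (laurentC κ) (mk (EtaleAlg.quadratic (Units.mk0 θ hθ))) := by
  have hf : (X ^ 2 : k[X]).Monic := monic_X_pow 2
  have hfn : (X ^ 2 : k[X]).natDegree = 2 := natDegree_X_pow 2
  have hfg : (1 : k[X]).natDegree < (X ^ 2 : k[X]).natDegree := by rw [hfn, natDegree_one]; norm_num
  have hs := separable_pencil_quadratic i hθ
  have hne : laurentC κ θ + HahnSeries.single 1 1 ≠ 0 := by
    rw [← expandAt_X i θ]
    exact (_root_.map_ne_zero _).mpr RatFunc.X_ne_zero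
  rw [mk_quadratic_eq_pencil i hθ (pencil_monic hf hfg _ _) hs ((pencil_natDegree hf hfg _ _).trans hfn),
    map_laurentC_pencil i θ hf hfg hfn hs, ← mk_quadratic_eq_pencil _ hne, map_mk_quadratic]
  congr 2
  exact Units.ext (expandAt_X i θ)

theorem order_expandAt_X (i : k →+* κ) {θ : κ} (hθ : θ ≠ 0) :
    (expandAt i θ RatFunc.X).order = 0 ∧ (expandAt i θ RatFunc.X).leadingCoeff = θ := by
  have := order_expandPoly_of_eval (i := i) (θ := θ) (f := X) (by rwa [eval₂_X])
  rwa [← expandAt_algebraMap, RatFunc.algebraMap_X, eval₂_X] at this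

theorem residue_dg_expandAt_X (i : k →+* κ) {θ : κ} (hθ : θ ≠ 0) (r : ZMod 2) (w : WittRing κ) :
    residue r (WittRing.dg (expandAt i θ RatFunc.X) * WittRing.map (laurentC κ) w) =
      if (0 : ZMod 2) = r then WittRing.dg θ * w else 0 := by
  obtain ⟨h1, h2⟩ := order_expandAt_X i hθ
  rw [residue_dg_mul r ((_root_.map_ne_zero _).mpr RatFunc.X_ne_zero), h1, h2, Int.cast_zero]

theorem residue_dg_uniformizer (r : ZMod 2) (w : WittRing κ) :
    residue r (WittRing.dg (HahnSeries.single (1 : ℤ) (1 : κ) : LaurentSeries κ) *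
      WittRing.map (laurentC κ) w) = if (1 : ZMod 2) = r then w else 0 := by
  rw [residue_dg_mul r (HahnSeries.single_ne_zero one_ne_zero), HahnSeries.order_single one_ne_zero,
    HahnSeries.leadingCoeff_of_single, map_one, one_mul, Int.cast_one]

/-- The value at the generic quadratic algebra has a residue at most at `t = 0`. With `c₁` that
residue, carried to `k` along `k[t]/(t) ≃ k`, subtracting `⟨t⟩ c₁` leaves a class without residues,
that is, a constant `c₀`. -/
theorem Inv.exists_eq_rankTwo (α : Inv k (FieldFunctor.et 2)) : ∃ c₀ c₁ : WittRing k,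
    ∀ {K : Type u} [Field K] [NeZero (2 : K)] (i : k →+* K) (a : Kˣ),
      α.toFun i (Et.mk (EtaleAlg.quadratic a)) =
        WittRing.map i c₀ + WittRing.map i c₁ * WittRing.dg (a : K) := by
  set w := α.toFun (RatFunc.C (K := k)) (Et.mk (EtaleAlg.quadratic (ratFuncX k))) with hw
  have hexp : ∀ {κ : Type u} [Field κ] [NeZero (2 : κ)] (i : k →+* κ) {θ : κ} (hθ : θ ≠ 0),
      WittRing.map (expandAt i θ) w =
        WittRing.map (laurentC κ) (α.toFun i (Et.mk (EtaleAlg.quadratic (Units.mk0 θ hθ)))) := by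
    intro κ _ _ i θ hθ
    rw [hw, α.natural, α.natural, expandAt_comp_C]
    congr 1
    exact Et.map_expandAt_quadratic i hθ
  have : Fact (Irreducible (X : k[X])) := ⟨irreducible_X⟩
  let e : AdjoinRoot (X : k[X]) →+* k := AdjoinRoot.lift (RingHom.id k) 0 (by simp)
  have hroot : AdjoinRoot.root (X : k[X]) = 0 := by
    rw [← AdjoinRoot.mk_X, AdjoinRoot.mk_self]
  have hoe : (AdjoinRoot.of (X : k[X])).comp e = RingHom.id _ := by
    refine AdjoinRoot.ringHom_ext (RingHom.ext fun a => ?_) ?_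
    · simp [e]
    · simp [e, hroot]
  set c₁ := WittRing.map e (residueAt X w) with hc₁
  have hres : ∀ (π : k[X]) [Fact (Irreducible π)], π.Monic →
      residueAt π (w - WittRing.dg RatFunc.X * WittRing.map RatFunc.C c₁) = 0 := by
    intro π hπ hm
    rw [map_sub, residueAt_apply, residueAt_apply, map_mul, WittRing.map_map, expandAt_comp_C,
      ← WittRing.map_map (AdjoinRoot.of π), WittRing.map_dg]
    by_cases hr : AdjoinRoot.root π = 0
    · have hX : π = X := by
        have hd : π ∣ X := by
          rw [← AdjoinRoot.mk_eq_zero, AdjoinRoot.mk_X, hr]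
        exact eq_of_monic_of_associated hm monic_X (hπ.out.associated_of_dvd irreducible_X hd)
      subst hX
      rw [expandAt_X, hroot, map_zero, zero_add, residue_dg_uniformizer, if_pos rfl, hc₁,
        WittRing.map_map, hoe, WittRing.map_id, residueAt_apply, hroot, sub_self]
    · rw [hexp _ hr, residue_one_map, residue_dg_expandAt_X _ hr, if_neg (by decide), sub_zero]
  obtain ⟨c₀, hc₀⟩ := exists_eq_map_C _ hres
  refine ⟨c₀, c₁, fun {K} _ _ i a => ?_⟩
  -- Expand at `t = a`: the even residue recovers the value at `a`, since `t` has order zero and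
  -- leading coefficient `a` there.
  have h1 := hexp i a.ne_zero
  rw [sub_eq_iff_eq_add.mp hc₀, map_add, map_mul, WittRing.map_map, WittRing.map_map,
    expandAt_comp_C, ← WittRing.map_map i, ← WittRing.map_map i, WittRing.map_dg] at h1
  have h2 := congrArg (residue 0) h1
  rw [map_add, residue_zero_map, residue_zero_map, residue_dg_expandAt_X i a.ne_zero,
    if_pos rfl] at h2
  rw [mul_comm (WittRing.map i c₁), h2]
  congr 3
  exact Units.ext rfl

/-- The trace form of `E_a` is `⟨2⟩(1 + ⟨a⟩)` and `⟨2⟩² = 1`, so `1` and the trace span the same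
module as `1` and `⟨a⟩`. For independence take `a` to be the uniformizer of `k((s))` and read off
the coefficients as residues. -/
theorem isBasis_rankTwo : IsBasis (FieldFunctor.et.{u} 2) rankTwoBasis where
  exists_eq {k} _ _ α := by
    obtain ⟨c₀, c₁, h⟩ := α.exists_eq_rankTwo
    refine ⟨fun b => if b then WittRing.dg 2 * c₁ else c₀ - c₁, fun {K} _ _ i x => ?_⟩
    obtain ⟨a, rfl⟩ := Et.exists_eq_quadratic x
    rw [h, Fintype.sum_bool]
    simp only [if_true, Bool.false_eq_true, if_false, rankTwoBasis, UInv.one, UInv.trace,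
      Et.trace_quadratic, map_mul, map_sub, WittRing.map_dg, map_ofNat]
    have h2 : WittRing.dg (2 : K) * WittRing.dg 2 = 1 := WittRing.dg_mul_self (NeZero.ne 2)
    linear_combination (-WittRing.map i c₁ * (1 + WittRing.dg (a : K))) * h2
  eq_zero {k} _ _ c hc := by
    have h : ∀ {K : Type u} [Field K] [NeZero (2 : K)] (i : k →+* K) (a : Kˣ),
        WittRing.dg (a : K) * WittRing.map i (c true * WittRing.dg 2) +
          WittRing.map i (c true * WittRing.dg 2 + c false) = 0 := by
      intro K _ _ i a
      have := hc i (Et.mk (EtaleAlg.quadratic a))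
      rw [Fintype.sum_bool] at this
      simp only [rankTwoBasis, UInv.one, UInv.trace, Et.trace_quadratic] at this
      simp only [map_mul, map_add, WittRing.map_dg, map_ofNat]
      linear_combination this
    have hs := h (laurentC k) (Units.mk0 (HahnSeries.single (1 : ℤ) (1 : k))
      (HahnSeries.single_ne_zero one_ne_zero))
    have h1 := congrArg (residue 1) hs
    rw [Units.val_mk0, map_add, residue_dg_uniformizer, residue_one_map, if_pos rfl, add_zero,
      map_zero] at h1
    have h0 := congrArg (residue 0) hs
    rw [Units.val_mk0, map_add, residue_dg_uniformizer, residue_zero_map, if_neg (by decide),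
      zero_add, map_zero, h1, zero_add] at h0
    have h2 : WittRing.dg (2 : k) * WittRing.dg 2 = 1 := WittRing.dg_mul_self (NeZero.ne 2)
    have h3 : c true = 0 := by
      calc c true = c true * WittRing.dg 2 * WittRing.dg 2 := by rw [mul_assoc, h2, mul_one]
        _ = 0 := by rw [h1, zero_mul]
    intro j
    cases j
    · exact h0
    · exact h3

end RankTwo

end WittEt
namespace WittEt

/-! ### Exterior powers of the trace form and construction of the invariants `β`. -/

section ElemSymm

variable {R R' : Type*} [CommRing R] [CommRing R'] {m : ℕ}

theorem map_elemSymm (f : R →+* R') (i : ℕ) (x : Fin m → R) :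
    f (elemSymm i x) = elemSymm i fun j => f (x j) := by
  simp only [elemSymm, map_sum, map_prod]

theorem elemSymm_eq_zero {i : ℕ} (h : m < i) (x : Fin m → R) : elemSymm i x = 0 := by
  rw [elemSymm, Finset.powersetCard_eq_empty.mpr (by simpa using h), Finset.sum_empty]

theorem prod_mul_add_eq_sum_elemSymm (x : Fin m → R) (u v : R) :
    ∏ j, (x j * v + u) = ∑ l ∈ Finset.range (m + 1), elemSymm l x * (v ^ l * u ^ (m - l)) := by
  rw [Finset.prod_add, Finset.sum_powerset, Finset.card_univ, Fintype.card_fin]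
  refine Finset.sum_congr rfl fun l _ => ?_
  rw [elemSymm, Finset.sum_mul]
  refine Finset.sum_congr rfl fun J hJ => ?_
  have hc := (Finset.mem_powersetCard.mp hJ).2
  rw [Finset.prod_mul_distrib, Finset.prod_const, Finset.prod_const, hc,
    Finset.card_sdiff_of_subset (Finset.subset_univ J), hc, Finset.card_univ, Fintype.card_fin, mul_assoc]

end ElemSymm

section Lambda

open PowerSeries

set_option linter.unusedSectionVars false

variable {K L : Type u} [Field K] [NeZero (2 : K)] [Field L] [NeZero (2 : L)] {n : ℕ}

/-- The generating series of the exterior powers of a form of rank one. -/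
noncomputable def lambdaUnary (a : K) : Additive (PowerSeries (WittRing K)) :=
  Additive.ofMul (1 + C (WittRing.dg a) * X)

/-- In degree one the relation is `dg_add`; in degree two it says that both sides have determinant
`⟨a b⟩`. The values lie in a multiplicative monoid. The hyperbolic plane goes to `1 - X ^ 2`, not to
`1`, so the series is defined on isometry classes and does not descend to Witt classes. -/
theorem isFormFunction_lambdaUnary : IsFormFunction (lambdaUnary : K → _) where
  mul_sq a b _ hb := by rw [lambdaUnary, WittRing.dg_mul_sq a b hb, lambdaUnary]
  add a b ha hb hab := by
    have h1 := WittRing.dg_add a b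
    have h2 := WittRing.dg_mul_self hab
    refine Additive.toMul.injective ?_
    simp only [lambdaUnary, toMul_add, toMul_ofMul, map_mul] at h1 h2 ⊢
    have h1' := congrArg (C (R := WittRing K)) h1
    have h2' := congrArg (C (R := WittRing K)) h2
    simp only [map_mul, map_add, map_one] at h1' h2'
    linear_combination X * h1' - (C (WittRing.dg a) * C (WittRing.dg b) * X ^ 2) * h2'

/-- The generating series of the exterior powers of the trace form. -/
noncomputable def Et.lambdaTrace (x : Et K n) : PowerSeries (WittRing K) :=
  (traceSum isFormFunction_lambdaUnary x).toMul

theorem Et.map_lambdaTrace (f : K →+* L) (x : Et K n) :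
    PowerSeries.map (WittRing.map f) x.lambdaTrace = (Et.map f x).lambdaTrace := by
  refine congrArg Additive.toMul (traceSum_map isFormFunction_lambdaUnary isFormFunction_lambdaUnary f
    (PowerSeries.map (WittRing.map f) : _ →* _).toAdditive (fun a => ?_) x)
  refine Additive.toMul.injective ?_
  simp [lambdaUnary, WittRing.map_dg]

variable (K) in
/-- The coefficients of the exterior powers of the trace form of a multiquadratic algebra in the
elementary symmetric polynomials of the trace forms of its quadratic factors. -/
noncomputable def lambdaCoeff (n l : ℕ) : PowerSeries (WittRing K) :=
  (1 + X) ^ (n - 2 * (n / 2)) * ((X + C (WittRing.dg 2) * X ^ 2) ^ l * (1 - X ^ 2) ^ (n / 2 - l))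

theorem map_lambdaCoeff (f : K →+* L) (n l : ℕ) :
    PowerSeries.map (WittRing.map f) (lambdaCoeff K n l) = lambdaCoeff L n l := by
  simp [lambdaCoeff, WittRing.map_dg, map_ofNat f 2]

/-- The factor `X ^ l`, followed by a series with constant term one, shows that the passage from
elementary symmetric polynomials to exterior powers is unitriangular. -/
theorem lambdaCoeff_eq_X_pow_mul (n l : ℕ) : lambdaCoeff K n l =
    X ^ l * ((1 + X) ^ (n - 2 * (n / 2)) * ((1 + C (WittRing.dg 2) * X) ^ l * (1 - X ^ 2) ^ (n / 2 - l))) := by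
  have h : (X + C (WittRing.dg 2) * X ^ 2 : PowerSeries (WittRing K)) =
      X * (1 + C (WittRing.dg 2) * X) := by ring
  rw [lambdaCoeff, h, mul_pow]
  ring

theorem coeff_lambdaCoeff_of_lt {i l : ℕ} (h : i < l) : coeff i (lambdaCoeff K n l) = 0 := by
  rw [lambdaCoeff_eq_X_pow_mul, coeff_X_pow_mul', if_neg (by omega)]

theorem coeff_lambdaCoeff_self (i : ℕ) : coeff i (lambdaCoeff K n i) = 1 := by
  rw [lambdaCoeff_eq_X_pow_mul, coeff_X_pow_mul', if_pos le_rfl, Nat.sub_self,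
    coeff_zero_eq_constantCoeff]
  simp

/-- One quadratic factor contributes `1 + T X + ⟨a⟩ X²`, where `T = ⟨2⟩(1 + ⟨a⟩)` is its trace form.
Since `⟨a⟩ = ⟨2⟩ T - 1`, this is affine in `T`, and a product of affine functions expands in
elementary symmetric polynomials. A copy of `K` contributes `1 + X`. -/
theorem Et.lambdaTrace_multiquadratic (a : Fin (n / 2) → Kˣ) :
    lambdaTrace (mk (EtaleAlg.multiquadratic n a)) = ∑ l ∈ Finset.range (n / 2 + 1),
      C (elemSymm l fun j => trace (mk (EtaleAlg.quadratic (a j)))) * lambdaCoeff K n l := by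
  have h : ∀ j, (1 + C (WittRing.dg (2 : K)) * X) * (1 + C (WittRing.dg (2 * (a j : K))) * X) =
      C (trace (mk (EtaleAlg.quadratic (a j)))) * (X + C (WittRing.dg 2) * X ^ 2) + (1 - X ^ 2) := by
    intro j
    have h2 := congrArg (C (R := WittRing K)) (WittRing.dg_mul_self (NeZero.ne (2 : K)))
    rw [trace_quadratic]
    simp only [map_mul, map_add, map_one] at h2 ⊢
    linear_combination (-X ^ 2 : PowerSeries (WittRing K)) * h2
  rw [lambdaTrace, traceSum_multiquadratic, toMul_add, toMul_nsmul, toMul_sum]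
  simp only [lambdaUnary, toMul_add, toMul_ofMul, h, map_one, one_mul]
  rw [prod_mul_add_eq_sum_elemSymm, mul_comm, Finset.mul_sum]
  refine Finset.sum_congr rfl fun l _ => ?_
  rw [lambdaCoeff, map_elemSymm]
  ring

/-- There is an invariant whose values on multiquadratic algebras are the elementary symmetric polynomials
in the trace forms of the quadratic factors. -/
theorem exists_beta (n i : ℕ) : ∃ β : UInv (FieldFunctor.et.{u} n),
    ∀ {K : Type u} [Field K] [NeZero (2 : K)] (a : Fin (n / 2) → Kˣ),
      β.toFun (Et.mk (EtaleAlg.multiquadratic n a)) =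
        elemSymm i fun j => Et.trace (Et.mk (EtaleAlg.quadratic (a j))) := by
  induction i using Nat.strong_induction_on with
  | _ i ih =>
    by_cases hi : n / 2 < i
    · exact ⟨⟨fun _ => 0, fun f _ => map_zero (WittRing.map f)⟩, fun a => (elemSymm_eq_zero hi _).symm⟩
    · choose β hβ using ih
      -- Solve the unitriangular system: from the `i`-th exterior power subtract the contributions
      -- of the lower `β`.
      refine ⟨⟨fun {K} _ _ x => coeff i x.lambdaTrace -
        ∑ l : Fin i, (β l l.2).toFun x * coeff i (lambdaCoeff K n l), fun {K L} _ _ _ _ f x => ?_⟩,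
        fun {K} _ _ a => ?_⟩
      · rw [map_sub, map_sum, ← coeff_map, Et.map_lambdaTrace]
        congr 1
        refine Finset.sum_congr rfl fun l _ => ?_
        rw [map_mul, (β l l.2).natural, ← coeff_map, map_lambdaCoeff]
      · dsimp only
        rw [Et.lambdaTrace_multiquadratic, map_sum]
        simp only [coeff_C_mul, hβ]
        rw [← Finset.sum_subset (Finset.range_mono (by omega : i + 1 ≤ n / 2 + 1)), Finset.sum_range_succ,
          coeff_lambdaCoeff_self, mul_one, ← Fin.sum_univ_eq_sum_range
            (fun l => elemSymm l (fun j => Et.trace (Et.mk (EtaleAlg.quadratic (a j)))) *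
              coeff i (lambdaCoeff K n l)), add_sub_cancel_left]
        intro l _ hl
        rw [coeff_lambdaCoeff_of_lt (by simpa using hl), mul_zero]

/-- The invariant `β_i` of étale algebras of rank `n`. -/
noncomputable def beta (n i : ℕ) : UInv (FieldFunctor.et.{u} n) := (exists_beta n i).choose

theorem beta_multiquadratic (i : ℕ) (a : Fin (n / 2) → Kˣ) :
    (beta n i).toFun (Et.mk (EtaleAlg.multiquadratic n a)) =
      elemSymm i fun j => Et.trace (Et.mk (EtaleAlg.quadratic (a j))) :=
  (exists_beta n i).choose_spec a

end Lambda

end WittEt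
namespace WittEt

/-! ### Tuples of quadratic algebras and their permutations. -/

section Multiquadratic

set_option linter.unusedSectionVars false

variable {K L : Type u} [Field K] [NeZero (2 : K)] [Field L] [NeZero (2 : L)] {n : ℕ}

theorem Et.mk_multiquadratic_congr {a b : Fin (n / 2) → Kˣ}
    (h : ∀ j, mk (EtaleAlg.quadratic (a j)) = mk (EtaleAlg.quadratic (b j))) :
    mk (EtaleAlg.multiquadratic n a) = mk (EtaleAlg.multiquadratic n b) := by
  have h' : ∀ j, Nonempty (EtaleAlg.quadraticCarrier (a j) ≃ₐ[K] EtaleAlg.quadraticCarrier (b j)) :=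
    fun j => mk_eq_mk.mp (h j)
  exact mk_eq_mk.mpr ⟨AlgEquiv.prodCongr (AlgEquiv.piCongrRight fun j => (h' j).some) AlgEquiv.refl⟩

theorem Et.mk_multiquadratic_perm (a : Fin (n / 2) → Kˣ) (σ : Equiv.Perm (Fin (n / 2))) :
    mk (EtaleAlg.multiquadratic n fun j => a (σ j)) = mk (EtaleAlg.multiquadratic n a) :=
  mk_eq_mk.mpr ⟨AlgEquiv.prodCongr
    (AlgEquiv.piCongrLeft K (fun j => EtaleAlg.quadraticCarrier (a j)) σ) AlgEquiv.refl⟩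

variable (n) in
/-- The multiquadratic algebra with given quadratic factors. -/
noncomputable def multiquadraticHom :
    (FieldFunctor.pi fun _ : Fin (n / 2) => FieldFunctor.et.{u} 2).Hom (FieldFunctor.et n) where
  app x := Et.mk (EtaleAlg.multiquadratic n fun j => (Et.exists_eq_quadratic (x j)).choose)
  natural f x := by
    refine (Et.map_mk_multiquadratic f _).trans (Et.mk_multiquadratic_congr fun j => ?_)
    rw [← Et.map_mk_quadratic, ← (Et.exists_eq_quadratic (x j)).choose_spec,
      ← (Et.exists_eq_quadratic (Et.map f (x j))).choose_spec]

theorem multiquadraticHom_mk (a : Fin (n / 2) → Kˣ) :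
    (multiquadraticHom n).app (fun j => Et.mk (EtaleAlg.quadratic (a j))) =
      Et.mk (EtaleAlg.multiquadratic n a) :=
  Et.mk_multiquadratic_congr fun j =>
    (Et.exists_eq_quadratic (Et.mk (EtaleAlg.quadratic (a j)))).choose_spec.symm

theorem multiquadraticHom_perm (x : Fin (n / 2) → Et K 2) (σ : Equiv.Perm (Fin (n / 2))) :
    (multiquadraticHom n).app (fun j => x (σ j)) = (multiquadraticHom n).app x := by
  choose a ha using fun j => Et.exists_eq_quadratic (x j)
  obtain rfl : x = fun j => Et.mk (EtaleAlg.quadratic (a j)) := funext ha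
  rw [multiquadraticHom_mk, multiquadraticHom_mk, Et.mk_multiquadratic_perm]

theorem beta_multiquadraticHom (i : ℕ) (x : Fin (n / 2) → Et K 2) :
    (beta n i).toFun ((multiquadraticHom n).app x) = elemSymm i fun j => (x j).trace := by
  choose a ha using fun j => Et.exists_eq_quadratic (x j)
  obtain rfl : x = fun j => Et.mk (EtaleAlg.quadratic (a j)) := funext ha
  rw [multiquadraticHom_mk, beta_multiquadratic]

end Multiquadratic

/-! ### Symmetric functions of Boolean tuples. -/

section Symmetric

variable {m : ℕ}

/-- The number of indices with value `true`. -/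
def countTrue (p : Fin m → Bool) : ℕ := (Finset.univ.filter fun j => p j = true).card

theorem countTrue_le (p : Fin m → Bool) : countTrue p ≤ m :=
  (Finset.card_filter_le _ _).trans (by simp)

theorem exists_countTrue_eq {i : ℕ} (hi : i ≤ m) : ∃ p : Fin m → Bool, countTrue p = i := by
  obtain ⟨J, -, hJ⟩ := Finset.exists_subset_card_eq (s := (Finset.univ : Finset (Fin m)))
    (n := i) (by simpa using hi)
  exact ⟨fun j => decide (j ∈ J), by simp [countTrue, hJ]⟩

theorem exists_perm_of_countTrue_eq {p q : Fin m → Bool} (h : countTrue p = countTrue q) :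
    ∃ σ : Equiv.Perm (Fin m), ∀ j, q (σ j) = p j := by
  have hc : Fintype.card {j // p j = true} = Fintype.card {j // q j = true} := by
    rw [Fintype.card_subtype, Fintype.card_subtype]
    exact h
  let e := Fintype.equivOfCardEq hc
  refine ⟨e.extendSubtype, fun j => ?_⟩
  by_cases hj : p j = true
  · rw [hj]
    exact e.extendSubtype_mem j hj
  · have := e.extendSubtype_not_mem j hj
    rw [Bool.not_eq_true] at hj this
    rw [hj, this]

theorem sum_countTrue_mul_prod {R : Type*} [CommRing R] (w : ℕ → R) (x : Fin m → R) :
    ∑ p : Fin m → Bool, w (countTrue p) * ∏ j, (if p j then x j else 1) =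
      ∑ i : Fin (m + 1), w i * elemSymm i x := by
  rw [Fin.sum_univ_eq_sum_range (fun i => w i * elemSymm i x)]
  calc _ = ∑ J : Finset (Fin m), w J.card * ∏ j ∈ J, x j := by
        refine Finset.sum_nbij' (fun p => Finset.univ.filter fun j => p j = true)
          (fun J j => decide (j ∈ J)) (by simp) (by simp) (by simp) (by simp) fun p _ => ?_
        rw [Finset.prod_filter]
        rfl
    _ = _ := by
        rw [← Finset.powerset_univ, Finset.sum_powerset, Finset.card_univ, Fintype.card_fin]
        refine Finset.sum_congr rfl fun i _ => ?_
        rw [elemSymm, Finset.mul_sum]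
        refine Finset.sum_congr rfl fun J hJ => ?_
        rw [(Finset.mem_powersetCard.mp hJ).2]

end Symmetric

/-! ### The basis of the invariants of rank `n`. -/

section Basis

variable {n : ℕ}

theorem sum_mul_pi_rankTwoBasis {K : Type u} [Field K] [NeZero (2 : K)] (w : ℕ → WittRing K)
    (x : Fin (n / 2) → Et K 2) :
    ∑ p : Fin (n / 2) → Bool, w (countTrue p) *
        (UInv.pi fun j => rankTwoBasis (p j)).toFun (F := _) x =
      ∑ i : Fin (n / 2 + 1), w i * (beta n i).toFun ((multiquadraticHom n).app x) := by
  simp only [beta_multiquadraticHom]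
  rw [← sum_countTrue_mul_prod]
  refine Finset.sum_congr rfl fun p _ => congrArg _ ?_
  change ∏ j, (rankTwoBasis (p j)).toFun (x j) = _
  refine Finset.prod_congr rfl fun j _ => ?_
  cases p j <;> rfl

theorem isBasis_multiquadratic (n : ℕ) :
    IsBasis (FieldFunctor.pi fun _ : Fin (n / 2) => FieldFunctor.et.{u} 2)
      fun p : Fin (n / 2) → Bool => UInv.pi fun j => rankTwoBasis (p j) :=
  IsBasis.pi (n / 2) fun _ => isBasis_rankTwo

/-- On tuples of quadratic algebras the coordinates are indexed by Boolean tuples. Permuting the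
factors does not change the algebra, so by uniqueness a coordinate depends only on the number of
`true` entries. Thus the invariant agrees with a combination of the `β` on multiquadratic algebras,
and the splitting principle gives equality everywhere. Independence is read off on the same tuples.
-/
theorem isBasis_beta (n : ℕ) :
    IsBasis (FieldFunctor.et.{u} n) fun i : Fin (n / 2 + 1) => beta n i where
  exists_eq {k} _ _ α := by
    obtain ⟨c, hc⟩ := (isBasis_multiquadratic n).exists_eq (α.pullback (multiquadraticHom n))
    have hperm : ∀ (p : Fin (n / 2) → Bool) (σ : Equiv.Perm (Fin (n / 2))),
        c (fun j => p (σ j)) = c p := by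
      intro p σ
      refine congrFun ((isBasis_multiquadratic n).eq_of_sum_eq
        (c := fun p => c fun j => p (σ j)) (d := c) fun {K} _ _ i x => ?_) p
      have h1 := hc i fun j => x (σ j)
      have h2 : (α.pullback (multiquadraticHom n)).toFun i (fun j => x (σ j)) =
          (α.pullback (multiquadraticHom n)).toFun i x :=
        congrArg (α.toFun i) (multiquadraticHom_perm x σ)
      rw [← hc i x, ← h2, h1, ← (Equiv.arrowCongr σ (Equiv.refl Bool)).sum_comp]
      refine Finset.sum_congr rfl fun p _ => ?_
      have h3 : (fun j => (σ.arrowCongr (Equiv.refl Bool) p) (σ j)) = p := by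
        funext j; simp [Equiv.arrowCongr]
      rw [h3]
      congr 1
      change ∏ j, (rankTwoBasis (σ.arrowCongr (Equiv.refl Bool) p j)).toFun (x j) =
        ∏ j, (rankTwoBasis (p j)).toFun (x (σ j))
      rw [← Equiv.prod_comp σ]
      exact Finset.prod_congr rfl fun j _ => by rw [congrFun h3 j]
    have hcount : ∀ p q : Fin (n / 2) → Bool, countTrue p = countTrue q → c p = c q := by
      intro p q h
      obtain ⟨σ, hσ⟩ := exists_perm_of_countTrue_eq h
      rw [← hperm q σ]
      exact congrArg c (funext fun j => (hσ j).symm)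
    choose p₀ hp₀ using fun i : Fin (n / 2 + 1) => exists_countTrue_eq (Nat.lt_succ_iff.mp i.2)
    -- Extended by zero beyond `n / 2` only to be indexed by `ℕ`; the value of `countTrue` never
    -- exceeds `n / 2`.
    let d : ℕ → WittRing k := fun i => if h : i < n / 2 + 1 then c (p₀ ⟨i, h⟩) else 0
    have hd : ∀ p, c p = d (countTrue p) := by
      intro p
      have h : countTrue p < n / 2 + 1 := Nat.lt_succ_of_le (countTrue_le p)
      simp only [d, dif_pos h]
      exact hcount _ _ (hp₀ ⟨_, h⟩).symm
    let γ : Inv k (FieldFunctor.et n) :=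
      { toFun := fun {K} _ _ i x => α.toFun i x -
          ∑ j : Fin (n / 2 + 1), WittRing.map i (d j) * (beta n j).toFun x
        natural := fun i f x => by
          rw [map_sub, α.natural, map_sum]
          congr 1
          refine Finset.sum_congr rfl fun j _ => ?_
          rw [map_mul, WittRing.map_map, (beta n j).natural] }
    refine ⟨fun j => d j, fun {K} _ _ i x => sub_eq_zero.mp ?_⟩
    refine Inv.eq_zero_of_isMultiquadratic n γ (fun {K} _ _ i x hx => ?_) i x
    obtain ⟨a, rfl⟩ := hx
    refine sub_eq_zero.mpr ?_
    have h1 := sum_mul_pi_rankTwoBasis (fun l => WittRing.map i (d l))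
      fun j => Et.mk (EtaleAlg.quadratic (a j))
    simp only [← hd] at h1
    rw [multiquadraticHom_mk] at h1
    rw [← h1, ← multiquadraticHom_mk]
    exact hc i _
  eq_zero {k} _ _ c hc j := by
    let d : ℕ → WittRing k := fun i => if h : i < n / 2 + 1 then c ⟨i, h⟩ else 0
    have hd : ∀ i : Fin (n / 2 + 1), d i = c i := fun i => dif_pos i.2
    obtain ⟨p, hp⟩ := exists_countTrue_eq (Nat.lt_succ_iff.mp j.2)
    have h := (isBasis_multiquadratic n).eq_zero (fun p => d (countTrue p)) (fun {K} _ _ i x => by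
      rw [← hc i ((multiquadraticHom n).app x),
        sum_mul_pi_rankTwoBasis (fun l => WittRing.map i (d l)) x]
      simp only [hd]) p
    rwa [hp, hd] at h

theorem isBasis_prod_beta (r : ℕ) (n : Fin r → ℕ) :
    IsBasis (FieldFunctor.pi fun j => FieldFunctor.et.{u} (n j))
      fun i : ∀ j, Fin (n j / 2 + 1) => UInv.pi fun j => beta (n j) (i j) :=
  IsBasis.pi r fun j => isBasis_beta (n j)

end Basis

end WittEt
namespace WittEt

/-- A basis indexed by a finite type, from existence and uniqueness of coordinates. -/
noncomputable def basisOfSum {I R M : Type*} [Fintype I] [CommRing R] [AddCommGroup M] [Module R M]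
    (v : I → M) (h1 : ∀ m, ∃ c : I → R, m = ∑ i, c i • v i)
    (h2 : ∀ c : I → R, ∑ i, c i • v i = 0 → ∀ i, c i = 0) : Module.Basis I R M :=
  Module.Basis.mk (Fintype.linearIndependent_iff.mpr h2) fun m _ => by
    obtain ⟨c, rfl⟩ := h1 m
    exact sum_mem fun i _ => Submodule.smul_mem _ _ (Submodule.subset_span ⟨i, rfl⟩)

theorem basisOfSum_apply {I R M : Type*} [Fintype I] [CommRing R] [AddCommGroup M] [Module R M]
    (v : I → M) (h1 : ∀ m, ∃ c : I → R, m = ∑ i, c i • v i)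
    (h2 : ∀ c : I → R, ∑ i, c i • v i = 0 → ∀ i, c i = 0) (i : I) : basisOfSum v h1 h2 i = v i :=
  Module.Basis.mk_apply _ _ _

/-- Tuples of étale algebras of multidegree `n`. -/
noncomputable abbrev FieldFunctor.etTuple {ι : Type} (n : ι → ℕ) : FieldFunctor.{u} :=
  FieldFunctor.pi fun j => FieldFunctor.et (n j)

/-! ### Invariants over a fixed field. -/

section Over

set_option linter.unusedSectionVars false

variable {k : Type u} [Field k] [NeZero (2 : k)] {ι : Type} {n : ι → ℕ}

/-- A field extension given by a homomorphism. -/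
abbrev FieldExt.ofHom {K : Type u} [Field K] (i : k →+* K) : FieldExt k :=
  letI := i.toAlgebra
  ⟨K⟩

theorem InvOver.apply_ofHom (α : InvOver k n) (X : FieldExt k) (A : EtTuple X.carrier n) :
    α.1 (FieldExt.ofHom (algebraMap k X.carrier)) A = α.1 X A := by
  obtain ⟨K⟩ := X
  rename_i inst
  have : NeZero (2 : K) := neZero_two_of_hom (algebraMap k K)
  have h : (algebraMap k K).toAlgebra = inst := Algebra.algebra_ext _ _ fun _ => rfl
  exact congrArg (β := WittRing K) (fun inst' : Algebra k K => α.1 (@FieldExt.mk k _ K _ inst') A) h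

/-- The invariant of `FieldFunctor.etTuple n` given by an element of `InvOver k n`. -/
noncomputable def InvOver.toInv (α : InvOver k n) : Inv k (FieldFunctor.etTuple n) where
  toFun {K} _ _ i x := α.1 (FieldExt.ofHom i) x
  natural {K L} _ _ _ _ i f x := by
    let _ := i.toAlgebra
    let _ := f.toAlgebra
    let _ := (f.comp i).toAlgebra
    have : IsScalarTower k K L := IsScalarTower.of_algebraMap_eq' rfl
    have h := α.2 (FieldExt.ofHom i) (FieldExt.ofHom (f.comp i)) x
    have h1 : WittRing.map f = WittRing.baseChange K L := WittRing.map_algebraMap L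
    have h2 : (FieldFunctor.etTuple n).map f x = EtTuple.baseChange L x :=
      funext fun j => Et.map_algebraMap (x j)
    rw [h1, h2]
    exact h

/-- The element of `InvOver k n` given by a universal invariant. -/
noncomputable def UInv.toInvOver (β : UInv (FieldFunctor.etTuple.{u} n)) : InvOver k n :=
  ⟨fun _ A => β.toFun A, fun X Y _ _ A => by
    have h := β.natural (algebraMap X.carrier Y.carrier) A
    have h2 : (FieldFunctor.etTuple n).map (algebraMap X.carrier Y.carrier) A =
      EtTuple.baseChange Y.carrier A := funext fun j => Et.map_algebraMap (A j)
    rw [WittRing.map_algebraMap, h2] at h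
    exact h⟩

theorem UInv.sum_smul_toInvOver {I : Type} [Fintype I] (b : I → UInv (FieldFunctor.etTuple.{u} n))
    (c : I → WittRing k) (X : FieldExt k) (A : EtTuple X.carrier n) :
    (∑ j, c j • (b j).toInvOver : InvOver k n).1 X A =
      ∑ j, WittRing.map (algebraMap k X.carrier) (c j) * (b j).toFun A := by
  rw [AddSubmonoidClass.coe_finsetSum, Finset.sum_apply, Finset.sum_apply]
  refine Finset.sum_congr rfl fun j _ => ?_
  rw [WittRing.map_algebraMap]
  exact Algebra.smul_def (A := WittRing X.carrier) (c j) ((b j).toFun A)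

/-- A basis of the invariants over all fields gives a basis of `InvOver k n`. -/
noncomputable def IsBasis.basisInvOver {I : Type} [Fintype I]
    {b : I → UInv (FieldFunctor.etTuple.{u} n)} (hb : IsBasis (FieldFunctor.etTuple n) b) :
    Module.Basis I (WittRing k) (InvOver k n) :=
  basisOfSum (fun j => (b j).toInvOver) (fun α => by
    obtain ⟨c, hc⟩ := hb.exists_eq (InvOver.toInv α)
    refine ⟨c, Subtype.ext (funext fun X => funext fun A => ?_)⟩
    rw [UInv.sum_smul_toInvOver, ← hc]
    exact (InvOver.apply_ofHom α X A).symm)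
    fun c hc => hb.eq_zero c fun {K} _ _ i x => by
      have h := UInv.sum_smul_toInvOver b c (FieldExt.ofHom i) x
      rw [hc] at h
      exact h.symm

end Over

/-! ### Invariants over all fields away from a set of primes. -/

section Away

set_option linter.unusedSectionVars false

variable {S : Set ℕ} {ι : Type} {n : ι → ℕ}

theorem PrimeAway.ext_char {P Q : PrimeAway S} (h : P.char = Q.char) : P = Q := by
  cases P
  cases Q
  cases h
  rfl

theorem PrimeAway.ringChar_eq (P : PrimeAway S) {K : Type u} [Field K]
    (i : PrimeField.{u} P.char →+* K) : ringChar K = P.char :=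
  have : CharP K P.char := charP_of_injective_ringHom i.injective P.char
  ringChar.eq K P.char

/-- A field containing a prime field of characteristic not in `S`. -/
abbrev FieldAway.ofHom (P : PrimeAway S) {K : Type u} [Field K] [NeZero (2 : K)]
    (i : PrimeField.{u} P.char →+* K) : FieldAway.{u} S where
  carrier := K
  two_ne_zero := NeZero.ne 2
  char_notMem := by
    rw [P.ringChar_eq i]
    exact P.char_notMem

/-- Both the characteristic and the embedding of the prime field are determined by `X`, so any
homomorphism from a prime field computes the scalar action. -/
theorem FieldAway.algebraMap_eq (X : FieldAway.{u} S) (P : PrimeAway S)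
    (i : PrimeField.{u} P.char →+* X.carrier) (w : WittPrimeRing.{u} S) :
    algebraMap (WittPrimeRing.{u} S) (WittRing X.carrier) w = WittRing.map i (w P) := by
  have key : ∀ (Q : PrimeAway S) [CharP X.carrier Q.char] (_ : P = Q),
      X.fromPrime Q w = WittRing.map i (w P) := by
    rintro _ _ rfl
    let _ : Algebra (PrimeField.{u} P.char) X.carrier :=
      (primeFieldHom P.char X.carrier).toAlgebra
    rw [primeFieldHom_unique P.char X.carrier i
      (algebraMap (PrimeField.{u} P.char) X.carrier), WittRing.map_algebraMap]
    rfl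
  exact key X.primeAway (PrimeAway.ext_char (P.ringChar_eq i).symm)

/-- The invariant over a prime field given by an element of `InvAway S n`. -/
noncomputable def InvAway.toInv (α : InvAway.{u} S n) (P : PrimeAway S) :
    Inv (PrimeField.{u} P.char) (FieldFunctor.etTuple n) where
  toFun {K} _ _ i x := α.1 (FieldAway.ofHom P i) x
  natural {K L} _ _ _ _ i f x := by
    let _ := f.toAlgebra
    have h := α.2 (FieldAway.ofHom P i) (FieldAway.ofHom P (f.comp i)) x
    have h1 : WittRing.map f = WittRing.baseChange K L := WittRing.map_algebraMap L
    have h2 : (FieldFunctor.etTuple n).map f x = EtTuple.baseChange L x :=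
      funext fun j => Et.map_algebraMap (x j)
    rw [h1, h2]
    exact h

/-- The element of `InvAway S n` given by a universal invariant. -/
noncomputable def UInv.toInvAway (β : UInv (FieldFunctor.etTuple.{u} n)) : InvAway.{u} S n :=
  ⟨fun _ A => β.toFun A, fun X Y _ A => by
    have h := β.natural (algebraMap X.carrier Y.carrier) A
    have h2 : (FieldFunctor.etTuple n).map (algebraMap X.carrier Y.carrier) A =
      EtTuple.baseChange Y.carrier A := funext fun j => Et.map_algebraMap (A j)
    rw [WittRing.map_algebraMap, h2] at h
    exact h⟩

theorem UInv.sum_smul_toInvAway {I : Type} [Fintype I] (b : I → UInv (FieldFunctor.etTuple.{u} n))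
    (c : I → WittPrimeRing.{u} S) (X : FieldAway.{u} S) (P : PrimeAway S)
    (i : PrimeField.{u} P.char →+* X.carrier) (A : EtTuple X.carrier n) :
    (∑ j, c j • (b j).toInvAway : InvAway.{u} S n).1 X A =
      ∑ j, WittRing.map i (c j P) * (b j).toFun A := by
  rw [AddSubmonoidClass.coe_finsetSum, Finset.sum_apply, Finset.sum_apply]
  refine Finset.sum_congr rfl fun j _ => ?_
  rw [← X.algebraMap_eq]
  exact Algebra.smul_def (A := WittRing X.carrier) (c j) ((b j).toFun A)

/-- A field lies over exactly one prime field. Restricting an invariant to the extensions of each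
prime field and taking coordinates there gives a vector over the product of the Witt rings; no
compatibility between different characteristics is required. -/
theorem IsBasis.exists_basisInvAway {I : Type} [Fintype I]
    {b : I → UInv (FieldFunctor.etTuple.{u} n)} (hb : IsBasis (FieldFunctor.etTuple n) b) (S : Set ℕ) :
    ∃ B : Module.Basis I (WittPrimeRing.{u} S) (InvAway.{u} S n), ∀ j, B j = (b j).toInvAway := by
  refine ⟨basisOfSum (fun j => (b j).toInvAway) (fun α => ?_) fun c hc j => ?_,
    basisOfSum_apply _ _ _⟩
  · choose c hc using fun P : PrimeAway S => hb.exists_eq (InvAway.toInv α P)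
    refine ⟨fun j P => c P j, Subtype.ext (funext fun X => funext fun A => ?_)⟩
    let i := primeFieldHom X.primeAway.char X.carrier
    rw [UInv.sum_smul_toInvAway b _ X X.primeAway i A]
    exact hc X.primeAway i A
  · funext P
    refine hb.eq_zero (fun j => c j P) (fun {K} _ _ i x => ?_) j
    have h := UInv.sum_smul_toInvAway b c (FieldAway.ofHom P i) P i x
    rw [hc] at h
    exact h.symm

/-- The invariant `β_i` of étale algebras of rank `n`, as a one-variable invariant. -/
noncomputable def betaInv (n i : ℕ) : InvAway.{u} ∅ fun _ : Fin 1 => n :=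
  UInv.toInvAway (n := fun _ : Fin 1 => n) (UInv.pi fun _ => beta n i)

theorem betaInv_apply (n i : ℕ) (X : FieldAway.{u} ∅) (A : EtTuple X.carrier fun _ : Fin 1 => n) :
    (betaInv n i).1 X A = (beta n i).toFun (A 0) :=
  Fin.prod_univ_one fun j : Fin 1 => (beta n i).toFun (A j)

theorem restrictsToBeta_betaInv (n i : ℕ) : RestrictsToBeta.{u} n i (betaInv n i) := by
  intro X a
  rw [betaInv_apply, beta_multiquadratic]
  simp only [Et.trace_mk]

/-- The difference vanishes on multiquadratic algebras; restricted to the extensions of the prime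
field of `X`, it is zero by the splitting principle. -/
theorem RestrictsToBeta.eq {n i : ℕ} {b b' : InvAway.{u} ∅ fun _ : Fin 1 => n}
    (h : RestrictsToBeta n i b) (h' : RestrictsToBeta n i b') : b = b' := by
  refine Subtype.ext (funext fun X => funext fun A => sub_eq_zero.mp ?_)
  let γ : Inv (PrimeField.{u} X.primeAway.char) (FieldFunctor.et n) :=
    { toFun := fun {K} _ _ i x => (InvAway.toInv (b - b') X.primeAway).toFun i fun _ => x
      natural := fun i f x => (InvAway.toInv (b - b') X.primeAway).natural i f fun _ => x }
  have := Inv.eq_zero_of_isMultiquadratic n γ (fun {K} _ _ i x hx => by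
    obtain ⟨a, rfl⟩ := hx
    exact sub_eq_zero.mpr ((h (FieldAway.ofHom X.primeAway i) a).trans
      (h' (FieldAway.ofHom X.primeAway i) a).symm)) (primeFieldHom X.primeAway.char X.carrier) (A 0)
  have hA : A = fun _ => A 0 := funext fun j => by rw [Subsingleton.elim j 0]
  rw [hA]
  exact this

/-- Multi-indices as tuples of elements of finite types. -/
def multiIndicesEquiv {r : ℕ} (n : Fin (r + 1) → ℕ) : multiIndices n ≃ ∀ j, Fin (n j / 2 + 1) where
  toFun i j := ⟨i.1 j, Nat.lt_succ_of_le (i.2 j)⟩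
  invFun p := ⟨fun j => p j, fun j => Nat.le_of_lt_succ (p j).2⟩
  left_inv _ := rfl
  right_inv _ := rfl

theorem exists_basis_prodInv (S : Set ℕ) (r : ℕ) (n : Fin (r + 1) → ℕ) :
    ∃ B : Module.Basis (multiIndices n) (WittPrimeRing.{u} S) (InvAway.{u} S n),
      ∀ i : multiIndices n, B i = prodInv betaInv S n i := by
  obtain ⟨B, hB⟩ := (isBasis_prod_beta (r + 1) n).exists_basisInvAway S
  refine ⟨B.reindex (multiIndicesEquiv n).symm, fun i => ?_⟩
  rw [Module.Basis.reindex_apply, hB]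
  refine Subtype.ext (funext fun X => funext fun A => ?_)
  change ∏ j, (beta (n j) (i.1 j)).toFun (A j) = ∏ j, (betaInv (n j) (i.1 j)).1 X.toAll fun _ => A j
  refine Finset.prod_congr rfl fun j _ => ?_
  exact (betaInv_apply _ _ X.toAll fun _ => A j).symm

end Away

end WittEt
theorem mainTheorem9 :
    (∀ (k : Type u) [Field k] [NeZero (2 : k)] (r : ℕ) (n : Fin (r + 1) → ℕ),
      Module.Free (WittEt.WittRing k) (WittEt.InvOver k n)) ∧
    ∃ β : ∀ n _ : ℕ, WittEt.InvAway.{u} ∅ fun _ : Fin 1 => n,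
      (∀ n i : ℕ, ∀ b : WittEt.InvAway.{u} ∅ fun _ : Fin 1 => n,
        WittEt.RestrictsToBeta n i b ↔ b = β n i) ∧
      ∀ S : Set ℕ, (∀ p ∈ S, p.Prime) → 2 ∈ S → ∀ (r : ℕ) (n : Fin (r + 1) → ℕ),
        ∃ B : Module.Basis (WittEt.multiIndices n) (WittEt.WittPrimeRing.{u} S)
            (WittEt.InvAway.{u} S n),
          ∀ i : WittEt.multiIndices n, B i = WittEt.prodInv β S n i := by
  refine ⟨fun k _ _ r n => Module.Free.of_basis
    (WittEt.isBasis_prod_beta (r + 1) n).basisInvOver, WittEt.betaInv, fun n i b => ⟨fun h =>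
      h.eq (WittEt.restrictsToBeta_betaInv n i), fun h => h ▸ WittEt.restrictsToBeta_betaInv n i⟩,
    fun S _ _ r n => WittEt.exists_basis_prodInv S r n⟩
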